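/- **Setting.** Let $f\in\mathbb C[\mathbf x]=\mathbb C[x_1,\dots,x_n]$ be of chain type, $f=x_1^{a_1}x_2+\dots+x_{n-1}^{a_{n-1}}x_n+x_n^{a_n}$ ($n\ge1$), or of loop type, $f=x_1^{a_1}x_2+\dots+x_{n-1}^{a_{n-1}}x_n+x_n^{a_n}x_1$ ($n\ge2$), with positive integers $a_i$, and assume that $f$ is invertible: it is weighted homogeneous with positive integer weights and degree, its Jacobian algebra $\mathrm{Jac}(f)=\mathbb C[\mathbf x]/(\partial f/\partial x_1,\dots,\partial f/\partial x_n)$ is finite-dimensional, and it is a combination with nonzero coefficients of $n$ monomials whose exponent matrix is invertible over $\mathbb Q$. Let $\mathbf e[t]=\exp(2\pi\sqrt{-1}\,t)$, let $G_f=\{\lambda\in(\mathbb C^*)^n: f(\lambda_1x_1,\dots,\lambda_nx_n)=f(\mathbf x)\}$, and let $g=(g_1,\dots,g_n)=(\mathbf e[\alpha_1],\dots,\mathbf e[\alpha_n])\in G_f\setminus\{\mathrm{id}\}$ with $0\le\alpha_i<1$. Put $\mathrm{age}(g)=\sum_i\alpha_i$, $I_g=\{i: g_i=1\}$, $I_g^c=\{1,\dots,n\}\setminus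 I_g$, $d_g=|I_g^c|$, $g(\mathbf x)=(g_1x_1,\dots,g_nx_n)$, and let $f^g$ be the restriction of $f$ to $\mathrm{Fix}(g)=\{x_j=0,\ j\in I_g^c\}$, a polynomial in the $x_i$, $i\in I_g$. For a polynomial $p$ let $\mu_p=\dim_{\mathbb C}\mathrm{Jac}(p)$ and let $\mathrm{hess}(p)$ be its Hessian determinant (with $\mathrm{Jac}=\mathbb C$, $\mathrm{hess}=1$ if there are no variables). Put $$H_{g,g^{-1}}=\widetilde m_{g,g^{-1}}\det\Big(\frac{\partial^2f}{\partial x_i\partial x_j}\Big)_{i,j\in I_g^c},\qquad \frac1{\mu_{f^g}}[\mathrm{hess}(f^g)H_{g,g^{-1}}]=\frac1{\mu_f}[\mathrm{hess}(f)]\ \text{ in }\mathrm{Jac}(f),$$ where the second equation determines the constant $\widetilde m_{g,g^{-1}}\in\mathbb C$. **Shklyarov's structure constants.** For $p\in\mathbb C[\mathbf x]$ let $\nabla_i^{\mathbf x\to(\mathbf x,\mathbf y)}(p)\in\mathbb C[\mathbf x,\mathbf y]$ be the exact quotient of $p(y_1,\dots,y_{i-1},x_i,\dots,x_n)-p(y_1,\dots,y_i,x_{i+1},\dots,x_n)$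 by $x_i-y_i$, and let $\nabla_i^{\mathbf x\to(\mathbf x,\psi(\mathbf x))}(p)$ be its restriction to $\mathbf y=\psi(\mathbf x)$. Let $\mathbf x^g$ have coordinates $x_i$ for $i\in I_g$ and $0$ for $i\in I_g^c$. With anticommuting variables $\theta_1,\dots,\theta_n$ put $$\mathrm H_f(\mathbf x,\mathbf y,\mathbf z)=\sum_{j\le i}\nabla_j^{\mathbf y\to(\mathbf y,\mathbf z)}\nabla_i^{\mathbf x\to(\mathbf x,\mathbf y)}(f)\,\theta_i\otimes\theta_j,\qquad \mathrm H_{f,g}(\mathbf x)=\sum_{i,j\in I_g^c,\ j<i}\frac1{1-g_j}\nabla_j^{\mathbf x\to(\mathbf x,\mathbf x^g)}\nabla_i^{\mathbf x\to(\mathbf x,g(\mathbf x))}(f)\,\theta_j\theta_i .$$ For $g,h\in G_f$ let $d_{g,h}=\frac12(d_g+d_h-d_{gh})$. If $d_{g,h}$ is not a non-negative integer, put $\sigma_{g,h}=0$. Otherwise $\sigma_{g,h}\in\mathrm{Jac}(f^{gh})$ is the coefficient of $\partial_{\theta_{I_{gh}^c}}$ in $$\frac1{d_{g,h}!}\Upsilon\Big(\big(\lfloor\mathrm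 H_f(\mathbf x,g(\mathbf x),\mathbf x)\rfloor_{gh}+\lfloor\mathrm H_{f,g}(\mathbf x)\rfloor_{gh}\otimes1+1\otimes\lfloor\mathrm H_{f,h}(g(\mathbf x))\rfloor_{gh}\big)^{d_{g,h}}\otimes\partial_{\theta_{I_g^c}}\otimes\partial_{\theta_{I_h^c}}\Big),$$ where $\lfloor-\rfloor_{gh}$ reduces the coefficients to $\mathrm{Jac}(f^{gh})$; the power is taken in the tensor product of two copies of the graded algebra $\mathbb C[\theta]$ with the Koszul sign rule $(p_1\otimes p_2)(p_1'\otimes p_2')=(-1)^{|p_2||p_1'|}p_1p_1'\otimes p_2p_2'$; $\partial_{\theta_I}$ is the product of the anticommuting variables $\partial_{\theta_i}$, $i\in I$, in increasing order; and $\Upsilon$ is the linear extension of $p_1\otimes p_2\otimes q_1\otimes q_2\mapsto(-1)^{|q_1||p_2|}p_1(q_1)\cdot p_2(q_2)\in\mathbb C[\partial_\theta]$, where $p(q)$ is the action of $\mathbb C[\theta]$ on $\mathbb C[\partial_\theta]=\mathrm{Cl}_n/\mathrm{Cl}_n\langle\theta_1,\dots,\theta_n\rangle$ for the Clifford algebra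 $\mathrm{Cl}_n$ generated by $\theta_i,\partial_{\theta_i}$ with $\theta_i\theta_j=-\theta_j\theta_i$, $\partial_{\theta_i}\partial_{\theta_j}=-\partial_{\theta_j}\partial_{\theta_i}$, $\partial_{\theta_i}\theta_j=-\theta_j\partial_{\theta_i}+\delta_{ij}$. For $h=g^{-1}$ one has $f^{gh}=f$, so $\sigma_{g,g^{-1}}\in\mathrm{Jac}(f)$. **Proposition 5.3.** For every $g=(\mathbf e[\alpha_1],\dots,\mathbf e[\alpha_n])\in G_f\setminus\{\mathrm{id}\}$ with $0\le\alpha_i<1$, the constant $\widetilde m_{g,g^{-1}}$ exists and is unique, and in $\mathrm{Jac}(f)$ $$\sigma_{g,g^{-1}}=(-1)^{\frac{d_g(d_g-1)}2}\cdot\mathbf e\Big[-\frac12\mathrm{age}(g)\Big]\cdot\Big(\prod_{i=1}^{d_g}\frac{\mathbf e[-\frac14]}{2\sin(\alpha_i\pi)}\Big)\,[H_{g,g^{-1}}].$$ -/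

import Mathlib

open scoped TensorProduct

noncomputable section

namespace OrbifoldJac

open MvPolynomial

/-! ### Jacobian algebras and invertible polynomials -/

section Jacobian

variable {σ τ : Type}

/-- The ideal generated by all the partial derivatives of `f`. -/
def jacobianIdeal (f : MvPolynomial σ ℂ) : Ideal (MvPolynomial σ ℂ) :=
  Ideal.span (Set.range fun i => pderiv i f)

/-- The Jacobian algebra of `f`. -/
abbrev Jac (f : MvPolynomial σ ℂ) : Type :=
  MvPolynomial σ ℂ ⧸ jacobianIdeal f

/-- The class `[p]` of a polynomial in the Jacobian algebra of `f`. -/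
def jacMk (f : MvPolynomial σ ℂ) : MvPolynomial σ ℂ →ₐ[ℂ] Jac f :=
  Ideal.Quotient.mkₐ ℂ (jacobianIdeal f)

/-- The Milnor number of `f`. -/
def milnorNumber (f : MvPolynomial σ ℂ) : ℕ :=
  Module.finrank ℂ (Jac f)

open scoped Classical in
/-- The Hessian determinant of `f` (equal to `1` if there are no variables). -/
def hess [Fintype σ] (f : MvPolynomial σ ℂ) : MvPolynomial σ ℂ :=
  (Matrix.of fun i j : σ => pderiv i (pderiv j f)).det

theorem jacobianIdeal_rename (e : σ ≃ τ) (f : MvPolynomial σ ℂ) :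
    jacobianIdeal (rename e f) =
      (jacobianIdeal f).map (renameEquiv ℂ e : MvPolynomial σ ℂ ≃ₐ[ℂ] MvPolynomial τ ℂ) := by
  unfold jacobianIdeal
  rw [Ideal.map_span, ← Set.range_comp]
  congr 1
  rw [← e.surjective.range_comp]
  congr 1
  funext i
  simp [pderiv_rename e.injective]

end Jacobian

variable {n : ℕ}

/-- Invertible polynomials: weighted homogeneous with positive integer weights, with
finite-dimensional Jacobian algebra (that is, non-degenerate), and a combination with nonzero
coefficients of as many monomials as variables whose exponent matrix is invertible over `ℚ`. -/
structure IsInvertible (f : MvPolynomial (Fin n) ℂ) : Prop where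
  weighted : ∃ (w : Fin n → ℕ) (d : ℕ), (∀ i, 0 < w i) ∧ 0 < d ∧ IsWeightedHomogeneous w f d
  nondegenerate : Module.Finite ℂ (Jac f)
  monomials : ∃ (c : Fin n → ℂ) (E : Matrix (Fin n) (Fin n) ℕ), (∀ i, c i ≠ 0) ∧
    f = ∑ i, C (c i) * ∏ j, X j ^ E i j ∧ (E.map (Nat.cast : ℕ → ℚ)).det ≠ 0

/-- `x_1^{a_1} x_2 + x_2^{a_2} x_3 + ⋯ + x_{n-1}^{a_{n-1}} x_n + x_n^{a_n}`. -/
def chainPoly (a : Fin n → ℕ) : MvPolynomial (Fin n) ℂ :=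
  ∑ i : Fin n, X i ^ a i * (if h : (i : ℕ) + 1 < n then X ⟨(i : ℕ) + 1, h⟩ else 1)

/-- `x_1^{a_1} x_2 + x_2^{a_2} x_3 + ⋯ + x_{n-1}^{a_{n-1}} x_n + x_n^{a_n} x_1`. -/
def loopPoly (a : Fin n → ℕ) : MvPolynomial (Fin n) ℂ :=
  ∑ i : Fin n, X i ^ a i * X ⟨((i : ℕ) + 1) % n, Nat.mod_lt _ i.pos⟩

/-! ### Diagonal symmetries -/

/-- The substitution `p(x) ↦ p(g(x)) = p(g_1 x_1, …, g_n x_n)`. -/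
def diagSubst (g : Fin n → ℂˣ) : MvPolynomial (Fin n) ℂ →ₐ[ℂ] MvPolynomial (Fin n) ℂ :=
  aeval fun i => C (g i : ℂ) * X i

theorem diagSubst_mul (g h : Fin n → ℂˣ) :
    diagSubst (g * h) = (diagSubst h).comp (diagSubst g) := by
  apply algHom_ext
  intro i
  simp [diagSubst, mul_assoc]

theorem diagSubst_one : diagSubst (1 : Fin n → ℂˣ) = AlgHom.id ℂ _ := by
  apply algHom_ext
  intro i
  simp [diagSubst]

/-- The group of maximal diagonal symmetries of `f`. -/
def maxSymGroup (f : MvPolynomial (Fin n) ℂ) : Subgroup (Fin n → ℂˣ) where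
  carrier := {g | diagSubst g f = f}
  mul_mem' {g h} hg hh := by
    simp only [Set.mem_ofPred_eq] at *
    rw [diagSubst_mul, AlgHom.comp_apply, hg, hh]
  one_mem' := by simp [diagSubst_one]
  inv_mem' {g} hg := by
    simp only [Set.mem_ofPred_eq] at *
    conv_lhs => rw [← hg]
    rw [← AlgHom.comp_apply, ← diagSubst_mul, mul_inv_cancel, diagSubst_one, AlgHom.id_apply]

open scoped Classical in
/-- `I_g^c`: the indices of the coordinates that vanish on the fixed locus of `g`. -/
def movedIdx (g : Fin n → ℂˣ) : Finset (Fin n) :=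
  Finset.univ.filter fun i => g i ≠ 1

/-- `d_g`: the codimension of the fixed locus of `g`. -/
def codim (g : Fin n → ℂˣ) : ℕ := (movedIdx g).card

open scoped Classical in
/-- Restriction of polynomials to `Fix(g)`, whose coordinates are the `x_i` with `g_i = 1`. -/
def restrictFix (g : Fin n → ℂˣ) :
    MvPolynomial (Fin n) ℂ →ₐ[ℂ] MvPolynomial {i : Fin n // g i = 1} ℂ :=
  aeval fun i => if h : g i = 1 then X ⟨i, h⟩ else 0

/-- `f^g`, the restriction of `f` to `Fix(g)`. -/
abbrev fixPoly (f : MvPolynomial (Fin n) ℂ) (g : Fin n → ℂˣ) :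
    MvPolynomial {i : Fin n // g i = 1} ℂ :=
  restrictFix g f

/-- The class of a polynomial in `Jac(f^g)`. -/
def jacFixMk (f : MvPolynomial (Fin n) ℂ) (g : Fin n → ℂˣ) :
    MvPolynomial (Fin n) ℂ →ₐ[ℂ] Jac (fixPoly f g) :=
  (jacMk (fixPoly f g)).comp (restrictFix g)

theorem rename_restrictFix_one (g : Fin n → ℂˣ) (hg : ∀ i, g i = 1)
    (p : MvPolynomial (Fin n) ℂ) :
    rename (Equiv.subtypeUnivEquiv hg) (restrictFix g p) = p := by
  rw [← AlgHom.comp_apply]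
  conv_rhs => rw [← AlgHom.id_apply (R := ℂ) p]
  congr 1
  apply algHom_ext
  intro i
  simp [restrictFix, hg]

/-- The identification `Jac(f^{id}) = Jac(f)`. -/
def jacFixOneEquiv (f : MvPolynomial (Fin n) ℂ) (g : Fin n → ℂˣ) (hg : g = 1) :
    Jac (fixPoly f g) ≃ₐ[ℂ] Jac f :=
  Ideal.quotientEquivAlg _ _
    (renameEquiv ℂ (Equiv.subtypeUnivEquiv fun i => congrFun hg i))
    ((congrArg jacobianIdeal
      (rename_restrictFix_one g (fun i => congrFun hg i) f)).symm.trans (jacobianIdeal_rename _ _))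

theorem jacFixOneEquiv_jacFixMk (f : MvPolynomial (Fin n) ℂ) (g : Fin n → ℂˣ) (hg : g = 1)
    (p : MvPolynomial (Fin n) ℂ) :
    jacFixOneEquiv f g hg (jacFixMk f g p) = jacMk f p := by
  have h := rename_restrictFix_one g (fun i => congrFun hg i) p
  change Ideal.Quotient.mk _ (rename (Equiv.subtypeUnivEquiv fun i => congrFun hg i)
    (restrictFix g p)) = _
  rw [h]
  rfl

/-- The age of `g = (e[α_1], …, e[α_n])`, where `0 ≤ α_i < 1`. -/
def age (α : Fin n → ℝ) : ℝ := ∑ i, α i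

/-- `e[t] = exp(2 π √-1 t)`. -/
def ee (t : ℝ) : ℂ := Complex.exp (2 * Real.pi * Complex.I * t)

/-! ### The element `H_{g,g⁻¹}` -/

/-- `m` times the determinant of the second derivatives of `f` in the directions of `I_g^c`. -/
def hPoly (f : MvPolynomial (Fin n) ℂ) (g : Fin n → ℂˣ) (m : ℂ) : MvPolynomial (Fin n) ℂ :=
  C m * (Matrix.of fun i j : movedIdx g => pderiv (i : Fin n) (pderiv (j : Fin n) f)).det

/-- The equation `(1/μ_{f^g}) [hess(f^g) H] = (1/μ_f) [hess(f)]` in `Jac(f)` for the constant `m`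
in `H = m · det(∂²f/∂x_i∂x_j)_{i,j ∈ I_g^c}`; the polynomial `hess(f^g)` in the variables `x_i`,
`i ∈ I_g`, is read as a polynomial in all the variables. -/
def IsHConstant (f : MvPolynomial (Fin n) ℂ) (g : Fin n → ℂˣ) (m : ℂ) : Prop :=
  (1 / (milnorNumber (fixPoly f g) : ℂ)) •
      jacMk f (rename Subtype.val (hess (fixPoly f g)) * hPoly f g m) =
    (1 / (milnorNumber f : ℂ)) • jacMk f (hess f)

/-! ### Difference derivatives -/

section DifferenceDerivative

variable {A : Type} [CommRing A]

/-- `p(y_1, …, y_i, x_{i+1}, …, x_n)`; the variables `x` are the left ones, `y` the right ones. -/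
def mixVars (i : ℕ) : MvPolynomial (Fin n) A →ₐ[A] MvPolynomial (Fin n ⊕ Fin n) A :=
  aeval fun k : Fin n => if (k : ℕ) < i then X (Sum.inr k) else X (Sum.inl k)

theorem dvd_mixVars_sub (i : Fin n) (p : MvPolynomial (Fin n) A) :
    (X (Sum.inl i) - X (Sum.inr i) : MvPolynomial (Fin n ⊕ Fin n) A) ∣
      mixVars (i : ℕ) p - mixVars ((i : ℕ) + 1) p := by
  rw [← Ideal.mem_span_singleton, ← Ideal.Quotient.eq]
  set J : Ideal (MvPolynomial (Fin n ⊕ Fin n) A) :=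
    Ideal.span {X (Sum.inl i) - X (Sum.inr i)} with hJ
  have key : (Ideal.Quotient.mkₐ A J).comp (mixVars (i : ℕ)) =
      (Ideal.Quotient.mkₐ A J).comp (mixVars ((i : ℕ) + 1)) := by
    apply algHom_ext
    intro k
    rcases lt_trichotomy (k : ℕ) (i : ℕ) with h | h | h
    · simp only [mixVars, AlgHom.comp_apply, aeval_X, h, Nat.lt_succ_of_lt h, if_true]
    · obtain rfl := Fin.ext h
      simp only [mixVars, AlgHom.comp_apply, aeval_X, lt_irrefl, if_false, Nat.lt_succ_self,
        if_true, Ideal.Quotient.mkₐ_eq_mk]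
      rw [Ideal.Quotient.eq, hJ]
      exact Ideal.mem_span_singleton_self _
    · simp only [mixVars, AlgHom.comp_apply, aeval_X, not_lt.2 h.le,
        not_lt.2 (Nat.succ_le_of_lt h), if_false]
  exact DFunLike.congr_fun key p

/-- The difference derivative `∇_i^{x → (x,y)} : A[x] → A[x,y]`, the exact quotient of
`p(y_1, …, y_{i-1}, x_i, …, x_n) - p(y_1, …, y_i, x_{i+1}, …, x_n)` by `x_i - y_i`. -/
def diffDeriv (i : Fin n) (p : MvPolynomial (Fin n) A) : MvPolynomial (Fin n ⊕ Fin n) A :=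
  (dvd_mixVars_sub i p).choose

theorem diffDeriv_spec (i : Fin n) (p : MvPolynomial (Fin n) A) :
    mixVars (i : ℕ) p - mixVars ((i : ℕ) + 1) p =
      (X (Sum.inl i) - X (Sum.inr i)) * diffDeriv i p :=
  (dvd_mixVars_sub i p).choose_spec

/-- `∇_i^{x → (x,ψ(x))}(p)`, the restriction of `∇_i^{x → (x,y)}(p)` to `y = ψ(x)`. -/
def diffDerivAt (ψ : Fin n → MvPolynomial (Fin n) A) (i : Fin n) (p : MvPolynomial (Fin n) A) :
    MvPolynomial (Fin n) A :=
  aeval (Sum.elim X ψ) (diffDeriv i p)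

end DifferenceDerivative

/-- `∇_j^{y → (y,z)} ∇_i^{x → (x,y)}(f)`, as an element of `(ℂ[x])[y,z] = ℂ[x,y,z]`: the polynomial
`∇_i^{x → (x,y)}(f)` is read as a polynomial in `y` with coefficients in `ℂ[x]`. -/
def hfCoeff (f : MvPolynomial (Fin n) ℂ) (i j : Fin n) :
    MvPolynomial (Fin n ⊕ Fin n) (MvPolynomial (Fin n) ℂ) :=
  diffDeriv j (aeval (Sum.elim (fun k => C (X k)) X) (diffDeriv i f) :
    MvPolynomial (Fin n) (MvPolynomial (Fin n) ℂ))

/-- The coefficient of `θ_i ⊗ θ_j` in `H_f(x, g(x), x)`, for `j ≤ i`. -/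
def hfCoeffAt (f : MvPolynomial (Fin n) ℂ) (g : Fin n → ℂˣ) (i j : Fin n) :
    MvPolynomial (Fin n) ℂ :=
  aeval (Sum.elim (fun k => C (g k : ℂ) * X k) X) (hfCoeff f i j)

open scoped Classical in
/-- The coefficient of `θ_j θ_i` in `H_{f,g}(x)`, for `j < i` both in `I_g^c`. -/
def hfgCoeff (f : MvPolynomial (Fin n) ℂ) (g : Fin n → ℂˣ) (j i : Fin n) :
    MvPolynomial (Fin n) ℂ :=
  C (1 / (1 - (g j : ℂ))) *
    diffDerivAt (fun k => if g k = 1 then X k else 0) j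
      (diffDerivAt (fun k => C (g k : ℂ) * X k) i f)

/-! ### The Clifford algebra and its action

Everything is written over a commutative coefficient ring `R`, which will be `Jac(f^{gh})`. -/

section Clifford

variable (R : Type) [CommRing R] (n)

/-- `R[θ] = R ⊗ ℂ[θ_1, …, θ_n]`, with `θ_i` the dual basis of the `∂_{θ_i}`. -/
abbrev ThetaAlg : Type := ExteriorAlgebra R (Module.Dual R (Fin n → R))

/-- `R[∂_θ] = R ⊗ ℂ[∂_{θ_1}, …, ∂_{θ_n}]`. -/
abbrev DelAlg : Type := ExteriorAlgebra R (Fin n → R)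

/-- The generator `θ_i` of `R[θ]`. -/
def theta (i : Fin n) : ThetaAlg n R := ExteriorAlgebra.ι R (LinearMap.proj i)

/-- The monomials `∂_{θ_I}`, the products of the `∂_{θ_i}`, `i ∈ I`, in increasing order. -/
def delBasis : Module.Basis (Finset (Fin n)) R (DelAlg n R) :=
  (Pi.basisFun R (Fin n)).ExteriorAlgebra

/-- The Clifford algebra `R ⊗ Cl_n`, generated by `θ_i` and `∂_{θ_i}` with
`θ_i θ_j = -θ_j θ_i`, `∂_{θ_i} ∂_{θ_j} = -∂_{θ_j} ∂_{θ_i}`,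
`∂_{θ_i} θ_j = -θ_j ∂_{θ_i} + δ_{ij}`: the Clifford algebra of the quadratic form `(u, v) ↦ u(v)`
on the sum of the span of the `θ_i` and the span of the `∂_{θ_i}`. -/
abbrev Cl : Type := CliffordAlgebra (QuadraticForm.dualProd R (Fin n → R))

/-- The inclusion `R[θ] → Cl_n`. -/
def thetaToCl : ThetaAlg n R →ₐ[R] Cl n R :=
  ExteriorAlgebra.lift R
    ⟨(CliffordAlgebra.ι (QuadraticForm.dualProd R (Fin n → R))).comp (LinearMap.inl R _ _), by
      intro u
      simp [CliffordAlgebra.ι_sq_scalar]⟩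

/-- The left module structure of `R[∂_θ] = Cl_n / Cl_n⟨θ_1, …, θ_n⟩` over the Clifford algebra:
`∂_{θ_i}` acts by left multiplication and `θ_i` by contraction, so that `θ_i · 1 = 0`. -/
def clAct : Cl n R →ₐ[R] Module.End R (DelAlg n R) :=
  CliffordAlgebra.lift _
    ⟨(CliffordAlgebra.contractLeft (Q := (0 : QuadraticForm R (Fin n → R)))).comp
        (LinearMap.fst R _ _) +
      ((LinearMap.mul R (DelAlg n R)).comp (ExteriorAlgebra.ι R)).comp (LinearMap.snd R _ _), by
      rintro ⟨u, v⟩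
      apply LinearMap.ext
      intro q
      have h1 : CliffordAlgebra.contractLeft (Q := (0 : QuadraticForm R (Fin n → R))) u
          (ExteriorAlgebra.ι R v * q) = u v • q -
          ExteriorAlgebra.ι R v * CliffordAlgebra.contractLeft u q :=
        CliffordAlgebra.contractLeft_ι_mul (Q := (0 : QuadraticForm R (Fin n → R))) u v q
      have h2 : CliffordAlgebra.contractLeft (Q := (0 : QuadraticForm R (Fin n → R))) u
          (CliffordAlgebra.contractLeft u q) = 0 := CliffordAlgebra.contractLeft_contractLeft _ _
      have h3 : ExteriorAlgebra.ι R v * (ExteriorAlgebra.ι R v * q) = 0 := by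
        rw [← mul_assoc, ExteriorAlgebra.ι_sq_zero, zero_mul]
      simp only [LinearMap.add_apply, LinearMap.comp_apply, LinearMap.fst_apply,
        LinearMap.snd_apply, Module.End.mul_apply, LinearMap.mul_apply', map_add,
        Module.algebraMap_end_apply, QuadraticForm.dualProd_apply, h1, h2, h3]
      abel⟩

/-- The action `p ↦ p(q)` of `R[θ]` on `R[∂_θ]`. -/
def thetaAct : ThetaAlg n R →ₐ[R] Module.End R (DelAlg n R) :=
  (clAct n R).comp (thetaToCl n R)

/-- The grading of `R[θ]` by the number of generators. -/
abbrev thetaGrading : ℕ → Submodule R (ThetaAlg n R) :=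
  fun k => ⋀[R]^k (Module.Dual R (Fin n → R))

/-- `R[θ] ⊗ R[θ]`, the tensor product of graded algebras, with the Koszul sign in
`(p_1 ⊗ p_2)(p_1' ⊗ p_2') = (-1)^{|p_2||p_1'|} p_1 p_1' ⊗ p_2 p_2'`. -/
abbrev ThetaTensor : Type := thetaGrading n R ᵍ⊗[R] thetaGrading n R

variable {n R}

/-- The map `p_1 ⊗ p_2 ⊗ q_1 ⊗ q_2 ↦ (-1)^{|q_1||p_2|} p_1(q_1) · p_2(q_2)`. The element `q_1` is
split into its homogeneous components; the grade involution multiplies `p_2` by `(-1)^{|p_2|}`. -/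
def upsilon (P : ThetaTensor n R) (q₁ q₂ : DelAlg n R) : DelAlg n R :=
  ∑ k ∈ Finset.range (n + 1),
    LinearMap.mul' R (DelAlg n R)
      (TensorProduct.map
        ((thetaAct n R).toLinearMap.flip
          (GradedRing.proj (fun k : ℕ => ⋀[R]^k (Fin n → R)) k q₁))
        ((thetaAct n R).toLinearMap.flip q₂ ∘ₗ
          (CliffordAlgebra.involute
            (Q := (0 : QuadraticForm R (Module.Dual R (Fin n → R))))).toLinearMap ^ k)
        ((GradedTensorProduct.of R (thetaGrading n R) (thetaGrading n R)).symm P))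

end Clifford

/-! ### The structure constants -/

section Sigma

variable {R : Type} [CommRing R] [Algebra ℂ R]

/-- `⌊H_f(x,g(x),x)⌋`, the coefficients being sent to `R` by `φ`. -/
def hfElt (φ : MvPolynomial (Fin n) ℂ →ₐ[ℂ] R) (f : MvPolynomial (Fin n) ℂ)
    (g : Fin n → ℂˣ) : ThetaTensor n R :=
  ∑ i : Fin n, ∑ j ∈ Finset.univ.filter (fun j : Fin n => j ≤ i),
    φ (hfCoeffAt f g i j) • GradedTensorProduct.tmul R (theta n R i) (theta n R j)

/-- `⌊H_{f,g}(s(x))⌋`, the coefficients being sent to `R` by `φ`, for a substitution `s`. -/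
def hfgElt (φ : MvPolynomial (Fin n) ℂ →ₐ[ℂ] R) (f : MvPolynomial (Fin n) ℂ)
    (g s : Fin n → ℂˣ) : ThetaAlg n R :=
  ∑ i ∈ movedIdx g, ∑ j ∈ (movedIdx g).filter (fun j => j < i),
    φ (diagSubst s (hfgCoeff f g j i)) • (theta n R j * theta n R i)

/-- `⌊H_f(x,g(x),x)⌋ + ⌊H_{f,g}(x)⌋ ⊗ 1 + 1 ⊗ ⌊H_{f,h}(g(x))⌋`. -/
def sigmaBase (φ : MvPolynomial (Fin n) ℂ →ₐ[ℂ] R) (f : MvPolynomial (Fin n) ℂ)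
    (g h : Fin n → ℂˣ) : ThetaTensor n R :=
  hfElt φ f g + GradedTensorProduct.tmul R (hfgElt φ f g 1) 1 +
    GradedTensorProduct.tmul R 1 (hfgElt φ f h g)

end Sigma

open scoped Classical in
/-- Shklyarov's structure constant `σ_{g,h} ∈ Jac(f^{gh})`. It is `0` unless
`d_{g,h} = (d_g + d_h - d_{gh}) / 2` is a non-negative integer, and then it is the coefficient of
`∂_{θ_I}`, `I = I_{gh}^c`, in
`(1 / d_{g,h}!) Υ((⌊H_f(x,g(x),x)⌋ + ⌊H_{f,g}(x)⌋ ⊗ 1 + 1 ⊗ ⌊H_{f,h}(g(x))⌋)^{d_{g,h}} ⊗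
∂_{θ_{I_g^c}} ⊗ ∂_{θ_{I_h^c}})`. -/
def sigma (f : MvPolynomial (Fin n) ℂ) (g h : Fin n → ℂˣ) : Jac (fixPoly f (g * h)) :=
  if codim (g * h) ≤ codim g + codim h ∧ Even (codim g + codim h - codim (g * h)) then
    (1 / (((codim g + codim h - codim (g * h)) / 2).factorial : ℂ)) •
      (delBasis n (Jac (fixPoly f (g * h)))).repr
        (upsilon
          (sigmaBase (jacFixMk f (g * h)) f g h ^ ((codim g + codim h - codim (g * h)) / 2))
          (delBasis n _ (movedIdx g)) (delBasis n _ (movedIdx h)))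
        (movedIdx (g * h))
  else 0

/-- `σ_{g,g⁻¹}` as an element of `Jac(f)`, which is `Jac(f^{gh})` for `h = g⁻¹`. -/
def sigmaInv (f : MvPolynomial (Fin n) ℂ) (g : Fin n → ℂˣ) : Jac f :=
  jacFixOneEquiv f (g * g⁻¹) (mul_inv_cancel g) (sigma f g g⁻¹)

end OrbifoldJac

end

open scoped TensorProduct

noncomputable section

namespace OrbifoldJac

open MvPolynomial

/-! ### Continuants and cyclic tridiagonal determinants -/

section Continuant

variable {R : Type*} [CommRing R]

/-! Both sides are computed explicitly as multiples of one class in a one-dimensional piece of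
$\mathrm{Jac}(f)$.

Write chains and loops uniformly as $f=\sum_k m_k$ with $m_k=x_k^{a_k}x_{k+1}^{\varepsilon_k}$ and
cyclic indices. For a chain the symmetry equations make the moved coordinates an initial segment
$0,\dots,d-1$; for a loop every coordinate is moved. The quadratic element defining
$\sigma_{g,g^{-1}}$ then has only terms between equal or neighbouring indices (and, for a loop, a
closing term): with $X_i=\theta_i\otimes1$, $Y_i=1\otimes\theta_i$ it is a ladder graph weighted by
Grassmann variables. Its $d$-th power is $d!$ times a signed count of perfect matchings, namely a
continuant, or for a loop a cyclic continuant plus two winding terms (`Grassmann.ladder_pow`,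
`Grassmann.add_ladder_pow_cyclic`, `LadderCoeffs.sigmaInv_eq`). The determinants of second
derivatives are continuants as well.

To compare such polynomials in $\mathrm{Jac}(f)$, note that $x_i\partial_if=0$ gives
$m_k=-a_{k+1}m_{k+1}$ whenever $\varepsilon_k=1$. So every monomial that occurs is formally a number
times $\prod_k(m_k/x_k^2)^{S_k}$. The submodules `cycRep` record the pairs (polynomial, number);
they multiply, so the number attached to a continuant is the continuant of the numbers
(`contin_mem_cycRep`). These numerical continuants factor: for a chain one gets
$\prod_{i<d}a_i/(1-g_i)$, for a loop $(\prod a_i-(-1)^n)\prod1/(1-g_i)$.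

That equal formal classes are equal in $\mathrm{Jac}(f)$ is proved with an explicit residue
functional (`cycFunctional`). It kills the Jacobian ideal (`CycAdm.kills`), and it is nondegenerate
by the Casimir element $\det M\in\mathrm{Jac}(f)\otimes\mathrm{Jac}(f)$, where $\nabla f(x)-\nabla
f(y)=(x-y)M$ (`CasimirData.map_eq_zero`). The trace of the same element gives the value of the
functional on the Hessian as a nonzero constant times $\mu_f$ (`CasimirData.apply_hess`), which
brings the Milnor numbers into the comparison.

What remains is $\mathbf e[-\frac12t]\,\mathbf e[-\frac14]/(2\sin\pi t)=-1/(1-\mathbf e[t])$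
(`ee_neg_half_mul`): the trigonometric product is $(-1)^d\prod1/(1-g_i)$, and $(-1)^d$ is also the
sign left over by the Koszul rule. -/

/-- The continuant `K(0, …, k-1)` with diagonal terms `D i` and dimer terms `d i` on `{i, i+1}`. -/
def contin (D d : ℕ → R) : ℕ → R
  | 0 => 1
  | 1 => D 0
  | k + 2 => D (k + 1) * contin D d (k + 1) + d k * contin D d k

@[simp] theorem contin_zero (D d : ℕ → R) : contin D d 0 = 1 := rfl

@[simp] theorem contin_one (D d : ℕ → R) : contin D d 1 = D 0 := rfl

theorem contin_add_two (D d : ℕ → R) (k : ℕ) :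
    contin D d (k + 2) = D (k + 1) * contin D d (k + 1) + d k * contin D d k := rfl

theorem map_contin {S : Type*} [CommRing S] (φ : R →+* S) (D d : ℕ → R) (k : ℕ) :
    φ (contin D d k) = contin (fun i => φ (D i)) (fun i => φ (d i)) k := by
  induction k using Nat.twoStepInduction with
  | zero => simp
  | one => simp
  | more k h1 h2 => simp [contin_add_two, h1, h2]

theorem contin_congr {D d D' d' : ℕ → R} {k : ℕ} (hD : ∀ i < k, D i = D' i)
    (hd : ∀ i, i + 1 < k → d i = d' i) : contin D d k = contin D' d' k := by
  induction k using Nat.twoStepInduction with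
  | zero => simp
  | one => simp [hD 0 one_pos]
  | more k h1 h2 =>
    rw [contin_add_two, contin_add_two, hD _ (by omega), hd _ (by omega),
      h1 (fun i hi => hD i (by omega)) (fun i hi => hd i (by omega)),
      h2 (fun i hi => hD i (by omega)) (fun i hi => hd i (by omega))]

theorem contin_add_two_left (D d : ℕ → R) (k : ℕ) :
    contin D d (k + 2) = D 0 * contin (fun i => D (i + 1)) (fun i => d (i + 1)) (k + 1) +
      d 0 * contin (fun i => D (i + 2)) (fun i => d (i + 2)) k := by
  induction k using Nat.twoStepInduction with
  | zero => simp [contin_add_two]; ring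
  | one => simp [contin_add_two]; ring
  | more k h1 h2 =>
    rw [contin_add_two, h1, h2, contin_add_two (fun i => D (i + 1)) _ (k + 1),
      contin_add_two (fun i => D (i + 2))]
    ring

/-- The second-order recursion splits into two first-order ones:
$K_{k+2}-v_{k+1}K_{k+1}=\alpha_{k+1}(K_{k+1}-v_kK_k)$. All explicit continuants below have
coefficients of this form, usually with the last `v` equal to zero, so that only $\prod\alpha_i$
survives. -/
theorem contin_succ_of_factor {α v D d : ℕ → R} (k : ℕ) (hD : ∀ i ≤ k, D i = α i + v i)
    (hd : ∀ i < k, d i = -(α (i + 1) * v i)) :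
    contin D d (k + 1) = v k * contin D d k + ∏ i ∈ Finset.range (k + 1), α i := by
  induction k with
  | zero => simp [hD]; ring
  | succ k ih =>
    rw [contin_add_two, Finset.prod_range_succ, hD (k + 1) le_rfl, hd k (by omega)]
    have := ih (fun i hi => hD i (by omega)) (fun i hi => hd i (by omega))
    linear_combination α (k + 1) * this

/-- Periodic version of the same factorization. The continuant and its truncation at the left end
obey the same inhomogeneous recursion, so in $K_{j+1}-\alpha_0K'_j$ the products of the $\alpha_i$
cancel and only $\prod v_i$ is left. -/
theorem contin_cyclic_of_factor {α v D d : ℕ → R} (k : ℕ) (hD : ∀ i ≤ k + 1, D i = α i + v i)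
    (hd : ∀ i < k + 1, d i = -(α (i + 1) * v i)) :
    contin D d (k + 2) -
        α 0 * v (k + 1) * contin (fun i => D (i + 1)) (fun i => d (i + 1)) k =
      ∏ i ∈ Finset.range (k + 2), α i + ∏ i ∈ Finset.range (k + 2), v i := by
  have h (j : ℕ) (hj : j ≤ k + 1) : contin D d (j + 1) -
      α 0 * contin (fun i => D (i + 1)) (fun i => d (i + 1)) j =
      ∏ i ∈ Finset.range (j + 1), v i := by
    induction j with
    | zero => simp [hD]
    | succ j ih =>
      have h1 := contin_succ_of_factor (j + 1) (fun i hi => hD i (by omega))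
        (fun i hi => hd i (by omega))
      have h2 := contin_succ_of_factor (α := fun i => α (i + 1)) (v := fun i => v (i + 1))
        (D := fun i => D (i + 1)) (d := fun i => d (i + 1)) j (fun i hi => hD _ (by omega))
        (fun i hi => hd _ (by omega))
      rw [Finset.prod_range_succ, ← ih (by omega), h1, h2, Finset.prod_range_succ' α]
      ring
  have h2 := contin_succ_of_factor (α := fun i => α (i + 1)) (v := fun i => v (i + 1))
        (D := fun i => D (i + 1)) (d := fun i => d (i + 1)) k (fun i hi => hD _ (by omega))
        (fun i hi => hd _ (by omega))
  rw [← h (k + 1) le_rfl, h2, Finset.prod_range_succ' α]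
  ring

/-- The tridiagonal matrix with diagonal `D`, subdiagonal `b` and superdiagonal `c`. -/
def tri (D b c : ℕ → R) (k : ℕ) : Matrix (Fin k) (Fin k) R :=
  Matrix.of fun i j => (if (i : ℕ) = j then D i else 0) + (if (i : ℕ) = j + 1 then b j else 0) +
    if (j : ℕ) = i + 1 then c i else 0

theorem tri_submatrix_succ (D b c : ℕ → R) (k : ℕ) :
    (tri D b c (k + 1)).submatrix Fin.succ Fin.succ =
      tri (fun i => D (i + 1)) (fun i => b (i + 1)) (fun i => c (i + 1)) k := by
  ext i j
  simp [tri]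

theorem det_tri (D b c : ℕ → R) (k : ℕ) :
    (tri D b c k).det = contin D (fun i => -(b i * c i)) k := by
  induction k using Nat.twoStepInduction generalizing D b c with
  | zero => simp
  | one => simp [tri]
  | more k h1 h2 =>
    rw [contin_add_two_left, Matrix.det_succ_row_zero, Fin.sum_univ_succ, Fin.sum_univ_succ]
    have h0 : ∀ i : Fin k, tri D b c (k + 2) 0 i.succ.succ = 0 := by
      intro i; simp [tri]
    have hm : ((tri D b c (k + 2)).submatrix Fin.succ (Fin.succAbove (Fin.succ 0))).det =
        b 0 * (tri (fun i => D (i + 2)) (fun i => b (i + 2)) (fun i => c (i + 2)) k).det := by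
      rw [Matrix.det_succ_column_zero, Fin.sum_univ_succ]
      have h00 : ∀ i : Fin k, ((tri D b c (k + 2)).submatrix Fin.succ
          (Fin.succAbove (Fin.succ 0))) i.succ 0 = 0 := by
        intro i; simp [tri]
      have he : (((tri D b c (k + 2)).submatrix Fin.succ (Fin.succAbove (Fin.succ 0))).submatrix
          (Fin.succAbove 0) Fin.succ) =
          tri (fun i => D (i + 2)) (fun i => b (i + 2)) (fun i => c (i + 2)) k := by
        ext i j
        simp [tri, Fin.succAbove, Fin.lt_def]
      simp only [h00, mul_zero, zero_mul, Finset.sum_const_zero, add_zero, he]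
      simp [tri]
    simp only [h0, mul_zero, zero_mul, Finset.sum_const_zero, add_zero, hm]
    rw [Fin.succAbove_zero, tri_submatrix_succ, h1, h2]
    simp [tri]
    ring

/-- The cyclic tridiagonal matrix of size `k + 2`, with corners `b'` and `c'`. -/
def cycTri (D b c : ℕ → R) (b' c' : R) (k : ℕ) : Matrix (Fin (k + 2)) (Fin (k + 2)) R :=
  Matrix.of fun i j => tri D b c (k + 2) i j + (if i = 0 ∧ j = Fin.last _ then b' else 0) +
    if i = Fin.last _ ∧ j = 0 then c' else 0

/-- Multilinearity in the first and last rows. Neither corner gives the tridiagonal determinant, one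
corner gives a triangular minor with an off-diagonal as its diagonal, both corners give minus the
inner block. -/
theorem det_cycTri (D b c : ℕ → R) (b' c' : R) (k : ℕ) :
    (cycTri D b c b' c' k).det = contin D (fun i => -(b i * c i)) (k + 2) -
      b' * c' * contin (fun i => D (i + 1)) (fun i => -(b (i + 1) * c (i + 1))) k +
      (-1) ^ (k + 1) * (b' * ∏ i ∈ Finset.range (k + 1), b i +
        c' * ∏ i ∈ Finset.range (k + 1), c i) := by
  set A := tri D b c (k + 2) with hA
  set l : Fin (k + 2) := Fin.last _ with hl
  have hl0 : l ≠ 0 := by simp [hl, Fin.ext_iff]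
  have hB : cycTri D b c b' c' k =
      (A.updateRow 0 (A 0 + b' • Pi.single l 1)).updateRow l (A l + c' • Pi.single 0 1) := by
    ext i j
    by_cases h1 : i = l
    · subst h1
      simp [cycTri, hl0, Pi.single_apply, ← hA, ← hl]
    · rw [Matrix.updateRow_ne h1]
      by_cases h2 : i = 0
      · subst h2
        simp [cycTri, hl0.symm, Pi.single_apply, ← hA, ← hl]
      · rw [Matrix.updateRow_ne h2]
        simp [cycTri, h1, h2, ← hA, ← hl]
  have hb : (A.updateRow 0 (Pi.single l 1)).det =
      (-1) ^ (k + 1) * ∏ i ∈ Finset.range (k + 1), b i := by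
    rw [← Matrix.adjugate_apply, Matrix.adjugate_fin_succ_eq_det_submatrix,
      Matrix.det_of_isUpperTriangular, ← Fin.prod_univ_eq_prod_range]
    · have h (x : ℕ) : x ≠ x + 1 + 1 := by omega
      simp [hl, hA, tri, Fin.succAbove_last, h]
    · intro i j hij
      have hij : (j : ℕ) < i := hij
      simp [hl, hA, tri, Fin.succAbove_last]
      rw [if_neg (by omega), if_neg (by omega), if_neg (by omega)]
      simp
  have hc : (A.updateRow l (Pi.single 0 1)).det =
      (-1) ^ (k + 1) * ∏ i ∈ Finset.range (k + 1), c i := by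
    rw [← Matrix.adjugate_apply, Matrix.adjugate_fin_succ_eq_det_submatrix,
      Matrix.det_of_isLowerTriangular, ← Fin.prod_univ_eq_prod_range]
    · have h (x : ℕ) : x ≠ x + 1 + 1 := by omega
      simp [hl, hA, tri, Fin.succAbove_last, h]
    · intro i j hij
      have hij : (i : ℕ) < j := hij
      simp [hl, hA, tri, Fin.succAbove_last]
      rw [if_neg (by omega), if_neg (by omega), if_neg (by omega)]
      simp
  -- Two successive expansions, along the first and then the last row, leave rows and columns
  -- $1,\dots,k$.
  have hbc : ((A.updateRow l (Pi.single 0 1)).updateRow 0 (Pi.single l 1)).det =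
      -contin (fun i => D (i + 1)) (fun i => -(b (i + 1) * c (i + 1))) k := by
    rw [← Matrix.adjugate_apply, Matrix.adjugate_fin_succ_eq_det_submatrix]
    have : (A.updateRow l (Pi.single 0 1)).submatrix (Fin.succAbove 0) l.succAbove =
        (A.submatrix Fin.succ Fin.castSucc).updateRow (Fin.last k) (Pi.single 0 1) := by
      ext i j
      by_cases hi : i = Fin.last k
      · subst hi
        rw [Matrix.submatrix_apply, Fin.succAbove_zero, Fin.succ_last, ← hl, Matrix.updateRow_self,
          Matrix.updateRow_self, hl, Fin.succAbove_last]
        rcases Fin.eq_zero_or_eq_succ j with rfl | ⟨j, rfl⟩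
        · rfl
        · rw [Pi.single_eq_of_ne, Pi.single_eq_of_ne (Fin.succ_ne_zero j)]
          simp [Fin.ext_iff]
      · have : i.succ ≠ l := by
          intro h; apply hi; ext; simpa [hl, Fin.ext_iff] using h
        rw [Matrix.updateRow_ne hi, Matrix.submatrix_apply, Matrix.submatrix_apply,
          Fin.succAbove_zero, Matrix.updateRow_ne this, hl, Fin.succAbove_last]
    rw [this, ← Matrix.adjugate_apply, Matrix.adjugate_fin_succ_eq_det_submatrix, ← det_tri]
    have : ((A.submatrix Fin.succ Fin.castSucc).submatrix (Fin.last k).succAbove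
        (Fin.succAbove 0)) = tri (fun i => D (i + 1)) (fun i => b (i + 1)) (fun i => c (i + 1)) k := by
      ext i j
      simp [hA, tri, Fin.succAbove_last]
    rw [this]
    simp [hl, pow_succ, ← mul_assoc, ← mul_pow]
  rw [hB, Matrix.det_updateRow_add, Matrix.det_updateRow_smul]
  have h1 : (A.updateRow 0 (A 0 + b' • Pi.single l 1)).updateRow l (A l) =
      A.updateRow 0 (A 0 + b' • Pi.single l 1) := by
    conv_rhs => rw [← Matrix.updateRow_eq_self (A.updateRow 0 (A 0 + b' • Pi.single l 1)) l]
    rw [Matrix.updateRow_ne hl0]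
  have h2 : (A.updateRow 0 (A 0 + b' • Pi.single l 1)).updateRow l (Pi.single 0 1) =
      (A.updateRow l (Pi.single 0 1)).updateRow 0 (A 0 + b' • Pi.single l 1) :=
    Matrix.updateRow_comm _ hl0.symm _ _
  have h3 : (A.updateRow l (Pi.single 0 1)).updateRow 0 (A 0) = A.updateRow l (Pi.single 0 1) := by
    conv_rhs => rw [← Matrix.updateRow_eq_self (A.updateRow l (Pi.single 0 1)) 0]
    rw [Matrix.updateRow_ne hl0.symm]
  rw [h1, h2, Matrix.det_updateRow_add, Matrix.det_updateRow_smul, Matrix.updateRow_eq_self,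
    Matrix.det_updateRow_add, Matrix.det_updateRow_smul, h3, hb, hc, hbc, hA, det_tri]
  ring

end Continuant

/-! ### Powers of quadratic elements of ladder shape in a Grassmann algebra -/

section Ladder

variable {R S : Type*} [CommRing R] [Ring S] [Algebra R S]

/-- Two sequences of pairwise anticommuting elements of square zero. -/
structure Grassmann (X Y : ℕ → S) : Prop where
  xx : ∀ i j, X i * X j = -(X j * X i)
  yy : ∀ i j, Y i * Y j = -(Y j * Y i)
  yx : ∀ i j, Y i * X j = -(X j * Y i)
  xsq : ∀ i, X i * X i = 0
  ysq : ∀ i, Y i * Y i = 0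

/-- The bond between the columns `(x, y)` and `(x', y')`, together with the rung `x' * y'`. -/
def bond (D b c s : R) (x y x' y' : S) : S :=
  D • (x' * y') + (b • (x * x') + c • (y * y') + s • (x' * y))

/-- The rung and the bond added to a ladder in position `k + 1`. -/
def ladderStep (X Y : ℕ → S) (D b c s : ℕ → R) (k : ℕ) : S :=
  bond (D (k + 1)) (b k) (c k) (s k) (X k) (Y k) (X (k + 1)) (Y (k + 1))

/-- The quadratic element with rungs `D i • X i * Y i` and bonds between `i` and `i + 1`. -/
def ladder (X Y : ℕ → S) (D b c s : ℕ → R) : ℕ → S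
  | 0 => 0
  | 1 => D 0 • (X 0 * Y 0)
  | k + 2 => ladder X Y D b c s (k + 1) + ladderStep X Y D b c s k

/-- The product of all `X i * Y i`, `i < k`. -/
def ladderTop (X Y : ℕ → S) : ℕ → S
  | 0 => 1
  | k + 1 => ladderTop X Y k * (X k * Y k)

/-- Binomial theorem when $N^3=0$. Writing $N^2=2M$ absorbs the $\frac12$ of the binomial
coefficient, so no division is needed in the coefficient ring. -/
theorem add_pow_of_sq_eq {A N M : S} (hAN : Commute A N) (hAM : Commute A M)
    (hN : N * N = 2 • M) (hNM : M * N = 0) (m : ℕ) :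
    (A + N) ^ (m + 2) = A ^ (m + 2) + (m + 2) • (A ^ (m + 1) * N) +
      ((m + 2) * (m + 1)) • (A ^ m * M) := by
  induction m with
  | zero =>
    have := hAN.eq
    simp only [pow_succ, pow_zero, one_mul, add_mul, mul_add, hN, ← this]
    module
  | succ m ih =>
    have h1 : A ^ (m + 1) * N * A = A ^ (m + 2) * N := by
      rw [mul_assoc, ← hAN.eq, ← mul_assoc, ← pow_succ]
    have h2 : A ^ m * M * A = A ^ (m + 1) * M := by
      rw [mul_assoc, ← hAM.eq, ← mul_assoc, ← pow_succ]
    have h3 : A ^ (m + 1) * N * N = 2 • (A ^ (m + 1) * M) := by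
      rw [mul_assoc, hN, mul_smul_comm]
    have h4 : A ^ m * M * N = 0 := by rw [mul_assoc, hNM, mul_zero]
    rw [pow_succ (A + N), ih]
    simp only [add_mul, mul_add, smul_mul_assoc, h1, h2, h3, h4, ← pow_succ]
    module

theorem add_pow_mul_of_sq_mul_eq_zero {A N z : S} (hAN : Commute A N) (hN : N * (N * z) = 0)
    (m : ℕ) : (A + N) ^ (m + 1) * z = A ^ (m + 1) * z + (m + 1) • (A ^ m * (N * z)) := by
  induction m with
  | zero => simp [add_mul]
  | succ m ih =>
    have h1 : N * (A ^ (m + 1) * z) = A ^ (m + 1) * (N * z) := by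
      rw [← mul_assoc, ← (hAN.pow_left (m + 1)).eq, mul_assoc]
    have h2 : N * (A ^ m * (N * z)) = 0 := by
      rw [← mul_assoc, ← (hAN.pow_left m).eq, mul_assoc, hN, mul_zero]
    rw [pow_succ' (A + N), mul_assoc, ih]
    simp only [add_mul, mul_add, mul_smul_comm, h1, h2]
    simp only [← mul_assoc, ← pow_succ']
    module

set_option linter.unusedSimpArgs false

/-! ### Products of edges between two adjacent columns -/

section FourElements

variable {X Y : ℕ → S} (h : Grassmann X Y) (i j : ℕ) (D b c s : R)
include h

/-- A product of edges vanishes as soon as two of them share a vertex. Among the rung, the two rails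
and the diagonal $x'y$, the only disjoint pair is the pair of rails, because the opposite diagonal
$xy'$ is absent; reordering it gives the sign in $-bc$. The proof puts words in the four odd letters
into a normal order. -/
theorem Grassmann.bond_relations :
    bond D b c s (X i) (Y i) (X j) (Y j) * bond D b c s (X i) (Y i) (X j) (Y j) =
        2 • (-(b * c) • (X i * Y i * (X j * Y j))) ∧
    (-(b * c) • (X i * Y i * (X j * Y j))) * bond D b c s (X i) (Y i) (X j) (Y j) = 0 ∧
    X i * Y i * bond D b c s (X i) (Y i) (X j) (Y j) = D • (X i * Y i * (X j * Y j)) ∧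
    bond D b c s (X i) (Y i) (X j) (Y j) * (X j * Y j) = 0 ∧
    bond D b c s (X i) (Y i) (X j) (Y j) * X j = -c • (Y i * (X j * Y j)) ∧
    bond D b c s (X i) (Y i) (X j) (Y j) * Y j =
      b • (X i * (X j * Y j)) - s • (Y i * (X j * Y j)) ∧
    bond D b c s (X i) (Y i) (X j) (Y j) * (bond D b c s (X i) (Y i) (X j) (Y j) * X j) = 0 ∧
    bond D b c s (X i) (Y i) (X j) (Y j) * (bond D b c s (X i) (Y i) (X j) (Y j) * Y j) = 0 := by
  have e1 := h.yx i i
  have e2 := h.xx j i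
  have e3 := h.yx j i
  have e4 : X j * Y i = -(Y i * X j) := by rw [h.yx, neg_neg]
  have e5 := h.yy j i
  have e6 := h.yx j j
  have f {p q : S} (hh : p * q = -(q * p)) (z : S) : p * (q * z) = -(q * (p * z)) := by
    rw [← mul_assoc, hh, neg_mul, mul_assoc]
  have g {p : S} (hh : p * p = 0) (z : S) : p * (p * z) = 0 := by
    rw [← mul_assoc, hh, zero_mul]
  have s1 := h.xsq i
  have s2 := h.xsq j
  have s3 := h.ysq i
  have s4 := h.ysq j
  refine ⟨?_, ?_, ?_, ?_, ?_, ?_, ?_, ?_⟩ <;>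
  simp only [bond, mul_add, add_mul, smul_mul_assoc, mul_smul_comm, mul_assoc, e1, e2, e3, e4, e5,
    e6, f e1, f e2, f e3, f e4, f e5, f e6, s1, s2, s3, s4, g s1, g s2, g s3, g s4, mul_neg,
    neg_mul, mul_zero, smul_zero, neg_zero, add_zero, zero_add, neg_neg, smul_neg] <;>
  module

end FourElements

variable {X Y : ℕ → S} (h : Grassmann X Y)
include h

theorem Grassmann.commute_mul_mul {p q r : S}
    (hp : p ∈ Set.range X ∪ Set.range Y) (hq : q ∈ Set.range X ∪ Set.range Y)
    (hr : r ∈ Set.range X ∪ Set.range Y) : Commute (p * q) r := by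
  have anti : ∀ {u v : S}, u ∈ Set.range X ∪ Set.range Y → v ∈ Set.range X ∪ Set.range Y →
      u * v = -(v * u) := by
    rintro u v (⟨i, rfl⟩ | ⟨i, rfl⟩) (⟨j, rfl⟩ | ⟨j, rfl⟩)
    · exact h.xx i j
    · rw [h.yx, neg_neg]
    · exact h.yx i j
    · exact h.yy i j
  change p * q * r = r * (p * q)
  rw [mul_assoc, anti hq hr, mul_neg, ← mul_assoc, anti hp hr, neg_mul, neg_neg, mul_assoc]

/-- The elements commuting with all the generators. -/
abbrev evenPart (R : Type*) [CommRing R] [Algebra R S] (X Y : ℕ → S) : Subalgebra R S :=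
  Subalgebra.centralizer R (Set.range X ∪ Set.range Y)

omit h in
theorem commute_X_of_mem {z : S} (hz : z ∈ evenPart R X Y) (i : ℕ) : Commute z (X i) :=
  ((Subalgebra.mem_centralizer_iff R).1 hz _ (Or.inl ⟨i, rfl⟩)).symm

omit h in
theorem commute_Y_of_mem {z : S} (hz : z ∈ evenPart R X Y) (i : ℕ) : Commute z (Y i) :=
  ((Subalgebra.mem_centralizer_iff R).1 hz _ (Or.inr ⟨i, rfl⟩)).symm

theorem Grassmann.mul_mem_evenPart {p q : S} (hp : p ∈ Set.range X ∪ Set.range Y)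
    (hq : q ∈ Set.range X ∪ Set.range Y) : p * q ∈ evenPart R X Y :=
  (Subalgebra.mem_centralizer_iff R).2 fun _ hr => (h.commute_mul_mul hp hq hr).eq.symm

theorem Grassmann.XX_mem (i j : ℕ) : X i * X j ∈ evenPart R X Y :=
  h.mul_mem_evenPart (Or.inl ⟨i, rfl⟩) (Or.inl ⟨j, rfl⟩)

theorem Grassmann.XY_mem (i j : ℕ) : X i * Y j ∈ evenPart R X Y :=
  h.mul_mem_evenPart (Or.inl ⟨i, rfl⟩) (Or.inr ⟨j, rfl⟩)

theorem Grassmann.YY_mem (i j : ℕ) : Y i * Y j ∈ evenPart R X Y :=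
  h.mul_mem_evenPart (Or.inr ⟨i, rfl⟩) (Or.inr ⟨j, rfl⟩)

theorem Grassmann.bond_mem (D b c s : R) (i j : ℕ) :
    bond D b c s (X i) (Y i) (X j) (Y j) ∈ evenPart R X Y :=
  add_mem (Subalgebra.smul_mem _ (h.XY_mem j j) _) (add_mem (add_mem
    (Subalgebra.smul_mem _ (h.XX_mem i j) _) (Subalgebra.smul_mem _ (h.YY_mem i j) _))
    (Subalgebra.smul_mem _ (h.XY_mem j i) _))

variable (D b c s : ℕ → R)

theorem Grassmann.ladder_mem (k : ℕ) : ladder X Y D b c s k ∈ evenPart R X Y := by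
  induction k using Nat.twoStepInduction with
  | zero => exact zero_mem _
  | one => exact Subalgebra.smul_mem _ (h.XY_mem 0 0) _
  | more k _ h2 => exact add_mem h2 (h.bond_mem _ _ _ _ _ _)

theorem Grassmann.ladderTop_mem (k : ℕ) : ladderTop X Y k ∈ evenPart R X Y := by
  induction k with
  | zero => exact one_mem _
  | succ k ih => exact mul_mem ih (h.XY_mem k k)

omit h in
theorem commute_bond_of_mem {z : S} (hz : z ∈ evenPart R X Y) (D b c s : R) (i j : ℕ) :
    Commute z (bond D b c s (X i) (Y i) (X j) (Y j)) := by
  have hX := fun i => commute_X_of_mem hz i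
  have hY := fun i => commute_Y_of_mem hz i
  exact (((hX j).mul_right (hY j)).smul_right _).add_right
    (((((hX i).mul_right (hX j)).smul_right _).add_right
      (((hY i).mul_right (hY j)).smul_right _)).add_right
      (((hX j).mul_right (hY i)).smul_right _))

theorem Grassmann.ladderTop_mul_eq_zero {i k : ℕ} (hi : i < k) :
    ladderTop X Y k * X i = 0 ∧ ladderTop X Y k * Y i = 0 := by
  induction k with
  | zero => omega
  | succ k ih =>
    have hX := (h.commute_mul_mul (p := X k) (q := Y k) (Or.inl ⟨k, rfl⟩) (Or.inr ⟨k, rfl⟩)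
      (Or.inl ⟨i, rfl⟩)).eq
    have hY := (h.commute_mul_mul (p := X k) (q := Y k) (Or.inl ⟨k, rfl⟩) (Or.inr ⟨k, rfl⟩)
      (Or.inr ⟨i, rfl⟩)).eq
    rcases Nat.lt_succ_iff_lt_or_eq.1 hi with h1 | rfl
    · rw [ladderTop, mul_assoc _ _ (X i), mul_assoc _ _ (Y i), hX, hY, ← mul_assoc _ (X i),
        ← mul_assoc _ (Y i), (ih h1).1, (ih h1).2]
      simp
    · rw [ladderTop, mul_assoc _ _ (X i), mul_assoc _ _ (Y i), hX, ← mul_assoc (X i), h.xsq,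
        mul_assoc (X i), h.ysq]
      simp

theorem Grassmann.ladderTop_mul_ladder (k : ℕ) :
    ladderTop X Y k * ladder X Y D b c s k = 0 := by
  suffices H : ∀ m ≤ k, ladderTop X Y k * ladder X Y D b c s m = 0 from H k le_rfl
  intro m hm
  induction m using Nat.twoStepInduction with
  | zero => simp [ladder]
  | one => simp [ladder, ← mul_assoc, (h.ladderTop_mul_eq_zero (i := 0) (k := k) (by omega)).1]
  | more m _ h2 =>
    rw [ladder, mul_add, h2 (by omega), zero_add, ladderStep, bond]
    simp [mul_add, ← mul_assoc, (h.ladderTop_mul_eq_zero (i := m) (k := k) (by omega)).1,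
      (h.ladderTop_mul_eq_zero (i := m) (k := k) (by omega)).2,
      (h.ladderTop_mul_eq_zero (i := m + 1) (k := k) (by omega)).1]

/-- Every term added with column `k` meets $X_k$ or $Y_k$, so the product $X_kY_k$ removes it. -/
theorem Grassmann.ladder_succ_mul (k : ℕ) :
    ladder X Y D b c s (k + 1) * (X k * Y k) = ladder X Y D b c s k * (X k * Y k) := by
  cases k with
  | zero =>
    simp only [ladder, zero_mul, smul_mul_assoc]
    rw [mul_assoc, ← mul_assoc (Y 0), h.yx, neg_mul, mul_assoc, h.ysq]
    simp
  | succ k =>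
    rw [ladder, add_mul, ladderStep, (h.bond_relations _ _ _ _ _ _).2.2.2.1, add_zero]

omit h in
theorem mul_pow_mul_eq {A B z : S} (hA : Commute A B) (hAz : A * z = B * z)
    (m : ℕ) : A ^ m * z = B ^ m * z := by
  induction m with
  | zero => simp
  | succ m ih =>
    rw [pow_succ, mul_assoc, hAz, ← mul_assoc, (hA.pow_left m).eq, mul_assoc, ih, ← mul_assoc,
      ← pow_succ']

/-- The `k`-th power counts perfect matchings of the ladder, each $k!$ times for the order of its
edges. The number of edges over a bond has the parity of the number of vertices to its left, hence
is 0 or 2, and two edges must be the two rails. So a matching is a choice of rungs and disjoint rail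
pairs, which is a continuant; the diagonals `s` never contribute. -/
theorem Grassmann.ladder_pow (k : ℕ) :
    ladder X Y D b c s k ^ k =
      (k.factorial : ℕ) • contin D (fun i => -(b i * c i)) k • ladderTop X Y k ∧
    ladder X Y D b c s k ^ (k + 1) = 0 := by
  have hpow (k : ℕ) (hk : ladder X Y D b c s k ^ k =
      (k.factorial : ℕ) • contin D (fun i => -(b i * c i)) k • ladderTop X Y k) :
      ladder X Y D b c s k ^ (k + 1) = 0 := by
    rw [pow_succ, hk, smul_mul_assoc, smul_mul_assoc, h.ladderTop_mul_ladder, smul_zero, smul_zero]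
  suffices H : ladder X Y D b c s k ^ k =
      (k.factorial : ℕ) • contin D (fun i => -(b i * c i)) k • ladderTop X Y k from ⟨H, hpow k H⟩
  induction k using Nat.twoStepInduction with
  | zero => simp [ladder, ladderTop]
  | one => simp [ladder, ladderTop]
  | more k h1 h2 =>
    obtain ⟨r1, r2, r3, -⟩ := h.bond_relations k (k + 1) (D (k + 1)) (b k) (c k) (s k)
    have hA := h.ladder_mem D b c s (k + 1)
    have hA' := h.ladder_mem D b c s k
    have hM : Commute (ladder X Y D b c s (k + 1))
        (-(b k * c k) • (X k * Y k * (X (k + 1) * Y (k + 1)))) :=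
      (((commute_X_of_mem hA _).mul_right (commute_Y_of_mem hA _)).mul_right
        ((commute_X_of_mem hA _).mul_right (commute_Y_of_mem hA _))).smul_right _
    have hAA : Commute (ladder X Y D b c s (k + 1)) (ladder X Y D b c s k) := by
      cases k with
      | zero => exact Commute.zero_right _
      | succ k =>
        rw [ladder]
        exact (Commute.refl _).add_left (commute_bond_of_mem hA' _ _ _ _ _ _).symm
    -- This is the case of two rails over the last bond: columns `k` and `k + 1` are then saturated
    -- and the shorter ladder remains.
    have hlow : ladder X Y D b c s (k + 1) ^ k * (X k * Y k) =
        (k.factorial : ℕ) • contin D (fun i => -(b i * c i)) k • ladderTop X Y (k + 1) := by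
      rw [mul_pow_mul_eq hAA (h.ladder_succ_mul D b c s k), h1, ladderTop]
      simp only [smul_mul_assoc]
    rw [ladder, ladderStep, add_pow_of_sq_eq (commute_bond_of_mem hA _ _ _ _ _ _) hM r1 r2,
      hpow _ h2, h2, zero_add]
    have e1 : ladderTop X Y (k + 1) * bond (D (k + 1)) (b k) (c k) (s k) (X k) (Y k)
        (X (k + 1)) (Y (k + 1)) = D (k + 1) • ladderTop X Y (k + 2) := by
      rw [ladderTop, mul_assoc, r3, mul_smul_comm, ladderTop, ladderTop, mul_assoc (ladderTop X Y k)]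
    rw [smul_mul_assoc, smul_mul_assoc, e1, mul_smul_comm, ← mul_assoc, hlow, contin_add_two,
      smul_mul_assoc, smul_mul_assoc, ← ladderTop, Nat.factorial_succ (k + 1), Nat.factorial_succ k]
    module

omit h in
theorem ladder_mul_left (h : Grassmann X Y) (k : ℕ) :
    ladder X Y D b c s (k + 1) * (X 0 * Y 0) =
      ladder (fun i => X (i + 1)) (fun i => Y (i + 1)) (fun i => D (i + 1)) (fun i => b (i + 1))
        (fun i => c (i + 1)) (fun i => s (i + 1)) k * (X 0 * Y 0) := by
  have hX : X 0 * (X 0 * Y 0) = 0 := by rw [← mul_assoc, h.xsq, zero_mul]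
  have hY : Y 0 * (X 0 * Y 0) = 0 := by
    rw [← mul_assoc, h.yx, neg_mul, mul_assoc, h.ysq, mul_zero, neg_zero]
  induction k using Nat.twoStepInduction with
  | zero => simp [ladder, mul_assoc, hY]
  | one =>
    simp only [ladder, ladderStep, bond, add_mul, smul_mul_assoc, mul_assoc, hY, zero_add,
      mul_zero, smul_zero, add_zero]
    have e1 : X 0 * (X 1 * (X 0 * Y 0)) = 0 := by
      rw [← mul_assoc, h.xx, neg_mul, mul_assoc, hX, mul_zero, neg_zero]
    have e2 : Y 0 * (Y 1 * (X 0 * Y 0)) = 0 := by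
      rw [← mul_assoc, h.yy, neg_mul, mul_assoc, hY, mul_zero, neg_zero]
    simp [e1, e2]
  | more k _ h2 =>
    rw [ladder, add_mul, h2, ladder.eq_3 (fun i => X (i + 1)), add_mul]
    rfl

theorem Grassmann.shift : Grassmann (fun i => X (i + 1)) (fun i => Y (i + 1)) :=
  ⟨fun _ _ => h.xx _ _, fun _ _ => h.yy _ _, fun _ _ => h.yx _ _, fun _ => h.xsq _,
    fun _ => h.ysq _⟩

theorem Grassmann.ladderTop_shift (k : ℕ) :
    ladderTop (fun i => X (i + 1)) (fun i => Y (i + 1)) k * (X 0 * Y 0) =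
      ladderTop X Y (k + 1) := by
  induction k with
  | zero => simp [ladderTop]
  | succ k ih =>
    rw [ladderTop, mul_assoc, ((commute_X_of_mem (h.XY_mem (R := ℤ) (k + 1) (k + 1)) 0).mul_right
      (commute_Y_of_mem (h.XY_mem (R := ℤ) (k + 1) (k + 1)) 0)).eq, ← mul_assoc, ih]
    rfl

/-- Both end columns are already occupied, so every edge touching them dies and the inner ladder on
columns $1,\dots,k$ remains. -/
theorem Grassmann.ladder_pow_mul_corners (k : ℕ) :
    ladder X Y D b c s (k + 2) ^ k * (X 0 * Y 0 * (X (k + 1) * Y (k + 1))) =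
      (k.factorial : ℕ) • contin (fun i => D (i + 1)) (fun i => -(b (i + 1) * c (i + 1))) k •
        ladderTop X Y (k + 2) := by
  have hA := h.ladder_mem D b c s (k + 1)
  have hz (z : S) (hz : z ∈ evenPart R X Y) (i : ℕ) : Commute z (X i * Y i) :=
    (commute_X_of_mem hz _).mul_right (commute_Y_of_mem hz _)
  have hAA : Commute (ladder X Y D b c s (k + 2)) (ladder X Y D b c s (k + 1)) := by
    rw [ladder]
    exact (Commute.refl _).add_left (commute_bond_of_mem hA _ _ _ _ _ _).symm
  set L := ladder (fun i => X (i + 1)) (fun i => Y (i + 1)) (fun i => D (i + 1))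
    (fun i => b (i + 1)) (fun i => c (i + 1)) (fun i => s (i + 1)) k with hL
  have hAL : Commute (ladder X Y D b c s (k + 1)) L := by
    have hcomm : ∀ m, Commute (ladder X Y D b c s (k + 1)) (ladder (fun i => X (i + 1))
        (fun i => Y (i + 1)) (fun i => D (i + 1))
        (fun i => b (i + 1)) (fun i => c (i + 1)) (fun i => s (i + 1)) m) := by
      intro m
      induction m using Nat.twoStepInduction with
      | zero => exact Commute.zero_right _
      | one => exact (hz _ hA 1).smul_right _
      | more m _ h2 => exact h2.add_right (commute_bond_of_mem hA _ _ _ _ _ _)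
    exact hcomm k
  have e : X 0 * Y 0 * (X (k + 1) * Y (k + 1)) = X (k + 1) * Y (k + 1) * (X 0 * Y 0) :=
    (hz _ (h.XY_mem 0 0) (k + 1)).eq
  rw [e, ← mul_assoc, mul_pow_mul_eq hAA (h.ladder_succ_mul D b c s (k + 1)),
    mul_assoc, ← e, ← mul_assoc, mul_pow_mul_eq hAL (ladder_mul_left D b c s h k),
    (h.shift.ladder_pow _ _ _ _ k).1]
  simp only [smul_mul_assoc, h.ladderTop_shift]
  rfl

/-- The coefficients of the configurations with one edge over each bond. -/
def transfer (b c s : ℕ → R) (p : R × R) : ℕ → R × R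
  | 0 => p
  | k + 1 => (-(c k * (transfer b c s p k).2),
      b k * (transfer b c s p k).1 - s k * (transfer b c s p k).2)

/-- With one vertex of the first column and one of the last already occupied, parity forces exactly
one edge over each bond. The pair in `transfer` is indexed by the vertex that closes the last
column: if it is $X$, the free $Y$ can only be reached by a rail of weight `c`; if it is $Y$, the
free $X$ is reached by a rail `b` or a diagonal `s`. The pair `p` is the reordering sign in the
first column. -/
theorem Grassmann.ladder_pow_mul_ends {U : S} (hU : U = X 0 ∨ U = Y 0) (p : R × R)
    (h1 : U * X 0 = p.1 • (X 0 * Y 0)) (h2 : U * Y 0 = p.2 • (X 0 * Y 0)) (k : ℕ) :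
    U * (ladder X Y D b c s (k + 1) ^ k * X k) =
        (k.factorial : ℕ) • (transfer b c s p k).1 • ladderTop X Y (k + 1) ∧
    U * (ladder X Y D b c s (k + 1) ^ k * Y k) =
        (k.factorial : ℕ) • (transfer b c s p k).2 • ladderTop X Y (k + 1) := by
  induction k with
  | zero => simp [transfer, ladderTop, h1, h2]
  | succ k ih =>
    obtain ⟨-, -, -, -, r5, r6, r7, r8⟩ :=
      h.bond_relations k (k + 1) (D (k + 1)) (b k) (c k) (s k)
    have hA := h.ladder_mem D b c s (k + 1)
    have hUA : U * ladder X Y D b c s (k + 1) ^ (k + 1) = 0 := by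
      have hUC : Commute U (ladderTop X Y (k + 1)) := by
        rcases hU with rfl | rfl
        · exact (commute_X_of_mem (h.ladderTop_mem (R := R) (k + 1)) 0).symm
        · exact (commute_Y_of_mem (h.ladderTop_mem (R := R) (k + 1)) 0).symm
      have : ladderTop X Y (k + 1) * U = 0 := by
        rcases hU with rfl | rfl
        · exact (h.ladderTop_mul_eq_zero (by omega)).1
        · exact (h.ladderTop_mul_eq_zero (by omega)).2
      rw [(h.ladder_pow D b c s (k + 1)).1, mul_smul_comm, mul_smul_comm, hUC.eq, this, smul_zero,
        smul_zero]
    have hx : U * (ladder X Y D b c s (k + 1) ^ k * (X k * (X (k + 1) * Y (k + 1)))) =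
        (k.factorial : ℕ) • (transfer b c s p k).1 • ladderTop X Y (k + 2) := by
      rw [← mul_assoc _ (X k), ← mul_assoc U, ih.1, smul_mul_assoc, smul_mul_assoc, ← ladderTop]
    have hy : U * (ladder X Y D b c s (k + 1) ^ k * (Y k * (X (k + 1) * Y (k + 1)))) =
        (k.factorial : ℕ) • (transfer b c s p k).2 • ladderTop X Y (k + 2) := by
      rw [← mul_assoc _ (Y k), ← mul_assoc U, ih.2, smul_mul_assoc, smul_mul_assoc, ← ladderTop]
    rw [ladder, ladderStep, add_pow_mul_of_sq_mul_eq_zero (commute_bond_of_mem hA _ _ _ _ _ _) r7,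
      add_pow_mul_of_sq_mul_eq_zero (commute_bond_of_mem hA _ _ _ _ _ _) r8, mul_add, mul_add,
      ← mul_assoc U, ← mul_assoc U, hUA, r5, r6]
    simp only [mul_sub, mul_smul_comm, hx, hy, zero_mul, zero_add, transfer, Nat.factorial_succ]
    constructor <;> module

/-- Matchings are sorted by the number of closing edges used: none gives the open continuant, two
give $-b'c'$ times the inner continuant, and one gives a path of single edges winding once around
the ladder, counted by `transfer`. -/
theorem Grassmann.add_ladder_pow_cyclic (k : ℕ) (b' c' s' : R) :
    (ladder X Y D b c s (k + 2) + bond 0 b' c' s' (X 0) (Y 0) (X (k + 1)) (Y (k + 1))) ^ (k + 2) =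
      ((k + 2).factorial : ℕ) • (contin D (fun i => -(b i * c i)) (k + 2) -
        b' * c' * contin (fun i => D (i + 1)) (fun i => -(b (i + 1) * c (i + 1))) k +
        (b' * (transfer b c s (0, 1) (k + 1)).1 + c' * (transfer b c s (-1, 0) (k + 1)).2 -
          s' * (transfer b c s (-1, 0) (k + 1)).1)) • ladderTop X Y (k + 2) := by
  obtain ⟨r1, r2, -⟩ := h.bond_relations 0 (k + 1) 0 b' c' s'
  have hA := h.ladder_mem D b c s (k + 2)
  have hM : Commute (ladder X Y D b c s (k + 2))
      (-(b' * c') • (X 0 * Y 0 * (X (k + 1) * Y (k + 1)))) :=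
    (((commute_X_of_mem hA _).mul_right (commute_Y_of_mem hA _)).mul_right
      ((commute_X_of_mem hA _).mul_right (commute_Y_of_mem hA _))).smul_right _
  -- The initial vectors express $X_0X_0=0$, $X_0Y_0$ and, in the next line, $Y_0X_0=-X_0Y_0$,
  -- $Y_0Y_0=0$.
  have hX := h.ladder_pow_mul_ends D b c s (Or.inl rfl) (0, 1) (by simp [h.xsq]) (by simp) (k + 1)
  have hY := h.ladder_pow_mul_ends D b c s (Or.inr rfl) (-1, 0) (by simp [h.yx])
    (by simp [h.ysq]) (k + 1)
  have hpA : ladder X Y D b c s (k + 2) ^ (k + 1) ∈ evenPart R X Y := pow_mem hA _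
  have hsw : X (k + 1) * Y 0 = -(Y 0 * X (k + 1)) := by rw [h.yx, neg_neg]
  have hmove (U V : S) (hU : Commute (ladder X Y D b c s (k + 2) ^ (k + 1)) U) :
      ladder X Y D b c s (k + 2) ^ (k + 1) * (U * V) =
        U * (ladder X Y D b c s (k + 2) ^ (k + 1) * V) := by
    rw [← mul_assoc, hU.eq, mul_assoc]
  have hW : ladder X Y D b c s (k + 2) ^ (k + 1) *
      bond 0 b' c' s' (X 0) (Y 0) (X (k + 1)) (Y (k + 1)) =
      ((k + 1).factorial : ℕ) • (b' * (transfer b c s (0, 1) (k + 1)).1 +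
        c' * (transfer b c s (-1, 0) (k + 1)).2 -
          s' * (transfer b c s (-1, 0) (k + 1)).1) • ladderTop X Y (k + 2) := by
    rw [bond, zero_smul, zero_add, hsw]
    simp only [mul_add, mul_smul_comm, mul_neg]
    rw [hmove _ _ (commute_X_of_mem hpA 0), hmove _ _ (commute_Y_of_mem hpA 0),
      hmove _ _ (commute_Y_of_mem hpA 0), hX.1, hY.1, hY.2]
    module
  rw [add_pow_of_sq_eq (commute_bond_of_mem hA _ _ _ _ _ _) hM r1 r2, hW, mul_smul_comm,
    h.ladder_pow_mul_corners, (h.ladder_pow D b c s (k + 2)).1, Nat.factorial_succ (k + 1),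
    Nat.factorial_succ k]
  module

end Ladder

/-! ### The action of `R[θ]` on `R[∂_θ]` and the top coefficient -/

theorem ladder_eq_sum {R S : Type*} [CommRing R] [Ring S] [Algebra R S] (X Y : ℕ → S)
    (D b c s : ℕ → R) (k : ℕ) : ladder X Y D b c s k =
      ∑ i ∈ Finset.range k, (D i • (X i * Y i) + if i = 0 then 0 else
        b (i - 1) • (X (i - 1) * X i) + c (i - 1) • (Y (i - 1) * Y i) +
          s (i - 1) • (X i * Y (i - 1))) := by
  induction k using Nat.twoStepInduction with
  | zero => simp [ladder]
  | one => simp [ladder]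
  | more k _ h => rw [ladder, h, Finset.sum_range_succ _ (k + 1)]; simp [ladderStep, bond]

section Words

variable (n : ℕ) (R : Type) [CommRing R]

/-- `θ_k`, with `θ_k = 0` for `n ≤ k`. -/
def thetaNat (k : ℕ) : ThetaAlg n R := if h : k < n then theta n R ⟨k, h⟩ else 0

/-- `∂_{θ_k}`, with `∂_{θ_k} = 0` for `n ≤ k`. -/
def delNat (k : ℕ) : DelAlg n R :=
  if h : k < n then ExteriorAlgebra.ι R (Pi.single ⟨k, h⟩ 1) else 0

/-- `θ_0 ⋯ θ_{k-1}`. -/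
def thetaWord : ℕ → ThetaAlg n R
  | 0 => 1
  | k + 1 => thetaWord k * thetaNat n R k

/-- `∂_{θ_0} ⋯ ∂_{θ_{k-1}}`. -/
def delWord : ℕ → DelAlg n R
  | 0 => 1
  | k + 1 => delWord k * delNat n R k

/-- `θ_k ⊗ 1`. -/
def leftTheta (k : ℕ) : ThetaTensor n R := GradedTensorProduct.tmul R (thetaNat n R k) 1

/-- `1 ⊗ θ_k`. -/
def rightTheta (k : ℕ) : ThetaTensor n R := GradedTensorProduct.tmul R 1 (thetaNat n R k)

variable {n R}

theorem thetaNat_mem (k : ℕ) : thetaNat n R k ∈ thetaGrading n R 1 := by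
  unfold thetaNat
  split_ifs with h
  · simp [theta, thetaGrading]
  · exact zero_mem _

theorem thetaWord_mem (k : ℕ) : thetaWord n R k ∈ thetaGrading n R k := by
  induction k with
  | zero => simp [thetaWord, thetaGrading, Submodule.one_eq_range]
  | succ k ih => exact SetLike.mul_mem_graded ih (thetaNat_mem k)

theorem delNat_mem (k : ℕ) : delNat n R k ∈ ⋀[R]^1 (Fin n → R) := by
  unfold delNat
  split_ifs with h
  · simp
  · exact zero_mem _

theorem delWord_mem (k : ℕ) : delWord n R k ∈ ⋀[R]^k (Fin n → R) := by
  induction k with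
  | zero => simp [delWord, Submodule.one_eq_range]
  | succ k ih => exact SetLike.mul_mem_graded ih (delNat_mem k)

theorem delBasis_filter_lt {d : ℕ} (hd : d ≤ n) :
    delBasis n R (Finset.univ.filter fun i : Fin n => (i : ℕ) < d) = delWord n R d := by
  have hcard : (Finset.univ.filter fun i : Fin n => (i : ℕ) < d).card = d := by
    rw [Fin.card_filter_val_lt, min_eq_right hd]
  rw [delBasis, ExteriorAlgebra.basis_apply_ofCard _ hcard]
  have hemb : Set.powersetCard.ofFinEmbEquiv.symm (Set.powersetCard.ofCard hcard) =
      Fin.castLEOrderEmb hd := by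
    rw [Equiv.symm_apply_eq]
    ext i
    simp only [Set.powersetCard.val_ofCard, Finset.mem_filter, Finset.mem_univ, true_and]
    rw [Set.powersetCard.mem_coe_iff, Set.powersetCard.mem_ofFinEmbEquiv_iff_mem_range]
    constructor
    · intro h
      exact ⟨⟨i, h⟩, by simp⟩
    · rintro ⟨j, rfl⟩
      simp
  rw [ExteriorAlgebra.ιMulti_family, hemb, ExteriorAlgebra.ιMulti_apply]
  clear hemb hcard
  induction d with
  | zero => simp [delWord]
  | succ d ih =>
    rw [List.ofFn_succ', List.concat_eq_append, List.prod_append, delWord, ← ih (by omega)]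
    have hd' : d < n := hd
    simp only [delNat, dif_pos hd']
    simp
    rfl

theorem thetaAct_theta (i : Fin n) (q : DelAlg n R) :
    thetaAct n R (theta n R i) q =
      CliffordAlgebra.contractLeft (Q := (0 : QuadraticForm R (Fin n → R)))
        (LinearMap.proj i) q := by
  simp [thetaAct, thetaToCl, theta, clAct]

theorem thetaAct_thetaNat_delWord_mul {i k : ℕ} (hi : k ≤ i) (q : DelAlg n R) :
    thetaAct n R (thetaNat n R i) (delWord n R k * q) =
      (-1) ^ k * (delWord n R k * thetaAct n R (thetaNat n R i) q) := by
  induction k generalizing q with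
  | zero => simp [delWord]
  | succ k ih =>
    rw [delWord, mul_assoc, ih (by omega)]
    have : thetaAct n R (thetaNat n R i) (delNat n R k * q) =
        -(delNat n R k * thetaAct n R (thetaNat n R i) q) := by
      unfold thetaNat delNat
      split_ifs with h1 h2
      · rw [thetaAct_theta, thetaAct_theta]
        refine (CliffordAlgebra.contractLeft_ι_mul _ _ _ ).trans ?_
        have : (⟨i, h1⟩ : Fin n) ≠ ⟨k, h2⟩ := by
          simp only [ne_eq, Fin.mk.injEq]; omega
        simp [Pi.single_eq_of_ne this, ExteriorAlgebra.ι]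
      · simp
      · simp
      · simp
    rw [this]
    simp [pow_succ, mul_assoc]

theorem thetaAct_thetaNat_delWord {i k : ℕ} (hi : k ≤ i) :
    thetaAct n R (thetaNat n R i) (delWord n R k) = 0 := by
  have := thetaAct_thetaNat_delWord_mul hi (1 : DelAlg n R)
  rw [mul_one] at this
  rw [this]
  have h1 : thetaAct n R (thetaNat n R i) 1 = 0 := by
    unfold thetaNat
    split_ifs
    · rw [thetaAct_theta]
      exact CliffordAlgebra.contractLeft_one _ _
    · simp
  rw [h1, mul_zero, mul_zero]

theorem thetaAct_thetaNat_delWord_succ {k : ℕ} (hk : k < n) :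
    thetaAct n R (thetaNat n R k) (delWord n R (k + 1)) = (-1) ^ k * delWord n R k := by
  rw [delWord, thetaAct_thetaNat_delWord_mul le_rfl]
  have : thetaAct n R (thetaNat n R k) (delNat n R k) = 1 := by
    rw [thetaNat, dif_pos hk, delNat, dif_pos hk, thetaAct_theta]
    refine (CliffordAlgebra.contractLeft_ι _ _ _).trans ?_
    simp
  rw [this, mul_one]

/-- The sign of the reversal of `d` letters. -/
def revSign (d : ℕ) : ℤ := (-1) ^ (d * (d - 1) / 2)

theorem revSign_succ (d : ℕ) : revSign (d + 1) = (-1) ^ d * revSign d := by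
  unfold revSign
  have h (m : ℕ) : m * (m - 1) / 2 = ∑ i ∈ Finset.range m, i := (Finset.sum_range_id m).symm
  rw [h, h, Finset.sum_range_succ, pow_add, mul_comm]

theorem revSign_mul_self (d : ℕ) : revSign d * revSign d = 1 := by
  rw [revSign, ← pow_add, ← two_mul, pow_mul]; simp

theorem thetaAct_thetaWord {d : ℕ} (hd : d ≤ n) :
    thetaAct n R (thetaWord n R d) (delWord n R d) = revSign d • 1 := by
  induction d with
  | zero => simp [thetaWord, delWord, revSign]
  | succ d ih =>
    rw [thetaWord, map_mul, Module.End.mul_apply, thetaAct_thetaNat_delWord_succ hd, revSign_succ,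
      ← smul_smul, ← ih (by omega)]
    have : ((-1 : DelAlg n R) ^ d) * delWord n R d = ((-1 : ℤ) ^ d) • delWord n R d := by
      rw [zsmul_eq_mul]; push_cast; rfl
    rw [this, map_zsmul]

open GradedTensorProduct in
theorem tmul_mul_tmul_of_mem {i j : ℕ} {a₁ a₂ b₁ b₂ : ThetaAlg n R}
    (hb : b₁ ∈ thetaGrading n R i) (ha : a₂ ∈ thetaGrading n R j) :
    (tmul R a₁ b₁ * tmul R a₂ b₂ : ThetaTensor n R) =
      ((-1 : ℤ) ^ (i * j)) • tmul R (a₁ * a₂) (b₁ * b₂) := by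
  have := tmul_coe_mul_coe_tmul (thetaGrading n R) (thetaGrading n R) a₁ ⟨b₁, hb⟩ ⟨a₂, ha⟩ b₂
  refine this.trans ?_
  rw [Units.smul_def]
  congr 1

theorem leftTheta_mul_rightTheta (i j : ℕ) :
    leftTheta n R i * rightTheta n R j =
      GradedTensorProduct.tmul R (thetaNat n R i) (thetaNat n R j) :=
  GradedTensorProduct.tmul_one_mul_one_tmul _ _ _ _

theorem thetaNat_mul_thetaNat (i j : ℕ) :
    thetaNat n R i * thetaNat n R j = -(thetaNat n R j * thetaNat n R i) := by
  unfold thetaNat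
  split_ifs
  · exact eq_neg_of_add_eq_zero_left (ExteriorAlgebra.ι_add_mul_swap _ _)
  all_goals simp

theorem thetaNat_sq (i : ℕ) : thetaNat n R i * thetaNat n R i = 0 := by
  unfold thetaNat
  split_ifs
  · exact ExteriorAlgebra.ι_sq_zero _
  · simp

theorem leftTheta_mul_leftTheta (i j : ℕ) : leftTheta n R i * leftTheta n R j =
    GradedTensorProduct.tmul R (thetaNat n R i * thetaNat n R j) 1 :=
  ((GradedTensorProduct.includeLeft (thetaGrading n R) (thetaGrading n R)).map_mul
    (thetaNat n R i) (thetaNat n R j)).symm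

theorem rightTheta_mul_rightTheta (i j : ℕ) : rightTheta n R i * rightTheta n R j =
    GradedTensorProduct.tmul R 1 (thetaNat n R i * thetaNat n R j) :=
  ((GradedTensorProduct.includeRight (thetaGrading n R) (thetaGrading n R)).map_mul
    (thetaNat n R i) (thetaNat n R j)).symm

theorem grassmann_theta : Grassmann (leftTheta n R) (rightTheta n R) where
  xx i j := by
    rw [leftTheta_mul_leftTheta, leftTheta_mul_leftTheta, thetaNat_mul_thetaNat,
      GradedTensorProduct.tmul, TensorProduct.neg_tmul, map_neg]
  yy i j := by
    rw [rightTheta_mul_rightTheta, rightTheta_mul_rightTheta, thetaNat_mul_thetaNat,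
      GradedTensorProduct.tmul, TensorProduct.tmul_neg, map_neg]
  yx i j := by
    rw [leftTheta_mul_rightTheta, rightTheta, leftTheta,
      tmul_mul_tmul_of_mem (thetaNat_mem i) (thetaNat_mem j)]
    simp
  xsq i := by
    rw [leftTheta_mul_leftTheta, thetaNat_sq, GradedTensorProduct.tmul, TensorProduct.zero_tmul,
      map_zero]
  ysq i := by
    rw [rightTheta_mul_rightTheta, thetaNat_sq, GradedTensorProduct.tmul, TensorProduct.tmul_zero,
      map_zero]

/-- Separating the left letters from the right ones moves the `k`-th left letter past `k` right
letters; these signs multiply to the sign of a reversal. -/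
theorem ladderTop_theta (d : ℕ) : ladderTop (leftTheta n R) (rightTheta n R) d =
    revSign d • GradedTensorProduct.tmul R (thetaWord n R d) (thetaWord n R d) := by
  induction d with
  | zero => simp [ladderTop, revSign, thetaWord]; rfl
  | succ d ih =>
    rw [ladderTop, ih, leftTheta_mul_rightTheta, smul_mul_assoc,
      tmul_mul_tmul_of_mem (thetaWord_mem d) (thetaNat_mem d), smul_smul, revSign_succ, mul_one,
      mul_comm, thetaWord]

variable (n R) in
/-- The coefficient of `1` in `Υ(P ⊗ ∂_{θ_0} ⋯ ∂_{θ_{d-1}} ⊗ ∂_{θ_0} ⋯ ∂_{θ_{d-1}})`. -/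
def topCoeff (d : ℕ) : ThetaTensor n R →ₗ[R] R where
  toFun P := (delBasis n R).repr (upsilon P (delWord n R d) (delWord n R d)) ∅
  map_add' P Q := by simp [upsilon, Finset.sum_add_distrib]
  map_smul' r P := by simp [upsilon, Finset.mul_sum]

theorem upsilon_tmul_delWord {d : ℕ} (hd : d ≤ n) (a b : ThetaAlg n R) :
    upsilon (GradedTensorProduct.tmul R a b) (delWord n R d) (delWord n R d) =
      thetaAct n R a (delWord n R d) * thetaAct n R ((CliffordAlgebra.involute
        (Q := (0 : QuadraticForm R (Module.Dual R (Fin n → R)))).toLinearMap ^ d) b)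
        (delWord n R d) := by
  rw [upsilon, Finset.sum_eq_single d]
  · rw [GradedRing.proj_apply, DirectSum.decompose_of_mem_same (fun k : ℕ => ⋀[R]^k (Fin n → R)) (delWord_mem d)]
    rfl
  · intro k _ hk
    rw [GradedRing.proj_apply, DirectSum.decompose_of_mem_ne (fun k : ℕ => ⋀[R]^k (Fin n → R)) (delWord_mem d) hk.symm]
    simp
  · intro h
    simp at h
    omega

theorem involute_thetaNat (k : ℕ) : CliffordAlgebra.involute
    (Q := (0 : QuadraticForm R (Module.Dual R (Fin n → R)))) (thetaNat n R k) =
      -thetaNat n R k := by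
  unfold thetaNat
  split_ifs
  · exact CliffordAlgebra.involute_ι _
  · simp

theorem involute_pow_thetaWord (m d : ℕ) : (CliffordAlgebra.involute
    (Q := (0 : QuadraticForm R (Module.Dual R (Fin n → R)))).toLinearMap ^ m) (thetaWord n R d) =
      ((-1 : ℤ) ^ (m * d)) • thetaWord n R d := by
  have h1 : CliffordAlgebra.involute
      (Q := (0 : QuadraticForm R (Module.Dual R (Fin n → R)))) (thetaWord n R d) =
      ((-1 : ℤ) ^ d) • thetaWord n R d := by
    induction d with
    | zero => simp only [thetaWord, map_one, pow_zero, one_smul]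
    | succ d ih =>
      rw [thetaWord, map_mul, ih, involute_thetaNat, pow_succ, smul_mul_assoc, mul_neg, mul_smul]
      simp
  induction m with
  | zero => simp
  | succ m ih =>
    rw [pow_succ', Module.End.mul_apply, ih, map_zsmul, AlgHom.toLinearMap_apply, h1, smul_smul,
      ← pow_add]
    congr 2
    ring

/-- Three reversal signs occur, one from `ladderTop_theta` and one from each action of a word on the
opposite word, and they leave one. The factor $(-1)^d$ is the Koszul sign $(-1)^{d\cdot d}$ in
`upsilon`. -/
theorem topCoeff_ladderTop {d : ℕ} (hd : d ≤ n) :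
    topCoeff n R d (ladderTop (leftTheta n R) (rightTheta n R) d) =
      (((-1) ^ d * revSign d : ℤ) : R) := by
  rw [ladderTop_theta, map_zsmul]
  change revSign d • (delBasis n R).repr (upsilon _ _ _) ∅ = _
  rw [upsilon_tmul_delWord hd, involute_pow_thetaWord, map_zsmul, LinearMap.smul_apply,
    thetaAct_thetaWord hd]
  have h1 : (delBasis n R) ∅ = 1 := by
    have := delBasis_filter_lt (n := n) (R := R) (Nat.zero_le n)
    simpa [delWord] using this
  simp only [smul_mul_smul_comm, smul_smul, mul_one]
  rw [map_zsmul, ← h1, Module.Basis.repr_self]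
  have hs := revSign_mul_self d
  have h2 : revSign d * (revSign d * ((-1) ^ (d * d) * revSign d)) = (-1) ^ d * revSign d := by
    have : ((-1 : ℤ)) ^ (d * d) = (-1) ^ d := by
      rcases Nat.even_or_odd d with h | h
      · rw [h.neg_one_pow, (h.mul_left d).neg_one_pow]
      · rw [h.neg_one_pow, (h.mul h).neg_one_pow]
    rw [this]
    linear_combination (-1) ^ d * revSign d * hs
  simp only [Finsupp.smul_apply, Finsupp.single_eq_same, smul_smul]
  rw [h2]
  simp

/-- A rightmost $\theta_i\otimes1$ acts first on the word
$\partial_{\theta_0}\cdots\partial_{\theta_{d-1}}$, in which $\partial_{\theta_i}$ does not occur.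
This discards the terms of $\mathrm H_f$ whose left index is fixed by the symmetry. -/
theorem topCoeff_mul_leftTheta {d i : ℕ} (hd : d ≤ n) (hi : d ≤ i) (Z : ThetaTensor n R) :
    topCoeff n R d (Z * leftTheta n R i) = 0 := by
  have key (a b : ThetaAlg n R) :
      topCoeff n R d (GradedTensorProduct.tmul R a b * leftTheta n R i) = 0 := by
    induction b using DirectSum.Decomposition.inductionOn (thetaGrading n R) with
    | zero => simp [GradedTensorProduct.tmul]
    | homogeneous m =>
      rw [leftTheta, tmul_mul_tmul_of_mem m.2 (thetaNat_mem i), map_zsmul]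
      change _ • (delBasis n R).repr (upsilon _ _ _) ∅ = _
      rw [upsilon_tmul_delWord hd, map_mul (thetaAct n R), Module.End.mul_apply,
        thetaAct_thetaNat_delWord hi]
      simp
    | add x y hx hy =>
      have : (GradedTensorProduct.tmul R a (x + y) : ThetaTensor n R) =
          GradedTensorProduct.tmul R a x + GradedTensorProduct.tmul R a y := by
        simp [GradedTensorProduct.tmul, TensorProduct.tmul_add]
      rw [this, add_mul, map_add, hx, hy, add_zero]
  have hZ : Z = GradedTensorProduct.of R (thetaGrading n R) (thetaGrading n R)
      ((GradedTensorProduct.of R (thetaGrading n R) (thetaGrading n R)).symm Z) := by simp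
  rw [hZ]
  generalize (GradedTensorProduct.of R (thetaGrading n R) (thetaGrading n R)).symm Z = W
  induction W using TensorProduct.induction_on with
  | zero => simp
  | tmul a b => exact key a b
  | add x y hx hy => rw [map_add, add_mul, map_add, hx, hy, add_zero]

end Words

/-! ### Reduction of `σ_{g,g⁻¹}` to a power of a ladder -/

theorem sum_fin_filter_lt {M : Type*} [AddCommMonoid M] {n d : ℕ} (hd : d ≤ n) (G : ℕ → M)
    (p : Fin n → Prop) [DecidablePred p] (hp : ∀ i, p i ↔ (i : ℕ) < d) {F : Fin n → M}
    (hF : ∀ i ∈ Finset.univ.filter p, F i = G i) :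
    ∑ i ∈ Finset.univ.filter p, F i = ∑ i ∈ Finset.range d, G i := by
  rw [Finset.sum_congr rfl hF]
  refine Finset.sum_nbij (fun i => (i : ℕ)) ?_ ?_ ?_ ?_
  · intro i hi
    simpa [hp] using hi
  · intro i _ j _ h
    exact Fin.ext h
  · intro i hi
    have hi : i < d := by simpa using hi
    exact ⟨⟨i, by omega⟩, by simp [hp, hi], rfl⟩
  · intro i _
    rfl

/-! ### Sums of coefficients supported on the diagonal, the subdiagonal or a corner -/

section InnerSums

variable {R S : Type*} [CommRing R] [AddCommGroup S] [Module R S]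

theorem sum_range_ite_eq_smul (i : ℕ) (D : R) (H : ℕ → S) :
    ∑ j ∈ Finset.range (i + 1), (if i = j then D else 0) • H j = D • H i := by
  rw [Finset.sum_eq_single i] <;> simp +contextual [eq_comm]

theorem sum_range_ite_succ_smul (i m : ℕ) (hm : i ≤ m) (s : ℕ → R) (H : ℕ → S) :
    ∑ j ∈ Finset.range m, (if i = j + 1 then s j else 0) • H j =
      if i = 0 then 0 else s (i - 1) • H (i - 1) := by
  rcases i with _ | i
  · simp
  · rw [Finset.sum_eq_single i]
    · simp
    · intro j _ hj
      rw [if_neg (by omega), zero_smul]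
    · intro h
      simp at h
      omega

theorem sum_range_ite_zero_smul (q : Prop) [Decidable q] (m : ℕ) (s : R) (H : ℕ → S) :
    ∑ j ∈ Finset.range m, (if j = 0 ∧ q then s else 0) • H j =
      if 0 < m ∧ q then s • H 0 else 0 := by
  rcases m with _ | m
  · simp
  · rw [Finset.sum_range_succ', Finset.sum_eq_zero]
    · simp [ite_smul]
    · intro j _
      simp

end InnerSums

section Base

theorem theta_eq_thetaNat {n : ℕ} {R : Type} [CommRing R] (i : Fin n) :
    theta n R i = thetaNat n R i := by
  simp [thetaNat]

variable {n : ℕ} {R : Type} [CommRing R] [Algebra ℂ R]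

/-- The ladder coefficients describing `σ_{g,g⁻¹}` when the moved indices are `0, …, d-1`. -/
structure LadderCoeffs (f : MvPolynomial (Fin n) ℂ) (g : Fin n → ℂˣ) (d : ℕ)
    (D b c s : ℕ → MvPolynomial (Fin n) ℂ) (b' c' s' : MvPolynomial (Fin n) ℂ) : Prop where
  pos : 0 < d
  le : d ≤ n
  moved : ∀ i, i ∈ movedIdx g ↔ (i : ℕ) < d
  hf : ∀ i j : Fin n, j ≤ i → (i : ℕ) < d → hfCoeffAt f g i j =
    (if (i : ℕ) = j then D i else 0) + (if (i : ℕ) = j + 1 then s j else 0) +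
      if (j : ℕ) = 0 ∧ (i : ℕ) + 1 = d then s' else 0
  hfg : ∀ i j : Fin n, j < i → (i : ℕ) < d → hfgCoeff f g j i =
    (if (i : ℕ) = j + 1 then b j else 0) + if (j : ℕ) = 0 ∧ (i : ℕ) + 1 = d then b' else 0
  hfg_inv : ∀ i j : Fin n, j < i → (i : ℕ) < d → diagSubst g (hfgCoeff f g⁻¹ j i) =
    (if (i : ℕ) = j + 1 then c j else 0) + if (j : ℕ) = 0 ∧ (i : ℕ) + 1 = d then c' else 0

theorem movedIdx_inv (g : Fin n → ℂˣ) : movedIdx g⁻¹ = movedIdx g := by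
  ext i
  simp [movedIdx]

theorem movedIdx_mul_inv (g : Fin n → ℂˣ) : movedIdx (g * g⁻¹) = ∅ := by
  ext i
  simp [movedIdx]

variable {f : MvPolynomial (Fin n) ℂ} {g : Fin n → ℂˣ} {d : ℕ}
    {D b c s : ℕ → MvPolynomial (Fin n) ℂ} {b' c' s' : MvPolynomial (Fin n) ℂ}

/-- The condition `H 0 0 = 0` covers `d = 1`: there are then no indices $j<i$, while the corner term
on the right is $H(0,0)$. -/
theorem sum_smul_of_eq (φ : MvPolynomial (Fin n) ℂ →ₐ[ℂ] R) {S : Type*} [AddCommGroup S]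
    [Module R S] {d : ℕ} (hd0 : 0 < d) (hd : d ≤ n) (H : ℕ → ℕ → S)
    (p : Fin n → Prop) [DecidablePred p] (hp : ∀ i, p i ↔ (i : ℕ) < d)
    (q : Fin n → Fin n → Prop) [∀ i, DecidablePred (q i)]
    (hq : ∀ i j : Fin n, (i : ℕ) < d → (q i j ↔ (j : ℕ) < i))
    (F : Fin n → Fin n → MvPolynomial (Fin n) ℂ)
    (hF : ∀ i j : Fin n, j < i → (i : ℕ) < d → F i j =
      (if (i : ℕ) = j + 1 then b j else 0) + if (j : ℕ) = 0 ∧ (i : ℕ) + 1 = d then b' else 0)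
    (hH : H 0 0 = 0) :
    ∑ i ∈ Finset.univ.filter p, ∑ j ∈ Finset.univ.filter (q i), φ (F i j) • H i j =
      (∑ i ∈ Finset.range d, if i = 0 then 0 else φ (b (i - 1)) • H i (i - 1)) +
        φ b' • H (d - 1) 0 := by
  let G : ℕ → S := fun i => (if i = 0 then 0 else φ (b (i - 1)) • H i (i - 1)) +
    if 0 < i ∧ i + 1 = d then φ b' • H i 0 else 0
  have h1 : ∀ i ∈ Finset.univ.filter p, ∑ j ∈ Finset.univ.filter (q i), φ (F i j) • H i j =
      G i := by
    intro i hi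
    have hid : (i : ℕ) < d := by simpa [hp] using hi
    let G' : ℕ → S := fun j => (if (i : ℕ) = j + 1 then φ (b j) else 0) • H i j +
      (if j = 0 ∧ (i : ℕ) + 1 = d then φ b' else 0) • H i j
    have h2 : ∀ j ∈ Finset.univ.filter (q i), φ (F i j) • H i j = G' j := by
      intro j hj
      have hj : (j : ℕ) < i := (hq i j hid).1 (Finset.mem_filter.1 hj).2
      rw [hF i j hj hid, map_add, add_smul]
      simp only [apply_ite φ, map_zero, G']
    rw [sum_fin_filter_lt i.2.le G' _ (fun j => hq i j hid) h2,
      Finset.sum_add_distrib, sum_range_ite_succ_smul _ _ le_rfl, sum_range_ite_zero_smul]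
  rw [sum_fin_filter_lt hd G _ hp h1, Finset.sum_add_distrib]
  congr 1
  rw [Finset.sum_eq_single (d - 1)]
  · by_cases h : d = 1
    · subst h; simp [hH]
    · rw [if_pos (by omega)]
  · intro i _ hi
    rw [if_neg (by omega)]
  · intro h
    simp at h
    omega

/-- $\mathrm H_f$ supplies rungs, diagonals and the closing diagonal; $\mathrm H_{f,g}\otimes1$ and
$1\otimes\mathrm H_{f,g^{-1}}$ supply the left and right rails. The remaining sum collects the terms
with left index outside the moved segment, written with $\theta_i\otimes1$ on the right so that
`topCoeff_mul_leftTheta` applies. If the left index is moved, so is the right one, because $j\le i$.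
-/
theorem LadderCoeffs.sigmaBase_eq (h : LadderCoeffs f g d D b c s b' c' s')
    (φ : MvPolynomial (Fin n) ℂ →ₐ[ℂ] R) :
    sigmaBase φ f g g⁻¹ = ladder (leftTheta n R) (rightTheta n R) (fun i => φ (D i))
        (fun i => φ (b i)) (fun i => φ (c i)) (fun i => φ (s i)) d +
      bond 0 (φ b') (φ c') (φ s') (leftTheta n R 0) (rightTheta n R 0) (leftTheta n R (d - 1))
        (rightTheta n R (d - 1)) +
      ∑ i ∈ Finset.univ.filter (fun i : Fin n => ¬ (i : ℕ) < d),
        (-∑ j ∈ Finset.univ.filter (fun j : Fin n => j ≤ i),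
          φ (hfCoeffAt f g i j) • rightTheta n R j) * leftTheta n R i := by
  have hG := grassmann_theta (n := n) (R := R)
  have hmoved : movedIdx g = Finset.univ.filter fun i : Fin n => (i : ℕ) < d := by
    ext i
    simp [h.moved i]
  have e1 : hfElt φ f g = ((∑ i ∈ Finset.range d, (φ (D i) • (leftTheta n R i * rightTheta n R i) +
        if i = 0 then 0 else φ (s (i - 1)) • (leftTheta n R i * rightTheta n R (i - 1)))) +
        φ s' • (leftTheta n R (d - 1) * rightTheta n R 0)) +
      ∑ i ∈ Finset.univ.filter (fun i : Fin n => ¬ (i : ℕ) < d),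
        (-∑ j ∈ Finset.univ.filter (fun j : Fin n => j ≤ i),
          φ (hfCoeffAt f g i j) • rightTheta n R j) * leftTheta n R i := by
    rw [hfElt, ← Finset.sum_filter_add_sum_filter_not _ (fun i : Fin n => (i : ℕ) < d)]
    congr 1
    · let G : ℕ → ThetaTensor n R := fun i => (φ (D i) • (leftTheta n R i * rightTheta n R i) +
        if i = 0 then 0 else φ (s (i - 1)) • (leftTheta n R i * rightTheta n R (i - 1))) +
        if i + 1 = d then φ s' • (leftTheta n R i * rightTheta n R 0) else 0
      have h1 : ∀ i ∈ Finset.univ.filter (fun i : Fin n => (i : ℕ) < d),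
          ∑ j ∈ Finset.univ.filter (fun j : Fin n => j ≤ i), φ (hfCoeffAt f g i j) •
            (GradedTensorProduct.tmul R (theta n R i) (theta n R j) : ThetaTensor n R) = G i := by
        intro i hi
        have hid : (i : ℕ) < d := by simpa using hi
        let G' : ℕ → ThetaTensor n R := fun j => (if (i : ℕ) = j then φ (D i) else 0) •
            (leftTheta n R i * rightTheta n R j) +
          (if (i : ℕ) = j + 1 then φ (s j) else 0) • (leftTheta n R i * rightTheta n R j) +
          (if j = 0 ∧ (i : ℕ) + 1 = d then φ s' else 0) • (leftTheta n R i * rightTheta n R j)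
        have h2 : ∀ j ∈ Finset.univ.filter (fun j : Fin n => j ≤ i), φ (hfCoeffAt f g i j) •
            (GradedTensorProduct.tmul R (theta n R i) (theta n R j) : ThetaTensor n R) = G' j := by
          intro j hj
          have hj : j ≤ i := by simpa using hj
          rw [h.hf i j hj hid, map_add, map_add, add_smul, add_smul, theta_eq_thetaNat,
            theta_eq_thetaNat, ← leftTheta_mul_rightTheta]
          simp only [apply_ite φ, map_zero, G']
        rw [sum_fin_filter_lt (d := i + 1) i.2 G' _
          (fun j => by rw [Fin.le_def, Nat.lt_succ_iff]) h2, Finset.sum_add_distrib,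
          Finset.sum_add_distrib, sum_range_ite_eq_smul, sum_range_ite_succ_smul _ _ (by omega),
          sum_range_ite_zero_smul]
        simp [G]
      rw [sum_fin_filter_lt h.le G _ (fun _ => Iff.rfl) h1,
        Finset.sum_add_distrib]
      congr 1
      rw [Finset.sum_eq_single (d - 1)]
      · have := h.pos
        rw [if_pos (by omega)]
      · intro i _ hi
        rw [if_neg (by omega)]
      · intro hh
        have := h.pos
        simp at hh
        omega
    · refine Finset.sum_congr rfl fun i _ => ?_
      rw [neg_mul, Finset.sum_mul, ← Finset.sum_neg_distrib]
      refine Finset.sum_congr rfl fun j _ => ?_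
      rw [theta_eq_thetaNat, theta_eq_thetaNat, ← leftTheta_mul_rightTheta, smul_mul_assoc, hG.yx,
        smul_neg, neg_neg]
  have e2 : (GradedTensorProduct.tmul R (hfgElt φ f g 1) 1 : ThetaTensor n R) =
      (∑ i ∈ Finset.range d, if i = 0 then 0 else
        φ (b (i - 1)) • (leftTheta n R (i - 1) * leftTheta n R i)) +
        φ b' • (leftTheta n R 0 * leftTheta n R (d - 1)) := by
    rw [← sum_smul_of_eq (F := fun i j => diagSubst 1 (hfgCoeff f g j i)) φ h.pos h.le
      (fun i j => leftTheta n R j * leftTheta n R i) (fun i => i ∈ movedIdx g) h.moved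
      (fun i j => j ∈ movedIdx g ∧ j < i) (fun i j hi => by
        rw [h.moved, Fin.lt_def]; omega) (fun i j hji hi => by
        rw [diagSubst_one, AlgHom.id_apply]; exact h.hfg i j hji hi) (hG.xsq 0)]
    change GradedTensorProduct.includeLeft (thetaGrading n R) (thetaGrading n R)
      (hfgElt φ f g 1) = _
    rw [hfgElt, map_sum]
    refine Finset.sum_congr (by ext; simp) fun i _ => ?_
    rw [map_sum]
    refine Finset.sum_congr (by ext; simp) fun j _ => ?_
    rw [map_smul, map_mul, theta_eq_thetaNat, theta_eq_thetaNat]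
    rfl
  have e3 : (GradedTensorProduct.tmul R 1 (hfgElt φ f g⁻¹ g) : ThetaTensor n R) =
      (∑ i ∈ Finset.range d, if i = 0 then 0 else
        φ (c (i - 1)) • (rightTheta n R (i - 1) * rightTheta n R i)) +
        φ c' • (rightTheta n R 0 * rightTheta n R (d - 1)) := by
    rw [← sum_smul_of_eq (F := fun i j => diagSubst g (hfgCoeff f g⁻¹ j i)) φ h.pos h.le
      (fun i j => rightTheta n R j * rightTheta n R i) (fun i => i ∈ movedIdx g) h.moved
      (fun i j => j ∈ movedIdx g ∧ j < i) (fun i j hi => by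
        rw [h.moved, Fin.lt_def]; omega) h.hfg_inv (hG.ysq 0)]
    change GradedTensorProduct.includeRight (thetaGrading n R) (thetaGrading n R)
      (hfgElt φ f g⁻¹ g) = _
    rw [hfgElt, map_sum, movedIdx_inv]
    refine Finset.sum_congr (by ext; simp) fun i _ => ?_
    rw [map_sum]
    refine Finset.sum_congr (by ext; simp) fun j _ => ?_
    rw [map_smul, map_mul, theta_eq_thetaNat, theta_eq_thetaNat]
    rfl
  have e4 : ladder (leftTheta n R) (rightTheta n R) (fun i => φ (D i))
        (fun i => φ (b i)) (fun i => φ (c i)) (fun i => φ (s i)) d =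
      (∑ i ∈ Finset.range d, (φ (D i) • (leftTheta n R i * rightTheta n R i) +
        if i = 0 then 0 else φ (s (i - 1)) • (leftTheta n R i * rightTheta n R (i - 1)))) +
      (∑ i ∈ Finset.range d, if i = 0 then 0 else
        φ (b (i - 1)) • (leftTheta n R (i - 1) * leftTheta n R i)) +
      (∑ i ∈ Finset.range d, if i = 0 then 0 else
        φ (c (i - 1)) • (rightTheta n R (i - 1) * rightTheta n R i)) := by
    rw [ladder_eq_sum, ← Finset.sum_add_distrib, ← Finset.sum_add_distrib]
    refine Finset.sum_congr rfl fun i _ => ?_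
    split_ifs
    · simp
    · abel
  rw [sigmaBase, e1, e2, e3, e4, bond, zero_smul]
  abel

-- The power of the ladder is assumed over every coefficient algebra because `sigma` lives in
-- $\mathrm{Jac}(f^{gg^{-1}})$, which is only isomorphic to $\mathrm{Jac}(f)$. The $d!$ of the power
-- cancels the normalization, and the sign is that of `topCoeff_ladderTop`.
set_option maxHeartbeats 1000000 in
theorem LadderCoeffs.sigmaInv_eq (h : LadderCoeffs f g d D b c s b' c' s')
    (K : MvPolynomial (Fin n) ℂ)
    (hK : ∀ (R : Type) [CommRing R] [Algebra ℂ R] (φ : MvPolynomial (Fin n) ℂ →ₐ[ℂ] R),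
      (ladder (leftTheta n R) (rightTheta n R) (fun i => φ (D i))
        (fun i => φ (b i)) (fun i => φ (c i)) (fun i => φ (s i)) d +
      bond 0 (φ b') (φ c') (φ s') (leftTheta n R 0) (rightTheta n R 0) (leftTheta n R (d - 1))
        (rightTheta n R (d - 1))) ^ d =
      (d.factorial : ℕ) • φ K • ladderTop (leftTheta n R) (rightTheta n R) d) :
    sigmaInv f g = jacMk f (((-1 : ℤ) ^ d * revSign d) • K) := by
  have hcard : (movedIdx g).card = d := by
    have : movedIdx g = Finset.univ.filter fun i : Fin n => (i : ℕ) < d := by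
      ext i
      simp [h.moved i]
    rw [this, Fin.card_filter_val_lt, min_eq_right h.le]
  have hword : delBasis n (Jac (fixPoly f (g * g⁻¹))) (movedIdx g) = delWord n _ d := by
    rw [← delBasis_filter_lt h.le]
    congr 1
    ext i
    simp [h.moved i]
  have hdim : (codim g + codim g⁻¹ - codim (g * g⁻¹)) / 2 = d := by
    rw [codim, codim, codim, movedIdx_inv, movedIdx_mul_inv, hcard]
    simp
    omega
  have hcond : codim (g * g⁻¹) ≤ codim g + codim g⁻¹ ∧
      Even (codim g + codim g⁻¹ - codim (g * g⁻¹)) := by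
    rw [codim, codim, codim, movedIdx_inv, movedIdx_mul_inv, hcard]
    simp
  rw [sigmaInv, sigma, if_pos hcond, hdim, movedIdx_inv, movedIdx_mul_inv, hword]
  set φ := jacFixMk f (g * g⁻¹) with hφ
  have hG := grassmann_theta (n := n) (R := Jac (fixPoly f (g * g⁻¹)))
  have hL := hG.ladder_mem (fun i => φ (D i)) (fun i => φ (b i)) (fun i => φ (c i))
    (fun i => φ (s i)) d
  have hB := hG.bond_mem 0 (φ b') (φ c') (φ s') 0 (d - 1)
  set L := ladder (leftTheta n (Jac (fixPoly f (g * g⁻¹)))) (rightTheta n (Jac (fixPoly f (g * g⁻¹)))) (fun i => φ (D i))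
        (fun i => φ (b i)) (fun i => φ (c i)) (fun i => φ (s i)) d +
      bond 0 (φ b') (φ c') (φ s') (leftTheta n (Jac (fixPoly f (g * g⁻¹))) 0) (rightTheta n (Jac (fixPoly f (g * g⁻¹))) 0) (leftTheta n (Jac (fixPoly f (g * g⁻¹))) (d - 1))
        (rightTheta n (Jac (fixPoly f (g * g⁻¹))) (d - 1)) with hLdef
  have hbase := h.sigmaBase_eq φ
  rw [← hLdef] at hbase
  set N := ∑ i ∈ Finset.univ.filter (fun i : Fin n => ¬ (i : ℕ) < d),
        (-∑ j ∈ Finset.univ.filter (fun j : Fin n => j ≤ i),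
          φ (hfCoeffAt f g i j) • rightTheta n (Jac (fixPoly f (g * g⁻¹))) j) * leftTheta n (Jac (fixPoly f (g * g⁻¹))) i with hN
  have hLm : L ∈ evenPart (Jac (fixPoly f (g * g⁻¹))) (leftTheta n (Jac (fixPoly f (g * g⁻¹)))) (rightTheta n (Jac (fixPoly f (g * g⁻¹)))) :=
    add_mem hL hB
  have hcomm : Commute (L + N) L := by
    refine Commute.add_left (Commute.refl _) ?_
    refine Commute.sum_left _ _ _ fun i _ => ?_
    refine Commute.symm (Commute.mul_right (Commute.neg_right
      (Commute.sum_right _ _ _ fun j _ => ?_)) (commute_X_of_mem hLm i))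
    exact (commute_Y_of_mem hLm j).smul_right _
  -- `L` commutes with `L + N`, so the difference of powers is a multiple of `N` with `N` on the
  -- right, and `topCoeff` kills it.
  have hpow : (L + N) ^ d = L ^ d +
      (∑ i ∈ Finset.range d, (L + N) ^ i * L ^ (d - 1 - i)) * N := by
    have := hcomm.geom_sum₂_mul d
    rw [add_sub_cancel_left] at this
    rw [this]
    abel
  have htop : topCoeff n _ d ((L + N) ^ d) =
      φ ((d.factorial : ℕ) • ((-1 : ℤ) ^ d * revSign d) • K) := by
    rw [hpow, map_add, hK _ φ, map_nsmul, map_smul, topCoeff_ladderTop h.le, hN, Finset.mul_sum,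
      map_sum, Finset.sum_eq_zero, add_zero, map_nsmul, map_zsmul]
    · congr 1
      rw [zsmul_eq_mul, smul_eq_mul]
      exact mul_comm _ _
    · intro i hi
      rw [← mul_assoc]
      exact topCoeff_mul_leftTheta h.le (by simpa using hi) _
  have key : (1 / ((d.factorial : ℕ) : ℂ)) • (delBasis n (Jac (fixPoly f (g * g⁻¹)))).repr
      (upsilon (sigmaBase φ f g g⁻¹ ^ d) (delWord n _ d) (delWord n _ d)) ∅ =
      φ (((-1 : ℤ) ^ d * revSign d) • K) := by
    rw [hbase]
    change _ • topCoeff n _ d ((L + N) ^ d) = _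
    rw [htop, map_nsmul, ← Nat.cast_smul_eq_nsmul ℂ, smul_smul, one_div, inv_mul_cancel₀, one_smul]
    exact_mod_cast Nat.factorial_ne_zero d
  exact (congrArg (jacFixOneEquiv f (g * g⁻¹) (mul_inv_cancel g)) key).trans
    (jacFixOneEquiv_jacFixMk _ _ _ _)

end Base

/-! ### The Casimir element of a Jacobian algebra -/

theorem jacMk_surjective {σ : Type} (f : MvPolynomial σ ℂ) : Function.Surjective (jacMk f) :=
  Ideal.Quotient.mk_surjective

theorem jacMk_eq_zero_iff {σ : Type} (f : MvPolynomial σ ℂ) {p : MvPolynomial σ ℂ} :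
    jacMk f p = 0 ↔ p ∈ jacobianIdeal f :=
  Ideal.Quotient.eq_zero_iff_mem

section Casimir

variable {σ : Type}

/-- A functional on the Jacobian algebra of `f` together with a factorization
`∂_j f(x) - ∂_j f(y) = ∑_i (x_i - y_i) M_{ij}(x, y)` into weighted homogeneous factors, such that
the functional is homogeneous of the degree of `det M`. -/
structure CasimirData [Fintype σ] (f : MvPolynomial σ ℂ) (φ : MvPolynomial σ ℂ →ₗ[ℂ] ℂ)
    (M : Matrix σ σ (MvPolynomial (σ ⊕ σ) ℂ)) : Prop where
  kills : ∀ p ∈ jacobianIdeal f, φ p = 0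
  diff : ∀ j, rename Sum.inl (pderiv j f) - rename Sum.inr (pderiv j f) =
    ∑ i, (X (Sum.inl i) - X (Sum.inr i)) * M i j
  degree : ∃ (w : σ → ℤ) (D : ℤ), (∀ i, 0 < w i) ∧
    (∀ i j, IsWeightedHomogeneous (Sum.elim w w) (M i j) (D - w i - w j)) ∧
    ∀ u : σ →₀ ℕ, φ (monomial u 1) ≠ 0 → ∑ i, (u i : ℤ) * w i = ∑ i, (D - 2 * w i)

variable {A : Type} [CommRing A] [Algebra ℂ A] (π : MvPolynomial σ ℂ →ₐ[ℂ] A)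

/-- The class of a polynomial in two sets of variables in `A ⊗ A`. -/
def tensorMk : MvPolynomial (σ ⊕ σ) ℂ →ₐ[ℂ] A ⊗[ℂ] A :=
  aeval (Sum.elim (fun i => π (X i) ⊗ₜ 1) fun i => 1 ⊗ₜ π (X i))

theorem tensorMk_rename_inl (p : MvPolynomial σ ℂ) :
    tensorMk π (rename Sum.inl p) = π p ⊗ₜ 1 := by
  have : (tensorMk π).comp (rename Sum.inl) =
      (Algebra.TensorProduct.includeLeft : A →ₐ[ℂ] A ⊗[ℂ] A).comp (π) := by
    apply algHom_ext
    intro i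
    simp [tensorMk]
  exact DFunLike.congr_fun this p

theorem tensorMk_rename_inr (p : MvPolynomial σ ℂ) :
    tensorMk π (rename Sum.inr p) = 1 ⊗ₜ π p := by
  have : (tensorMk π).comp (rename Sum.inr) =
      (Algebra.TensorProduct.includeRight : A →ₐ[ℂ] A ⊗[ℂ] A).comp (π) := by
    apply algHom_ext
    intro i
    simp [tensorMk]
  exact DFunLike.congr_fun this p

variable {π}

/-- A functional that kills the kernel of a surjection factors. -/
theorem exists_factor_functional (hs : Function.Surjective π) {φ : MvPolynomial σ ℂ →ₗ[ℂ] ℂ}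
    (h : ∀ p, π p = 0 → φ p = 0) : ∃ ψ : A →ₗ[ℂ] ℂ, ∀ p, ψ (π p) = φ p := by
  have key : ∀ p q, π p = π q → φ p = φ q := by
    intro p q hpq
    rw [← sub_eq_zero, ← map_sub] at hpq ⊢
    exact h _ hpq
  refine ⟨{ toFun := fun a => φ (hs a).choose, map_add' := ?_, map_smul' := ?_ }, ?_⟩
  · intro a b
    rw [← map_add]
    apply key
    rw [map_add, (hs _).choose_spec, (hs _).choose_spec, (hs _).choose_spec]
  · intro r a
    rw [RingHom.id_apply, ← map_smul]
    apply key
    rw [map_smul, (hs _).choose_spec, (hs _).choose_spec]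
  · intro p
    exact key _ _ (hs _).choose_spec

/-- `a ⊗ b ↦ ψ(a) b`. -/
def contractFirst (ψ : A →ₗ[ℂ] ℂ) : A ⊗[ℂ] A →ₗ[ℂ] A :=
  TensorProduct.lift ((LinearMap.lsmul ℂ A : ℂ →ₗ[ℂ] A →ₗ[ℂ] A) ∘ₗ ψ)



@[simp]
theorem contractFirst_tmul (ψ : A →ₗ[ℂ] ℂ) (a b : A) :
    contractFirst ψ (a ⊗ₜ b) = ψ a • b := by
  simp [contractFirst]

theorem contractFirst_mul_right (ψ : A →ₗ[ℂ] ℂ) (b : A) (z : A ⊗[ℂ] A) :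
    contractFirst ψ ((1 ⊗ₜ b) * z) = b * contractFirst ψ z := by
  induction z with
  | zero => simp
  | tmul u v => simp
  | add u v hu hv => rw [mul_add, map_add, map_add, hu, hv, mul_add]

/-- `z ↦ (a ↦ contractFirst ((a ⊗ 1) z))`. -/
def contractEnd (ψ : A →ₗ[ℂ] ℂ) : A ⊗[ℂ] A →ₗ[ℂ] Module.End ℂ (A) :=
  LinearMap.mk₂ ℂ (fun z a => contractFirst ψ ((a ⊗ₜ 1) * z))
    (fun z z' a => by rw [mul_add, map_add]) (fun r z a => by rw [mul_smul_comm, map_smul])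
    (fun z a a' => by rw [TensorProduct.add_tmul, add_mul, map_add])
    (fun r z a => by rw [← TensorProduct.smul_tmul', smul_mul_assoc, map_smul])

theorem trace_contractEnd [Module.Finite ℂ (A)] (ψ : A →ₗ[ℂ] ℂ)
    (z : A ⊗[ℂ] A) :
    LinearMap.trace ℂ (A) (contractEnd ψ z) =
      ψ (Algebra.TensorProduct.lmul' ℂ (S := A) z) := by
  induction z with
  | zero => simp
  | add u v hu hv => rw [map_add, map_add, map_add, map_add, hu, hv]
  | tmul u v =>
    have : contractEnd ψ (u ⊗ₜ v) = (ψ ∘ₗ LinearMap.mulRight ℂ u).smulRight v := by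
      ext a
      simp [contractEnd]
    rw [this, LinearMap.trace_smulRight]
    simp [mul_comm]

variable [Fintype σ] {f : MvPolynomial σ ℂ} {φ : MvPolynomial σ ℂ →ₗ[ℂ] ℂ} {M : Matrix σ σ (MvPolynomial (σ ⊕ σ) ℂ)}

theorem contractFirst_tensorMk_monomial {ψ : A →ₗ[ℂ] ℂ}
    (hψ : ∀ p, ψ (π p) = φ p) (s : σ ⊕ σ →₀ ℕ) :
    contractFirst ψ (tensorMk π (monomial s 1)) =
      φ (∏ i, X i ^ s (Sum.inl i)) • π (∏ i, X i ^ s (Sum.inr i)) := by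
  have : (monomial s 1 : MvPolynomial (σ ⊕ σ) ℂ) =
      rename Sum.inl (∏ i, X i ^ s (Sum.inl i)) * rename Sum.inr (∏ i, X i ^ s (Sum.inr i)) := by
    rw [monomial_eq, C_1, one_mul, Finsupp.prod_fintype _ _ (by simp), Fintype.prod_sum_type]
    simp [map_prod]
  rw [this, map_mul, tensorMk_rename_inl, tensorMk_rename_inr,
    Algebra.TensorProduct.tmul_mul_tmul, one_mul, mul_one, contractFirst_tmul, hψ]

section

variable [DecidableEq σ]

/-- Cramer's rule. In $A\otimes A$ the row vector $x\otimes1-1\otimes x$ is annihilated by `M`,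
since its product with `M` is the difference of two gradients that are zero; multiplying by the
adjugate shows that $\det M$ annihilates each entry. Coordinates generate, so this holds for every
`a`. -/
theorem CasimirData.mul_casimir (h : CasimirData f φ M) (hs : Function.Surjective π)
    (hπ : ∀ p, π p = 0 ↔ p ∈ jacobianIdeal f) (a : A) :
    (a ⊗ₜ 1) * tensorMk π M.det = (1 ⊗ₜ a) * tensorMk π M.det := by
  obtain ⟨p, rfl⟩ := hs a
  have key : ∀ i, (π (X i) ⊗ₜ[ℂ] (1 : A)) * tensorMk π M.det =
      ((1 : A) ⊗ₜ π (X i)) * tensorMk π M.det := by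
    intro i
    set v : σ → A ⊗[ℂ] A := fun i => tensorMk π (X (Sum.inl i) - X (Sum.inr i))
      with hv
    have h1 : Matrix.vecMul v ((tensorMk π).mapMatrix M) = 0 := by
      funext j
      have := congrArg (tensorMk π) (h.diff j)
      rw [map_sub, tensorMk_rename_inl, tensorMk_rename_inr, map_sum] at this
      have h0 : π (pderiv j f) = 0 := by
        rw [hπ]
        exact Ideal.subset_span ⟨j, rfl⟩
      rw [h0, TensorProduct.zero_tmul, TensorProduct.tmul_zero, sub_zero] at this
      simp only [map_mul] at this
      simp [Matrix.vecMul, dotProduct, hv, this]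
    have h2 : Matrix.vecMul v
        ((tensorMk π).mapMatrix M * ((tensorMk π).mapMatrix M).adjugate) = 0 := by
      rw [← Matrix.vecMul_vecMul, h1, Matrix.zero_vecMul]
    rw [Matrix.mul_adjugate, ← AlgHom.map_det, Matrix.vecMul_smul, Matrix.vecMul_one] at h2
    have h3 := congrFun h2 i
    simp only [Pi.smul_apply, smul_eq_mul, Pi.zero_apply, hv, map_sub] at h3
    rw [mul_sub, sub_eq_zero, mul_comm, mul_comm (tensorMk π M.det)] at h3
    simpa [tensorMk] using h3
  have mk1 : ∀ p q : MvPolynomial σ ℂ, π (p * q) ⊗ₜ[ℂ] (1 : A) =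
      (π p ⊗ₜ 1) * (π q ⊗ₜ 1) := by
    intro p q; simp
  have mk2 : ∀ p q : MvPolynomial σ ℂ, (1 : A) ⊗ₜ[ℂ] π (p * q) =
      (1 ⊗ₜ π p) * (1 ⊗ₜ π q) := by
    intro p q; simp
  induction p using MvPolynomial.induction_on with
  | C r =>
    have : π (C r) = r • (1 : A) := by
      rw [← algebraMap_eq, AlgHom.commutes, Algebra.algebraMap_eq_smul_one]
    rw [this, TensorProduct.smul_tmul]
  | add p q hp hq => rw [map_add, TensorProduct.add_tmul, TensorProduct.tmul_add, add_mul, add_mul,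
      hp, hq]
  | mul_X p i hp =>
    rw [mk1, mk2, mul_assoc, key, mul_left_comm, hp]
    ring

/-- $\det M$ is homogeneous of total degree $\sum(D-2w_i)$, the only degree in which the functional
is nonzero. A monomial containing some $y_i$ has too small a degree in `x`, so only $\det M(x,0)$
contributes. -/
theorem CasimirData.contractFirst_casimir (h : CasimirData f φ M) {ψ : A →ₗ[ℂ] ℂ}
    (hψ : ∀ p, ψ (π p) = φ p) :
    contractFirst ψ (tensorMk π M.det) =
      φ (aeval (Sum.elim X 0) M.det) • (1 : A) := by
  obtain ⟨w, D, hw, hM, hφ⟩ := h.degree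
  have hdet : IsWeightedHomogeneous (Sum.elim w w) M.det (∑ i, (D - 2 * w i)) := by
    rw [Matrix.det_apply]
    refine IsWeightedHomogeneous.sum _ _ _ fun τ _ => ?_
    have h1 : IsWeightedHomogeneous (Sum.elim w w) (∏ i, M (τ i) i)
        (∑ i, (D - w (τ i) - w i)) :=
      IsWeightedHomogeneous.prod _ _ _ fun i _ => hM _ _
    have h2 : ∑ i, (D - w (τ i) - w i) = ∑ i, (D - 2 * w i) := by
      simp only [Finset.sum_sub_distrib, two_mul, Finset.sum_add_distrib, Equiv.sum_comp τ w]
      ring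
    rw [h2] at h1
    rcases Int.units_eq_one_or (Equiv.Perm.sign τ) with hs | hs
    · rw [hs, one_smul]; exact h1
    · rw [hs, Units.neg_smul, one_smul]
      exact (weightedHomogeneousSubmodule ℂ (Sum.elim w w) _).neg_mem h1
  generalize M.det = P at hdet
  have hsum := P.support_sum_monomial_coeff
  have hterm : ∀ s ∈ P.support, contractFirst ψ (tensorMk π (monomial s (coeff s P))) =
      φ (aeval (Sum.elim X 0) (monomial s (coeff s P))) • (1 : A) := by
    intro s hs
    have hdeg := hdet (mem_support_iff.1 hs)
    rw [Finsupp.weight_apply, Finsupp.sum_fintype _ _ (by simp), Fintype.sum_sum_type] at hdeg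
    simp only [Sum.elim_inl, Sum.elim_inr] at hdeg
    have hC : (monomial s (coeff s P) : MvPolynomial (σ ⊕ σ) ℂ) = coeff s P • monomial s 1 := by
      simp [smul_monomial]
    rw [hC, map_smul, map_smul, map_smul, map_smul, contractFirst_tensorMk_monomial hψ,
      smul_assoc]
    congr 1
    have hev : (aeval (Sum.elim X 0) (monomial s (1 : ℂ)) : MvPolynomial σ ℂ) =
        (∏ i, X i ^ s (Sum.inl i)) * ∏ i, 0 ^ s (Sum.inr i) := by
      rw [aeval_monomial, map_one, one_mul, Finsupp.prod_fintype _ _ (by simp),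
        Fintype.prod_sum_type]
      simp
    rw [hev]
    by_cases hz : ∀ i, s (Sum.inr i) = 0
    · simp [hz]
    · push Not at hz
      obtain ⟨i, hi⟩ := hz
      rw [Finset.prod_eq_zero (f := fun i => (0 : MvPolynomial σ ℂ) ^ s (Sum.inr i))
        (Finset.mem_univ i) (by simp [hi]), mul_zero, map_zero, zero_smul]
      have h0 : φ (∏ i, X i ^ s (Sum.inl i)) = 0 := by
        by_contra hne
        set u : σ →₀ ℕ := Finsupp.equivFunOnFinite.symm fun i => s (Sum.inl i) with hu
        have hmon : (monomial u 1 : MvPolynomial σ ℂ) = ∏ i, X i ^ s (Sum.inl i) := by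
          rw [monomial_eq, C_1, one_mul, Finsupp.prod_fintype _ _ (by simp)]
          simp [hu]
        rw [← hmon] at hne
        have h1 := hφ u hne
        have h2 : 0 < ∑ i, s (Sum.inr i) • w i := by
          refine Finset.sum_pos' (fun i _ => ?_) ⟨i, Finset.mem_univ _, ?_⟩
          · exact nsmul_nonneg (hw i).le _
          · exact nsmul_pos (hw i) hi
        rw [← h1] at hdeg
        simp only [nsmul_eq_mul, hu, Finsupp.equivFunOnFinite_symm_apply_apply] at hdeg h2
        omega
      rw [h0, zero_smul]
  rw [← hsum, map_sum, map_sum, map_sum, map_sum, Finset.sum_smul]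
  exact Finset.sum_congr rfl hterm

/-- Differentiate the factorization in $x_i$ and put $y=x$: every term still containing a factor
$x_k-y_k$ vanishes. -/
theorem CasimirData.aeval_diagonal (h : CasimirData f φ M) (i j : σ) :
    aeval (Sum.elim X X) (M i j) = pderiv i (pderiv j f) := by
  have h1 := congrArg (fun p => (aeval (Sum.elim X X) (pderiv (Sum.inl i) p) : MvPolynomial σ ℂ))
    (h.diff j)
  have hr : ∀ p : MvPolynomial σ ℂ, pderiv (Sum.inl i) (rename (Sum.inr : σ → σ ⊕ σ) p) = 0 := by
    intro p
    induction p using MvPolynomial.induction_on with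
    | C r => simp
    | add p q hp hq => simp [hp, hq]
    | mul_X p k hp => simp [hp, pderiv_X]
  simp only [map_sub, hr, pderiv_rename Sum.inl_injective, sub_zero, map_sum, Derivation.leibniz,
    aeval_rename, map_add, smul_eq_mul, map_mul, aeval_X, Sum.elim_inl, Sum.elim_inr, sub_self,
    zero_mul, zero_add] at h1
  have h2 : (aeval (Sum.elim X X ∘ Sum.inl) (pderiv i (pderiv j f)) : MvPolynomial σ ℂ) =
      pderiv i (pderiv j f) := by
    rw [Sum.elim_comp_inl, aeval_X_left_apply]
  rw [h2] at h1
  rw [h1, Finset.sum_eq_single i]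
  · simp [pderiv_X]
  · intro k _ hk
    simp [pderiv_X, hk]
  · simp

theorem CasimirData.aeval_diagonal_det (h : CasimirData f φ M) :
    (aeval (Sum.elim X X) M.det : MvPolynomial σ ℂ) = hess f := by
  rw [AlgHom.map_det, hess]
  congr 1
  funext i j
  exact h.aeval_diagonal i j

/-- The endomorphism $a\mapsto(\psi\otimes1)((a\otimes1)\Delta)$ with $\Delta=\det M$ is a scalar,
by moving `a` to the other factor. Its trace is on one hand that scalar times $\dim A$, on the other
hand $\psi$ of the product of the two factors of $\Delta$, which is the Hessian. -/
theorem CasimirData.apply_hess (h : CasimirData f φ M) (hs : Function.Surjective π)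
    (hπ : ∀ p, π p = 0 ↔ p ∈ jacobianIdeal f) [Module.Finite ℂ A] :
    φ (hess f) = φ (aeval (Sum.elim X 0) M.det) * Module.finrank ℂ A := by
  obtain ⟨ψ, hψ⟩ := exists_factor_functional hs fun p hp => h.kills p ((hπ p).1 hp)
  have h1 : contractEnd ψ (tensorMk π M.det) =
      φ (aeval (Sum.elim X 0) M.det) • (LinearMap.id : A →ₗ[ℂ] A) := by
    ext a
    change contractFirst ψ ((a ⊗ₜ 1) * tensorMk π M.det) = _
    rw [h.mul_casimir hs hπ, contractFirst_mul_right, h.contractFirst_casimir hψ]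
    simp
  have h2 := trace_contractEnd ψ (tensorMk π M.det)
  have h3 : (Algebra.TensorProduct.lmul' ℂ (S := A)).comp (tensorMk π) =
      π.comp (aeval (Sum.elim X X)) := by
    apply algHom_ext
    rintro (i | i) <;> simp [tensorMk]
  rw [h1, map_smul, ← AlgHom.comp_apply, h3, AlgHom.comp_apply, h.aeval_diagonal_det, hψ] at h2
  rw [← h2, LinearMap.trace_id, smul_eq_mul]

/-- If $\psi(pA)=0$, contracting $(p\otimes1)\Delta=(1\otimes p)\Delta$ gives zero from the left
side and a nonzero multiple of `p` from the right side. -/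
theorem CasimirData.map_eq_zero (h : CasimirData f φ M) (hs : Function.Surjective π)
    (hπ : ∀ p, π p = 0 ↔ p ∈ jacobianIdeal f)
    (hc : φ (aeval (Sum.elim X 0) M.det) ≠ 0) {p : MvPolynomial σ ℂ}
    (hp : ∀ u, φ (p * monomial u 1) = 0) : π p = 0 := by
  obtain ⟨ψ, hψ⟩ := exists_factor_functional hs fun p hp => h.kills p ((hπ p).1 hp)
  have h1 : ∀ q, φ (p * q) = 0 := by
    intro q
    rw [← q.support_sum_monomial_coeff, Finset.mul_sum, map_sum]
    refine Finset.sum_eq_zero fun u _ => ?_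
    have : (monomial u (coeff u q) : MvPolynomial σ ℂ) = coeff u q • monomial u 1 := by
      simp [smul_monomial]
    rw [this, mul_smul_comm, map_smul, hp, smul_zero]
  have h2 : ∀ z : A ⊗[ℂ] A, contractFirst ψ ((π p ⊗ₜ 1) * z) = 0 := by
    intro z
    induction z with
    | zero => simp
    | add u v hu hv => rw [mul_add, map_add, hu, hv, add_zero]
    | tmul u v =>
      obtain ⟨q, rfl⟩ := hs u
      rw [Algebra.TensorProduct.tmul_mul_tmul, ← map_mul, contractFirst_tmul, hψ, h1, zero_smul]
  have h3 := h2 (tensorMk π M.det)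
  rw [h.mul_casimir hs hπ, contractFirst_mul_right, h.contractFirst_casimir hψ, mul_smul_comm,
    mul_one] at h3
  rw [← inv_smul_smul₀ hc (π p), h3, smul_zero]

/-- The value of the functional on the Hessian. -/
theorem CasimirData.hess_eq (h : CasimirData f φ M) (hf : Module.Finite ℂ (Jac f)) :
    φ (hess f) = φ (aeval (Sum.elim X 0) M.det) * milnorNumber f :=
  h.apply_hess (jacMk_surjective f) fun _ => jacMk_eq_zero_iff f

/-- The functional is nondegenerate. -/
theorem CasimirData.jacMk_eq_zero (h : CasimirData f φ M)
    (hc : φ (aeval (Sum.elim X 0) M.det) ≠ 0) {p : MvPolynomial σ ℂ}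
    (hp : ∀ u, φ (p * monomial u 1) = 0) : jacMk f p = 0 :=
  h.map_eq_zero (jacMk_surjective f) (fun _ => jacMk_eq_zero_iff f) hc hp

end

end Casimir

/-! ### Continuants in graded rings -/

/-- A dimer on $\{i,i+1\}$ replaces two diagonal terms, so giving it degree $e_i+e_{i+1}$ makes the
continuant homogeneous. -/
theorem contin_mem_graded {ι A : Type*} [AddCommMonoid ι] [CommRing A] [Algebra ℂ A]
    (𝒜 : ι → Submodule ℂ A) [SetLike.GradedMonoid 𝒜] {e : ℕ → ι} {D d : ℕ → A} {k : ℕ}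
    (hD : ∀ i < k, D i ∈ 𝒜 (e i)) (hd : ∀ i, i + 1 < k → d i ∈ 𝒜 (e i + e (i + 1))) :
    contin D d k ∈ 𝒜 (∑ i ∈ Finset.range k, e i) := by
  induction k using Nat.twoStepInduction with
  | zero => simpa using SetLike.GradedOne.one_mem
  | one => simpa using hD 0 one_pos
  | more k h1 h2 =>
    rw [contin_add_two]
    refine add_mem ?_ ?_
    · rw [Finset.sum_range_succ, add_comm]
      exact SetLike.GradedMul.mul_mem (hD _ (by omega))
        (h2 (fun i hi => hD i (by omega)) fun i hi => hd i (by omega))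
    · rw [Finset.sum_range_succ, Finset.sum_range_succ, add_assoc, add_comm]
      exact SetLike.GradedMul.mul_mem (hd _ (by omega))
        (h1 (fun i hi => hD i (by omega)) fun i hi => hd i (by omega))

/-! ### Cyclic polynomials -/

section Cyclic

variable {N : ℕ}

/-- `∑_k x_k^{a_k} x_{k+1}^{ε_k}`, the indices being read modulo the number of variables. -/
def cycPoly (a ε : Fin (N + 1) → ℕ) : MvPolynomial (Fin (N + 1)) ℂ :=
  ∑ k, X k ^ a k * X (k + 1) ^ ε k

variable (a ε : Fin (N + 1) → ℕ)

/-- `x^{p + 2S}` is the product of the monomials `m_k` of `cycPoly` with exponents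
`S_k + c_k - c_{k-1}`. -/
def CycCond (S : Fin (N + 1) → ℤ) (p : Fin (N + 1) →₀ ℕ) (c : Fin (N + 1) → ℤ) : Prop :=
  ∀ i, (p i : ℤ) + 2 * S i = a i * (S i + c i - c (i - 1)) +
    ε (i - 1) * (S (i - 1) + c (i - 1) - c (i - 1 - 1))

variable {a ε}

theorem CycCond.add {S S' c c' : Fin (N + 1) → ℤ} {p p' : Fin (N + 1) →₀ ℕ}
    (h : CycCond a ε S p c) (h' : CycCond a ε S' p' c') :
    CycCond a ε (S + S') (p + p') (c + c') := by
  intro i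
  have h1 := h i
  have h2 := h' i
  simp only [Pi.add_apply, Finsupp.add_apply, Nat.cast_add]
  linear_combination h1 + h2

theorem CycCond.of_add {S S' c c' : Fin (N + 1) → ℤ} {p p' : Fin (N + 1) →₀ ℕ}
    (h : CycCond a ε S p c) (h' : CycCond a ε (S + S') (p + p') (c + c')) :
    CycCond a ε S' p' c' := by
  intro i
  have h1 := h i
  have h2 := h' i
  simp only [Pi.add_apply, Finsupp.add_apply, Nat.cast_add] at h2
  linear_combination h2 - h1

/-- Each $m_k$ has weight `D`, and the shifts $c_k-c_{k-1}$ cancel around the cycle. For $S=1$ this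
is the degree $\sum(D-2w_i)$ required by `CasimirData`. -/
theorem CycCond.weight {S c : Fin (N + 1) → ℤ} {p : Fin (N + 1) →₀ ℕ} (h : CycCond a ε S p c)
    {w : Fin (N + 1) → ℤ} {D : ℤ} (hw : ∀ k, a k * w k + ε k * w (k + 1) = D) :
    ∑ i, (p i : ℤ) * w i + 2 * ∑ i, S i * w i = D * ∑ i, S i := by
  have h1 : ∀ F : Fin (N + 1) → ℤ, ∑ i, F (i - 1) = ∑ i, F i := fun F =>
    Equiv.sum_comp (Equiv.subRight (1 : Fin (N + 1))) F
  have h2 : ∑ i, (p i : ℤ) * w i + 2 * ∑ i, S i * w i =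
      ∑ i, a i * (S i + c i - c (i - 1)) * w i +
        ∑ i, ε (i - 1) * (S (i - 1) + c (i - 1) - c (i - 1 - 1)) * w (i - 1 + 1) := by
    rw [Finset.mul_sum, ← Finset.sum_add_distrib, ← Finset.sum_add_distrib]
    refine Finset.sum_congr rfl fun i _ => ?_
    rw [sub_add_cancel]
    linear_combination w i * h i
  rw [h2, h1 fun i => (ε i : ℤ) * (S i + c i - c (i - 1)) * w (i + 1), ← Finset.sum_add_distrib]
  have h3 : ∑ i, S i = ∑ i, (S i + c i - c (i - 1)) := by
    rw [Finset.sum_sub_distrib, Finset.sum_add_distrib, h1 c]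
    ring
  rw [h3, Finset.mul_sum]
  refine Finset.sum_congr rfl fun i _ => ?_
  rw [← hw i]
  ring

variable (a)

/-- The ratio of the classes of `m_k` and `m_{k+1}`. -/
def cycRatio (k : Fin (N + 1)) : ℂ := -(a (k + 1) : ℂ)

variable (ε)

/-- The span of the pairs `(x^p, ∏ t_k^{c_k})` where `c` is supported in `Z`. -/
def cycRep (Z : Finset (Fin (N + 1))) (S : Fin (N + 1) → ℤ) :
    Submodule ℂ (MvPolynomial (Fin (N + 1)) ℂ × ℂ) :=
  Submodule.span ℂ {q | ∃ (p : Fin (N + 1) →₀ ℕ) (c : Fin (N + 1) → ℕ),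
    CycCond a ε S p (fun i => c i) ∧ (∀ i ∉ Z, c i = 0) ∧
      q = (monomial p 1, ∏ i, cycRatio a i ^ c i)}

/-- Formally $x^p=\prod t_k^{c_k}\prod(m_k/x_k^2)^{S_k}$ with $t_k=m_k/m_{k+1}$, so `S` and `c` add
under multiplication. -/
instance (Z : Finset (Fin (N + 1))) : SetLike.GradedMonoid (cycRep a ε Z) where
  one_mem := by
    refine Submodule.subset_span ⟨0, 0, ?_, by simp, ?_⟩
    · intro i
      simp
    · ext1 <;> simp
  mul_mem := by
    intro S S' x y hx hy
    have h := Submodule.mul_mem_mul hx hy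
    rw [cycRep, cycRep, Submodule.span_mul_span] at h
    refine Submodule.span_le.2 ?_ h
    rintro _ ⟨_, ⟨p, c, h1, h2, rfl⟩, _, ⟨p', c', h1', h2', rfl⟩, rfl⟩
    refine Submodule.subset_span ⟨p + p', c + c', ?_, ?_, ?_⟩
    · have := h1.add h1'
      intro i
      simpa using this i
    · intro i hi
      simp [h2 i hi, h2' i hi]
    · ext1
      · simp [monomial_mul]
      · simp [pow_add, Finset.prod_mul_distrib]

variable {a ε}

theorem mem_cycRep {Z : Finset (Fin (N + 1))} {S : Fin (N + 1) → ℤ} {p : Fin (N + 1) →₀ ℕ}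
    {c : Fin (N + 1) → ℕ} (h : CycCond a ε S p fun i => c i) (hc : ∀ i ∉ Z, c i = 0) (r : ℂ) :
    (monomial p r, r * ∏ i, cycRatio a i ^ c i) ∈ cycRep a ε Z S := by
  have h1 : (monomial p r, r * ∏ i, cycRatio a i ^ c i) =
      r • ((monomial p 1 : MvPolynomial (Fin (N + 1)) ℂ), ∏ i, cycRatio a i ^ c i) := by
    ext1
    · simp [smul_monomial]
    · simp
  rw [h1]
  exact Submodule.smul_mem _ _ (Submodule.subset_span ⟨p, c, h, hc, rfl⟩)

/-- The continuant is formed in the product ring of polynomials and numbers; its two projections are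
the two continuants. -/
theorem contin_mem_cycRep {Z : Finset (Fin (N + 1))} {e : ℕ → Fin (N + 1) → ℤ}
    {D d : ℕ → MvPolynomial (Fin (N + 1)) ℂ} {κ δ : ℕ → ℂ} {k : ℕ}
    (hD : ∀ i < k, (D i, κ i) ∈ cycRep a ε Z (e i))
    (hd : ∀ i, i + 1 < k → (d i, δ i) ∈ cycRep a ε Z (e i + e (i + 1))) :
    (contin D d k, contin κ δ k) ∈ cycRep a ε Z (∑ i ∈ Finset.range k, e i) := by
  have h := contin_mem_graded (cycRep a ε Z) (D := fun i => (D i, κ i)) (d := fun i => (d i, δ i))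
    hD hd
  have h1 := map_contin (RingHom.fst (MvPolynomial (Fin (N + 1)) ℂ) ℂ) (fun i => (D i, κ i))
    (fun i => (d i, δ i)) k
  have h2 := map_contin (RingHom.snd (MvPolynomial (Fin (N + 1)) ℂ) ℂ) (fun i => (D i, κ i))
    (fun i => (d i, δ i)) k
  have h3 : contin (fun i => (D i, κ i)) (fun i => (d i, δ i)) k = (contin D d k, contin κ δ k) :=
    Prod.ext h1 h2
  rwa [h3] at h

theorem mul_ite_eq_of {α R : Type*} [DecidableEq α] [MulZeroOneClass R] (F : α → R) (i k : α) :
    F i * (if i = k then 1 else 0) = F k * (if i = k then 1 else 0) := by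
  by_cases h : i = k
  · rw [h]
  · simp [h]

/-- The indicator of an index. -/
def idx (i : Fin (N + 1)) : Fin (N + 1) → ℤ := fun j => if j = i then 1 else 0

/-- The hypothesis says $D=\kappa\,m_i/x_i^2$. The side condition excludes a single variable with
$\varepsilon=1$, where $x_{i+1}$ would be $x_i$ and its exponent in $m_i$ would not be $a_i$. -/
theorem diag_mem_cycRep {i : Fin (N + 1)} (hi : i + 1 ≠ i ∨ ε i = 0)
    {D : MvPolynomial (Fin (N + 1)) ℂ} {κ : ℂ}
    (hD : X i ^ 2 * D = C κ * (X i ^ a i * X (i + 1) ^ ε i)) (Z : Finset (Fin (N + 1))) :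
    (D, κ) ∈ cycRep a ε Z (idx i) := by
  set E : Fin (N + 1) →₀ ℕ := Finsupp.single i (a i) + Finsupp.single (i + 1) (ε i) with hE
  have hEi : E i = a i := by
    rcases hi with h | h <;> simp [hE, h]
  have hEj : ∀ j, (E j : ℤ) = a j * idx i j + ε (j - 1) * idx i (j - 1) := by
    intro j
    simp only [hE, Finsupp.add_apply, Finsupp.single_apply, idx, Nat.cast_add, Nat.cast_ite,
      Nat.cast_zero, sub_eq_iff_eq_add, mul_ite, mul_one, mul_zero]
    congr 1
    · by_cases h : j = i
      · simp [h]
      · simp [h, Ne.symm h]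
    · by_cases h : j = i + 1
      · simp [h]
      · simp [h, Ne.symm h]
  have hm : (X i ^ 2 : MvPolynomial (Fin (N + 1)) ℂ) = monomial (Finsupp.single i 2) 1 :=
    X_pow_eq_monomial
  have hm' : C κ * (X i ^ a i * X (i + 1) ^ ε i) = monomial E κ := by
    rw [X_pow_eq_monomial, X_pow_eq_monomial, monomial_mul, C_mul_monomial]
    simp [hE]
  rw [hm, hm'] at hD
  by_cases h2 : 2 ≤ a i
  · have hle : Finsupp.single i 2 ≤ E := by
      rw [Finsupp.single_le_iff, hEi]
      exact h2
    have hDeq : D = monomial (E - Finsupp.single i 2) κ := by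
      have h3 : (monomial (Finsupp.single i 2) 1 : MvPolynomial (Fin (N + 1)) ℂ) ≠ 0 := by
        simp
      apply mul_left_cancel₀ h3
      rw [hD, monomial_mul, add_tsub_cancel_of_le hle, one_mul]
    have h4 := mem_cycRep (a := a) (ε := ε) (Z := Z) (S := idx i) (p := E - Finsupp.single i 2)
      (c := 0) (by
        intro j
        have h5 : E j = (E - Finsupp.single i 2 : Fin (N + 1) →₀ ℕ) j +
            (Finsupp.single i 2 : Fin (N + 1) →₀ ℕ) j := by
          rw [← Finsupp.add_apply, tsub_add_cancel_of_le hle]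
        have h6 : ((Finsupp.single i 2 : Fin (N + 1) →₀ ℕ) j : ℤ) = 2 * idx i j := by
          simp only [Finsupp.single_apply, idx, eq_comm (a := i)]
          split_ifs <;> simp
        have h7 := hEj j
        rw [h5] at h7
        push_cast at h7
        rw [h6] at h7
        simp only [Pi.zero_apply, Nat.cast_zero, add_zero, sub_zero]
        exact h7) (by simp) κ
    simpa [hDeq] using h4
  -- If $a_i<2$ then $x_i^2$ does not divide $m_i$, so $D$ can only be zero.
  · have h3 : κ = 0 := by
      have := congrArg (coeff E) hD
      rw [coeff_monomial, if_pos rfl, coeff_monomial_mul', if_neg] at this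
      · exact this.symm
      · rw [Finsupp.single_le_iff, hEi]
        exact h2
    subst h3
    have h4 : D = 0 := by
      simpa using hD
    rw [h4]
    exact zero_mem _

/-- $x_i^{2(a_i-1)}=m_i^2/(x_i^2x_{i+1}^2)=t_i\cdot(m_i/x_i^2)(m_{i+1}/x_{i+1}^2)$, so a squared
off-diagonal entry fits the degree of a dimer. -/
theorem sq_mem_cycRep (ha : ∀ i, 1 ≤ a i) {i : Fin (N + 1)} (hε : ε i = 1)
    {Z : Finset (Fin (N + 1))} (hi : i ∈ Z) (r : ℂ) :
    (C r * (X i ^ (a i - 1) * X i ^ (a i - 1)), r * cycRatio a i) ∈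
      cycRep a ε Z (idx i + idx (i + 1)) := by
  have h := mem_cycRep (a := a) (ε := ε) (Z := Z) (S := idx i + idx (i + 1))
    (p := Finsupp.single i (2 * (a i - 1))) (c := fun j => if j = i then 1 else 0) (by
      intro j
      have h0 : ((2 * (a i - 1) : ℕ) : ℤ) = 2 * a i - 2 := by
        have := ha i
        omega
      have e1 : ((Finsupp.single i (2 * (a i - 1)) : Fin (N + 1) →₀ ℕ) j : ℤ) =
          (2 * a i - 2) * (if j = i then 1 else 0) := by
        rw [Finsupp.single_apply, ← h0]
        simp only [eq_comm (a := i)]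
        split_ifs <;> simp
      have e2 : (a j : ℤ) * (if j = i then 1 else 0) = a i * (if j = i then 1 else 0) :=
        mul_ite_eq_of (fun j => (a j : ℤ)) j i
      have e3 : (ε (j - 1) : ℤ) * (if j - 1 = i then 1 else 0) =
          1 * (if j - 1 = i then 1 else 0) := by
        rw [mul_ite_eq_of (fun j => (ε j : ℤ)) (j - 1) i, hε, Nat.cast_one]
      rw [e1]
      simp only [Pi.add_apply, idx, Nat.cast_ite, Nat.cast_one, Nat.cast_zero,
        ← sub_eq_iff_eq_add] at e3 ⊢
      linear_combination (-2) * e2 - 2 * e3) (by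
      intro j hj
      rw [if_neg]
      rintro rfl
      exact hj hi) r
  rw [← pow_add, ← two_mul, X_pow_eq_monomial, C_mul_monomial, mul_one]
  simpa using h

/-- For $\varepsilon=1$ the product of all $m_i/x_i^2$ is this monomial itself. -/
theorem prod_mem_cycRep (ha : ∀ i, 1 ≤ a i) (hε : ∀ i, ε i = 1) (Z : Finset (Fin (N + 1)))
    (r : ℂ) : (C r * ∏ i, X i ^ (a i - 1), r) ∈ cycRep a ε Z 1 := by
  have h := mem_cycRep (a := a) (ε := ε) (Z := Z) (S := 1)
    (p := Finsupp.equivFunOnFinite.symm fun i => a i - 1) (c := 0) (by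
      intro j
      have := ha j
      simp [hε]
      omega) (by simp) r
  rw [monomial_eq, Finsupp.prod_fintype _ _ (by simp)] at h
  simpa using h

end Cyclic

/-! ### The residue functional of a cyclic polynomial -/

section Functional

variable {N : ℕ} (a ε : Fin (N + 1) → ℕ) (Adm : (Fin (N + 1) → ℤ) → Prop)

/-- Conditions on a set of exponents that selects one exponent for each monomial. -/
structure CycAdm : Prop where
  inj : ∀ v : Fin (N + 1) → ℤ, (∀ i, a i * v i + ε (i - 1) * v (i - 1) = 0) → v = 0
  ext : ∀ c c', Adm c → Adm c' → (∀ i, c i - c (i - 1) = c' i - c' (i - 1)) → c = c'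
  step : ∀ k, ε k = 1 → ∀ u c, CycCond a ε 1 (u + Finsupp.single k (a k)) c →
    (Adm c ↔ Adm (c - idx k))
  boundary : ∀ k, ε k = 0 → ∀ u c, CycCond a ε 1 (u + (Finsupp.single (k + 1) (a (k + 1) - 1) +
    Finsupp.single (k + 1 + 1) (ε (k + 1)))) c → ¬ Adm c

open scoped Classical in
/-- The coefficient of `x^p` in the functional of type `S`. -/
def cycVal (S : Fin (N + 1) → ℤ) (p : Fin (N + 1) →₀ ℕ) : ℂ :=
  if h : ∃ c, Adm c ∧ CycCond a ε S p c then ∏ i, cycRatio a i ^ h.choose i else 0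

/-- The functional on polynomials with value `cycVal` on monomials. -/
def cycFunctional : MvPolynomial (Fin (N + 1)) ℂ →ₗ[ℂ] ℂ :=
  (basisMonomials (Fin (N + 1)) ℂ).constr ℂ (cycVal a ε Adm 1)

theorem cycFunctional_monomial (p : Fin (N + 1) →₀ ℕ) (r : ℂ) :
    cycFunctional a ε Adm (monomial p r) = r * cycVal a ε Adm 1 p := by
  have h : (monomial p r : MvPolynomial (Fin (N + 1)) ℂ) = r • monomial p 1 := by
    simp [smul_monomial]
  have h1 := (basisMonomials (Fin (N + 1)) ℂ).constr_basis ℂ (cycVal a ε Adm 1) p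
  rw [coe_basisMonomials] at h1
  rw [h, map_smul, smul_eq_mul, cycFunctional, h1]

/-- The pairs `(A, z)` with `φ(A x^u) = z ψ(u)`. -/
def cycVals (S : Fin (N + 1) → ℤ) : Submodule ℂ (MvPolynomial (Fin (N + 1)) ℂ × ℂ) where
  carrier := {q | ∀ u, cycFunctional a ε Adm (q.1 * monomial u 1) = q.2 * cycVal a ε Adm (1 - S) u}
  add_mem' {x y} hx hy u := by
    have h1 := hx u
    have h2 := hy u
    simp only [Prod.fst_add, Prod.snd_add, add_mul, map_add] at *
    rw [h1, h2]
  zero_mem' u := by simp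
  smul_mem' r x hx u := by
    have h1 := hx u
    simp only [Prod.smul_fst, Prod.smul_snd, smul_mul_assoc, map_smul] at *
    rw [h1]

/-- Adding exponents supported in `Z` does not change admissibility. -/
def CycShift (Z : Finset (Fin (N + 1))) (S : Fin (N + 1) → ℤ) : Prop :=
  ∀ c : Fin (N + 1) → ℕ, (∀ i ∉ Z, c i = 0) → ∀ u c', CycCond a ε (1 - S) u c' →
    (Adm ((fun i => (c i : ℤ)) + c') ↔ Adm c')

variable {a ε Adm}

/-- Independence of the exponents of the $m_k$ determines the differences $c_k-c_{k-1}$;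
admissibility fixes the remaining additive constant. -/
theorem CycAdm.unique (h : CycAdm a ε Adm) {S : Fin (N + 1) → ℤ} {p : Fin (N + 1) →₀ ℕ}
    {c c' : Fin (N + 1) → ℤ} (hc : Adm c) (hc' : Adm c') (h1 : CycCond a ε S p c)
    (h2 : CycCond a ε S p c') : c = c' := by
  refine h.ext c c' hc hc' fun i => ?_
  have h3 := h.inj (fun i => (c i - c (i - 1)) - (c' i - c' (i - 1))) fun i => by
    linear_combination h2 i - h1 i
  exact sub_eq_zero.1 (congrFun h3 i)

theorem CycAdm.cycVal_eq (h : CycAdm a ε Adm) {S : Fin (N + 1) → ℤ} {p : Fin (N + 1) →₀ ℕ}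
    {c : Fin (N + 1) → ℤ} (hc : Adm c) (h1 : CycCond a ε S p c) :
    cycVal a ε Adm S p = ∏ i, cycRatio a i ^ c i := by
  have hex : ∃ c, Adm c ∧ CycCond a ε S p c := ⟨c, hc, h1⟩
  rw [cycVal, dif_pos hex, h.unique hex.choose_spec.1 hc hex.choose_spec.2 h1]

theorem cycVal_eq_zero {S : Fin (N + 1) → ℤ} {p : Fin (N + 1) →₀ ℕ}
    (h : ∀ c, CycCond a ε S p c → ¬ Adm c) : cycVal a ε Adm S p = 0 := by
  rw [cycVal, dif_neg]
  rintro ⟨c, h1, h2⟩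
  exact h c h2 h1

theorem exists_of_cycVal_ne_zero {S : Fin (N + 1) → ℤ} {p : Fin (N + 1) →₀ ℕ}
    (h : cycVal a ε Adm S p ≠ 0) : ∃ c, CycCond a ε S p c := by
  by_contra hne
  push Not at hne
  exact h (cycVal_eq_zero fun c hc => absurd hc (hne c))

theorem cycRatio_ne_zero (ha : ∀ i, 1 ≤ a i) (i : Fin (N + 1)) : cycRatio a i ≠ 0 := by
  rw [cycRatio, neg_ne_zero, Nat.cast_ne_zero]
  have := ha (i + 1)
  omega

/-- On representable monomials exponents `c` add and values multiply, provided adding the `c` of the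
pair preserves admissibility in both directions, which is what `CycShift` grants. This turns formal
classes into values of the functional. -/
theorem CycAdm.cycRep_le (h : CycAdm a ε Adm) (ha : ∀ i, 1 ≤ a i) {Z : Finset (Fin (N + 1))}
    {S : Fin (N + 1) → ℤ} (hS : CycShift a ε Adm Z S) : cycRep a ε Z S ≤ cycVals a ε Adm S := by
  refine Submodule.span_le.2 ?_
  rintro _ ⟨p, c, h1, h2, rfl⟩
  intro u
  simp only [monomial_mul, one_mul, cycFunctional_monomial]
  by_cases hex : ∃ c', Adm c' ∧ CycCond a ε (1 - S) u c'
  · obtain ⟨c', hc', hu⟩ := hex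
    have h3 := h1.add hu
    rw [add_sub_cancel] at h3
    rw [h.cycVal_eq hc' hu, h.cycVal_eq ((hS c h2 u c' hu).2 hc') h3, ← Finset.prod_mul_distrib]
    refine Finset.prod_congr rfl fun i _ => ?_
    rw [Pi.add_apply, zpow_add₀ (cycRatio_ne_zero ha i), zpow_natCast]
  · push Not at hex
    rw [cycVal_eq_zero fun c' hu hc' => hex c' hc' hu, mul_zero]
    refine cycVal_eq_zero fun c'' hc'' hA => ?_
    have h3 : CycCond a ε (1 - S) u (c'' - fun i => (c i : ℤ)) := by
      apply h1.of_add
      rwa [add_sub_cancel, add_sub_cancel]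
    refine hex _ ((hS c h2 u _ h3).1 ?_) h3
    rwa [add_sub_cancel]

theorem pderiv_cycPoly (hε : ∀ i, ε i ≤ 1) (i : Fin (N + 1)) :
    pderiv i (cycPoly a ε) = C (a i : ℂ) * (X i ^ (a i - 1) * X (i + 1) ^ ε i) +
      C (ε (i - 1) : ℂ) * X (i - 1) ^ a (i - 1) := by
  have h1 : ∀ k : Fin (N + 1), pderiv i (X k ^ a k * X (k + 1) ^ ε k : MvPolynomial _ ℂ) =
      (if k = i then C (a i : ℂ) * (X i ^ (a i - 1) * X (i + 1) ^ ε i) else 0) +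
        if k = i - 1 then C (ε (i - 1) : ℂ) * X (i - 1) ^ a (i - 1) else 0 := by
    intro k
    have e1 : (pderiv i (X k ^ a k) : MvPolynomial (Fin (N + 1)) ℂ) =
        if k = i then C (a i : ℂ) * X i ^ (a i - 1) else 0 := by
      rw [pderiv_pow, pderiv_X]
      split_ifs with h
      · subst h; simp
      · simp [h]
    have e2 : (pderiv i (X (k + 1) ^ ε k) : MvPolynomial (Fin (N + 1)) ℂ) =
        if k = i - 1 then C (ε (i - 1) : ℂ) else 0 := by
      rw [pderiv_pow, pderiv_X]
      have h0 : ε k - 1 = 0 := by have := hε k; omega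
      rw [h0, pow_zero]
      split_ifs with h
      · subst h; simp
      · have : k + 1 ≠ i := fun hk => h (by rw [← hk, add_sub_cancel_right])
        simp [this]
    rw [Derivation.leibniz, smul_eq_mul, smul_eq_mul, e1, e2, add_comm (X k ^ a k * _)]
    congr 1
    · split_ifs with h
      · subst h; ring
      · simp
    · split_ifs with h
      · subst h; ring
      · simp
  rw [cycPoly, map_sum, Finset.sum_congr rfl fun k _ => h1 k, Finset.sum_add_distrib]
  simp

/-- Tested on $x^u\partial_{k+1}f$, which has two terms. If $\varepsilon_k=1$ their exponents `c`
differ by one in place `k`, so their values have ratio $t_k=-a_{k+1}$, exactly what cancels the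
coefficients. If $\varepsilon_k=0$ only one term is left, and its value is zero by `boundary`. -/
theorem CycAdm.kills (h : CycAdm a ε Adm) (ha : ∀ i, 1 ≤ a i) (hε : ∀ i, ε i ≤ 1)
    {p : MvPolynomial (Fin (N + 1)) ℂ} (hp : p ∈ jacobianIdeal (cycPoly a ε)) :
    cycFunctional a ε Adm p = 0 := by
  suffices H : ∀ q, cycFunctional a ε Adm (q * p) = 0 by simpa using H 1
  rw [jacobianIdeal] at hp
  induction hp using Submodule.span_induction with
  | zero => intro q; simp
  | add x y _ _ hx hy => intro q; rw [mul_add, map_add, hx, hy, add_zero]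
  | smul r x _ hx => intro q; rw [smul_eq_mul, ← mul_assoc, hx]
  | mem x hx =>
    obtain ⟨i, rfl⟩ := hx
    obtain ⟨k, rfl⟩ : ∃ k, i = k + 1 := ⟨i - 1, by rw [sub_add_cancel]⟩
    intro q
    have hmon : ∀ u, cycFunctional a ε Adm (monomial u 1 * pderiv (k + 1) (cycPoly a ε)) = 0 := by
      intro u
      set p' : Fin (N + 1) →₀ ℕ := u + (Finsupp.single (k + 1) (a (k + 1) - 1) +
        Finsupp.single (k + 1 + 1) (ε (k + 1))) with hp'
      have e1 : (monomial u 1 * pderiv (k + 1) (cycPoly a ε) : MvPolynomial _ ℂ) =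
          monomial p' (a (k + 1) : ℂ) + monomial (u + Finsupp.single k (a k)) (ε k : ℂ) := by
        rw [pderiv_cycPoly hε, add_sub_cancel_right, X_pow_eq_monomial, X_pow_eq_monomial,
          X_pow_eq_monomial, monomial_mul, C_mul_monomial, C_mul_monomial, mul_add, monomial_mul,
          monomial_mul]
        simp [hp']
      simp only [e1, map_add, cycFunctional_monomial]
      have hεk : ε k = 0 ∨ ε k = 1 := by have := hε k; omega
      rcases hεk with hk | hk
      · rw [hk, cycVal_eq_zero fun c hc => h.boundary k hk u c hc]
        simp
      · have hshift : ∀ c, CycCond a ε 1 (u + Finsupp.single k (a k)) c ↔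
            CycCond a ε 1 p' (c - idx k) := by
          intro c
          refine forall_congr' fun j => ?_
          have f1 : ((Finsupp.single (k + 1) (a (k + 1) - 1) : Fin (N + 1) →₀ ℕ) j : ℤ) =
              (a j - 1) * idx k (j - 1) := by
            simp only [Finsupp.single_apply, idx, sub_eq_iff_eq_add, eq_comm (a := k + 1)]
            split_ifs with hj
            · have := ha (k + 1)
              rw [hj]
              omega
            · simp
          have f2 : ((Finsupp.single (k + 1 + 1) (ε (k + 1)) : Fin (N + 1) →₀ ℕ) j : ℤ) =
              ε (j - 1) * idx k (j - 1 - 1) := by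
            simp only [Finsupp.single_apply, idx, sub_eq_iff_eq_add, eq_comm (a := k + 1 + 1)]
            split_ifs with hj
            · rw [hj, add_sub_cancel_right]
              simp
            · simp
          have f3 : ((Finsupp.single k (a k) : Fin (N + 1) →₀ ℕ) j : ℤ) = a j * idx k j := by
            simp only [Finsupp.single_apply, idx, eq_comm (a := k)]
            split_ifs with hj
            · simp [hj]
            · simp
          have f4 : (ε (j - 1) : ℤ) * idx k (j - 1) = idx k (j - 1) := by
            simp only [idx]
            split_ifs with hj
            · simp [hj, hk]
            · simp
          simp only [hp', Finsupp.add_apply, Nat.cast_add, f1, f2, f3, Pi.sub_apply, Pi.one_apply]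
          constructor
          · intro hh
            linear_combination hh + f4
          · intro hh
            linear_combination hh - f4
        by_cases hex : ∃ c, Adm c ∧ CycCond a ε 1 (u + Finsupp.single k (a k)) c
        · obtain ⟨c, hc, hu⟩ := hex
          rw [h.cycVal_eq hc hu, h.cycVal_eq ((h.step k hk u c hu).1 hc) ((hshift c).1 hu), hk]
          have e2 : ∏ i, cycRatio a i ^ c i =
              cycRatio a k * ∏ i, cycRatio a i ^ (c - idx k) i := by
            have e3 : cycRatio a k = ∏ i, cycRatio a i ^ idx k i := by
              simp only [idx]
              rw [Finset.prod_eq_single k]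
              · simp
              · intro j _ hj
                simp [hj]
              · simp
            rw [e3, ← Finset.prod_mul_distrib]
            refine Finset.prod_congr rfl fun i _ => ?_
            rw [← zpow_add₀ (cycRatio_ne_zero ha i), Pi.sub_apply, add_sub_cancel]
          rw [e2, cycRatio]
          push_cast
          ring
        · push Not at hex
          rw [cycVal_eq_zero fun c hu hc => hex c hc hu, cycVal_eq_zero]
          · simp
          · intro c hu hc
            have h5 : CycCond a ε 1 (u + Finsupp.single k (a k)) (c + idx k) := by
              rw [hshift, add_sub_cancel_right]
              exact hu
            refine hex _ ((h.step k hk u _ h5).2 ?_) h5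
            rwa [add_sub_cancel_right]
    rw [← q.support_sum_monomial_coeff, Finset.sum_mul, map_sum]
    refine Finset.sum_eq_zero fun u _ => ?_
    have : (monomial u (coeff u q) : MvPolynomial (Fin (N + 1)) ℂ) = coeff u q • monomial u 1 := by
      simp [smul_monomial]
    rw [this, smul_mul_assoc, map_smul, hmon, smul_zero]

end Functional

/-! ### Chains -/

section Chain

variable {N : ℕ} {a ε : Fin (N + 1) → ℕ}

/-- The exponents `ε` of a chain. -/
def IsChainExp (ε : Fin (N + 1) → ℕ) : Prop :=
  ∀ i, ε i = if i = Fin.last N then 0 else 1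

/-- The admissible exponents for a chain. -/
def chainAdm (c : Fin (N + 1) → ℤ) : Prop := c (Fin.last N) = 0

theorem Fin.mk_succ_sub_one {m : ℕ} (h : m + 1 < N + 1) :
    (⟨m + 1, h⟩ - 1 : Fin (N + 1)) = ⟨m, by omega⟩ := by
  rw [sub_eq_iff_eq_add]
  ext
  rw [Fin.val_add_one_of_lt]
  rw [Fin.lt_def, Fin.val_last]
  simp
  omega

theorem Fin.mk_zero_sub_one (h : 0 < N + 1) : (⟨0, h⟩ - 1 : Fin (N + 1)) = Fin.last N := by
  rw [sub_eq_iff_eq_add]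
  simp

theorem eq_of_eq_sub_one {α : Type*} {v : Fin (N + 1) → α} (h : ∀ i, v i = v (i - 1))
    (i j : Fin (N + 1)) : v i = v j := by
  have h1 : ∀ m (hm : m < N + 1), v ⟨m, hm⟩ = v 0 := by
    intro m
    induction m with
    | zero => intro _; rfl
    | succ m ih =>
      intro hm
      rw [h, Fin.mk_succ_sub_one hm, ih]
  rw [h1 i i.2, h1 j j.2]

/-- The normalization $c_N=0$ reflects that no relation links $m_N$ to $m_0$. The exponent system is
triangular, so injectivity follows by solving from index 0. -/
theorem chain_cycAdm (ha : ∀ i, 1 ≤ a i) (hε : IsChainExp ε) : CycAdm a ε chainAdm where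
  inj v hv := by
    have h1 : ∀ m (hm : m < N + 1), v ⟨m, hm⟩ = 0 := by
      intro m
      induction m with
      | zero =>
        intro hm
        have h0 := hv ⟨0, hm⟩
        rw [Fin.mk_zero_sub_one, hε, if_pos rfl] at h0
        have := ha ⟨0, hm⟩
        rw [Nat.cast_zero, zero_mul, add_zero] at h0
        exact (mul_eq_zero.1 h0).resolve_left (by omega)
      | succ m ih =>
        intro hm
        have h0 := hv ⟨m + 1, hm⟩
        rw [Fin.mk_succ_sub_one hm, ih, mul_zero, add_zero] at h0
        have := ha ⟨m + 1, hm⟩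
        exact (mul_eq_zero.1 h0).resolve_left (by omega)
    funext i
    exact h1 i i.2
  ext c c' hc hc' h := by
    have h1 := eq_of_eq_sub_one (v := fun i => c i - c' i) fun i => by linear_combination h i
    funext i
    have h2 := h1 i (Fin.last N)
    simp only [chainAdm] at hc hc'
    simp only [hc, hc'] at h2
    linarith
  step k hk u c _ := by
    have : Fin.last N ≠ k := by
      rintro rfl
      simp [hε _] at hk
    simp [chainAdm, idx, this]
  boundary k hk u c hc hA := by
    have hkl : k = Fin.last N := by
      by_contra hne
      simp [hε k, hne] at hk
    have hk0 : k + 1 = ⟨0, by omega⟩ := by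
      rw [hkl]
      exact Fin.last_add_one N
    rw [hk0] at hc
    simp only [chainAdm] at hA
    -- A multiple of $\partial_0f$ would force every $c_m\ge1$, contradicting $c_N=0$. Positivity
    -- propagates from index 0, using nonnegativity of the exponents and the two preceding values;
    -- index 1 is separate because its second predecessor is the last index, where $c=0$.
    have hpos : ∀ m (hm : m < N + 1), 1 ≤ c ⟨m, hm⟩ := by
      intro m
      induction m using Nat.strong_induction_on with
      | _ m ih =>
      rcases m with _ | _ | m
      · intro hm
        have h0 := hc ⟨0, hm⟩
        rw [Fin.mk_zero_sub_one, hε (Fin.last N), if_pos rfl, hA] at h0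
        simp only [Finsupp.add_apply, Finsupp.single_eq_same, Pi.one_apply, Nat.cast_add,
          Nat.cast_sub (ha ⟨0, hm⟩), Nat.cast_zero, zero_mul, add_zero, Nat.cast_one] at h0
        by_contra hneg
        have h1 : (a ⟨0, hm⟩ : ℤ) * c ⟨0, hm⟩ ≤ 0 :=
          mul_nonpos_of_nonneg_of_nonpos (Int.natCast_nonneg _) (by omega)
        set x : ℤ := (((Finsupp.single ((⟨0, hm⟩ : Fin (N + 1)) + 1) (ε ⟨0, hm⟩) :
          Fin (N + 1) →₀ ℕ) ⟨0, hm⟩ : ℕ) : ℤ) with hx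
        have h2 : 0 ≤ x := Int.natCast_nonneg _
        have h3 : (0 : ℤ) ≤ u ⟨0, hm⟩ := Int.natCast_nonneg _
        linarith
      · intro hm
        have h0 := hc ⟨0 + 1, hm⟩
        have hc0 := ih 0 (by omega) (by omega)
        have hε0 : ε ⟨0, by omega⟩ = 1 := by
          rw [hε, if_neg]
          intro h
          have := congrArg Fin.val h
          simp at this
          omega
        have hs : (⟨0, by omega⟩ + 1 : Fin (N + 1)) = ⟨0 + 1, hm⟩ := by
          rw [← Fin.mk_succ_sub_one hm, sub_add_cancel]
        rw [Fin.mk_succ_sub_one hm, Fin.mk_zero_sub_one, hA, hs, hε0] at h0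
        simp only [Finsupp.add_apply, Finsupp.single_eq_same, Pi.one_apply, Nat.cast_add,
          Nat.cast_one, one_mul, sub_zero] at h0
        set x : ℤ := (((Finsupp.single (⟨0, by omega⟩ : Fin (N + 1)) (a ⟨0, by omega⟩ - 1) :
          Fin (N + 1) →₀ ℕ) ⟨0 + 1, hm⟩ : ℕ) : ℤ) with hx
        have h2 : 0 ≤ x := Int.natCast_nonneg _
        have h3 : (0 : ℤ) ≤ u ⟨0 + 1, hm⟩ := Int.natCast_nonneg _
        have h4 : (1 : ℤ) ≤ a ⟨0 + 1, hm⟩ := by exact_mod_cast ha _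
        by_contra hneg
        nlinarith [mul_nonneg (sub_nonneg.2 hc0) (sub_nonneg.2 h4),
          mul_nonneg (sub_nonneg.2 h4) (show 0 ≤ -c ⟨0 + 1, hm⟩ by omega)]
      · intro hm
        have h0 := hc ⟨m + 1 + 1, hm⟩
        have hc0 := ih m (by omega) (by omega)
        have hc1 := ih (m + 1) (by omega) (by omega)
        have hε0 : ε ⟨m + 1, by omega⟩ = 1 := by
          rw [hε, if_neg]
          intro h
          have := congrArg Fin.val h
          simp at this
          omega
        rw [Fin.mk_succ_sub_one hm, Fin.mk_succ_sub_one (by omega), hε0] at h0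
        simp only [Pi.one_apply, Nat.cast_one, one_mul] at h0
        generalize (u + _ : Fin (N + 1) →₀ ℕ) ⟨m + 1 + 1, hm⟩ = x at h0
        have h3 : (0 : ℤ) ≤ x := Int.natCast_nonneg _
        have h4 : (1 : ℤ) ≤ a ⟨m + 1 + 1, hm⟩ := by exact_mod_cast ha _
        by_contra hneg
        nlinarith [mul_nonneg (sub_nonneg.2 hc1) (sub_nonneg.2 h4),
          mul_nonneg (sub_nonneg.2 h4) (show 0 ≤ -c ⟨m + 1 + 1, hm⟩ by omega)]
    have := hpos N (by omega)
    have h2 : c ⟨N, by omega⟩ = 0 := hA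
    omega

theorem chain_cycShift {Z : Finset (Fin (N + 1))} (hZ : Fin.last N ∉ Z) (S : Fin (N + 1) → ℤ) :
    CycShift a ε chainAdm Z S := by
  intro c hc u c' _
  simp [chainAdm, hc _ hZ]

end Chain

/-! ### Loops -/

section Loop

variable {N : ℕ} {a : Fin (N + 1) → ℕ}

/-- The admissible exponents for a loop. -/
def loopAdm (c : Fin (N + 1) → ℤ) : Prop := (∀ i, 0 ≤ c i) ∧ ∃ j, c j = 0

/-- For a loop `c` is determined up to an additive constant, which would change the value by a power
of $\prod t_k$; requiring minimum zero picks one representative. The point to check is that for a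
monomial divisible by $x_k^{a_k}$, lowering $c_k$ by one preserves minimum zero in both directions.
-/
theorem loop_cycAdm (ha : ∀ i, 1 ≤ a i)
    (hinj : ∀ v : Fin (N + 1) → ℤ, (∀ i, a i * v i + v (i - 1) = 0) → v = 0) :
    CycAdm a 1 loopAdm where
  inj v hv := hinj v fun i => by simpa using hv i
  ext c c' hc hc' h := by
    have h1 := eq_of_eq_sub_one (v := fun i => c i - c' i) fun i => by linear_combination h i
    obtain ⟨hc0, j, hj⟩ := hc
    obtain ⟨hc0', j', hj'⟩ := hc'
    funext i
    have h2 := h1 i j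
    have h3 := h1 i j'
    have h4 := hc0 j'
    have h5 := hc0' j
    change c i - c' i = c j - c' j at h2
    change c i - c' i = c j' - c' j' at h3
    omega
  step k _ u c hc := by
    have h0 := hc k
    simp only [Finsupp.add_apply, Finsupp.single_eq_same, Pi.one_apply, Nat.cast_add,
      Nat.cast_one, one_mul] at h0
    have hu : (0 : ℤ) ≤ u k := Int.natCast_nonneg _
    have hak : (1 : ℤ) ≤ a k := by exact_mod_cast ha _
    have hsub : ∀ j, (c - idx k) j = if j = k then c j - 1 else c j := by
      intro j
      simp only [Pi.sub_apply, idx]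
      split_ifs <;> simp
    constructor
    · rintro ⟨hc0, j, hj⟩
      -- If $c_k=0$, the equation at `k` reads $u_k+1=-(a_k-1)c_{k-1}-c_{k-2}\le0$.
      have hck : 1 ≤ c k := by
        by_contra hneg
        have h1 := hc0 k
        have h2 : c k = 0 := by omega
        rw [h2] at h0
        nlinarith [hc0 (k - 1), hc0 (k - 1 - 1), mul_nonneg (hc0 (k - 1)) (sub_nonneg.2 hak)]
      refine ⟨fun i => ?_, j, ?_⟩
      · rw [hsub]
        have := hc0 i
        split_ifs with h
        · subst h; omega
        · exact this
      · rw [hsub, if_neg]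
        · exact hj
        · rintro rfl
          omega
    · rintro ⟨hc0, j, hj⟩
      have hck := hc0 k
      rw [hsub, if_pos rfl] at hck
      have hc1 : ∀ i, 0 ≤ c i := by
        intro i
        have := hc0 i
        rw [hsub] at this
        split_ifs at this with h <;> omega
      refine ⟨hc1, ?_⟩
      -- If all $c_i\ge1$, the zero of the lowered exponents must be at `k`, so $c_k=1$; the
      -- equation at `k` then gives $u_k+1=-(a_k-1)(c_{k-1}-1)+1-c_{k-2}\le0$.
      by_contra hneg
      push Not at hneg
      have hpos : ∀ i, 1 ≤ c i := by
        intro i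
        have h1 := hc1 i
        have h2 := hneg i
        omega
      rw [hsub] at hj
      split_ifs at hj with h
      · subst h
        have hcj : c j = 1 := by omega
        rw [hcj] at h0
        nlinarith [hpos (j - 1), hpos (j - 1 - 1),
          mul_nonneg (sub_nonneg.2 (hpos (j - 1))) (sub_nonneg.2 hak)]
      · exact hneg j hj
  boundary k hk := by simp at hk

/-- Restricted to $S=1$: the complementary monomial then has weight zero, hence is 1, and its
exponents $c'$ are constant. Adding a nonnegative vector that vanishes somewhere does not change
whether the minimum is zero. -/
theorem loop_cycShift
    (hinj : ∀ v : Fin (N + 1) → ℤ, (∀ i, a i * v i + v (i - 1) = 0) → v = 0)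
    {w : Fin (N + 1) → ℤ} {D : ℤ} (hw0 : ∀ i, 0 < w i) (hw : ∀ k, a k * w k + w (k + 1) = D)
    {Z : Finset (Fin (N + 1))} {j : Fin (N + 1)} (hZ : j ∉ Z) : CycShift a 1 loopAdm Z 1 := by
  intro c hc u c' hu
  have h1 := hu.weight (w := w) (D := D) (by simpa using hw)
  have hu0 : ∀ i, u i = 0 := by
    have h2 : ∑ i, (u i : ℤ) * w i = 0 := by simpa using h1
    rw [Finset.sum_eq_zero_iff_of_nonneg fun i _ =>
      mul_nonneg (Int.natCast_nonneg _) (hw0 i).le] at h2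
    intro i
    have h3 := h2 i (Finset.mem_univ i)
    simpa [(hw0 i).ne'] using h3
  have h4 := hinj (fun i => c' i - c' (i - 1)) fun i => by
    have := hu i
    simp [hu0] at this
    linarith
  have h5 : ∀ i, c' i = c' j := fun i =>
    eq_of_eq_sub_one (fun i => by have := congrFun h4 i; simp at this; linarith) i j
  have hcj := hc j hZ
  constructor
  · rintro ⟨h6, i, hi⟩
    have h7 := h6 j
    simp only [Pi.add_apply, hcj, h5 i] at hi h7
    have h8 : c' j = 0 := by
      have : (0 : ℤ) ≤ c i := Int.natCast_nonneg _
      push_cast at h7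
      omega
    exact ⟨fun i => by rw [h5, h8], j, h8⟩
  · rintro ⟨h6, i, hi⟩
    rw [h5] at hi
    refine ⟨fun i => ?_, j, ?_⟩
    · rw [Pi.add_apply, h5, hi]
      simp
    · simp [hcj, hi]

end Loop

/-! ### Cyclic tridiagonal matrices indexed by residues -/

section CycMat

variable {N : ℕ} {R : Type*} [CommRing R]

/-- The residue of a natural number. -/
def cyc (N i : ℕ) : Fin (N + 1) := Fin.ofNat (N + 1) i

@[simp]
theorem cyc_val (i : Fin (N + 1)) : cyc N i = i := by
  ext
  simp [cyc]

theorem cyc_succ (i : ℕ) : cyc N (i + 1) = cyc N i + 1 := by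
  ext
  simp [cyc, Fin.val_add]

theorem val_cyc {i : ℕ} (h : i < N + 1) : (cyc N i : ℕ) = i := by
  simp [cyc, Nat.mod_eq_of_lt h]

theorem cyc_last : cyc N N = Fin.last N := by
  ext
  rw [val_cyc (by omega), Fin.val_last]

theorem eq_add_one_iff (i j : Fin (N + 1)) :
    i = j + 1 ↔ (i : ℕ) = j + 1 ∨ (j = Fin.last N ∧ i = 0) := by
  rcases eq_or_ne j (Fin.last N) with rfl | h
  · rw [Fin.last_add_one]
    have := i.2
    simp only [Fin.val_last, true_and]
    constructor
    · exact Or.inr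
    · rintro (h | h)
      · omega
      · exact h
  · rw [Fin.ext_iff, Fin.val_add_one_of_lt (Fin.lt_last_iff_ne_last.2 h)]
    simp [h]

/-- The matrix with `D j` at `(j, j)`, `B j` at `(j + 1, j)` and `C i` at `(i, i + 1)`. -/
def cycMat (D B C : Fin (N + 1) → R) : Matrix (Fin (N + 1)) (Fin (N + 1)) R :=
  Matrix.of fun i j => (if i = j then D j else 0) + (if i = j + 1 then B j else 0) +
    if j = i + 1 then C i else 0

theorem map_cycMat {S : Type*} [CommRing S] (φ : R →+* S) (D B C : Fin (N + 1) → R) :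
    φ.mapMatrix (cycMat D B C) =
      cycMat (fun i => φ (D i)) (fun i => φ (B i)) fun i => φ (C i) := by
  ext i j
  simp [cycMat, apply_ite φ]

theorem cycMat_eq_tri {D B C : Fin (N + 1) → R} (hB : B (Fin.last N) = 0)
    (hC : C (Fin.last N) = 0) :
    cycMat D B C = tri (fun i => D (cyc N i)) (fun i => B (cyc N i)) (fun i => C (cyc N i))
      (N + 1) := by
  ext i j
  simp only [cycMat, tri, Matrix.of_apply, cyc_val]
  congr 1
  · congr 1
    · simp only [Fin.ext_iff]
      split_ifs with h
      · rw [Fin.ext h]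
      · rfl
    · rw [if_congr (eq_add_one_iff i j) rfl rfl]
      split_ifs with h1 h2 h3
      · rfl
      · rw [(h1.resolve_left h2).1, hB]
      · exact absurd (Or.inl h3) h1
      · rfl
  · rw [if_congr (eq_add_one_iff j i) rfl rfl]
    split_ifs with h1 h2 h3
    · rfl
    · rw [(h1.resolve_left h2).1, hC]
    · exact absurd (Or.inl h3) h1
    · rfl

theorem det_cycMat_of_last_eq_zero {D B C : Fin (N + 1) → R} (hB : B (Fin.last N) = 0)
    (hC : C (Fin.last N) = 0) : (cycMat D B C).det =
      contin (fun i => D (cyc N i)) (fun i => -(B (cyc N i) * C (cyc N i))) (N + 1) := by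
  rw [cycMat_eq_tri hB hC, det_tri]

theorem cycMat_eq_cycTri {k : ℕ} (D B C : Fin (k + 1 + 1) → R) :
    cycMat D B C = cycTri (fun i => D (cyc (k + 1) i)) (fun i => B (cyc (k + 1) i))
      (fun i => C (cyc (k + 1) i)) (B (Fin.last _)) (C (Fin.last _)) k := by
  have key : ∀ (B : Fin (k + 1 + 1) → R) (i j : Fin (k + 1 + 1)),
      (if i = j + 1 then B j else 0) = (if (i : ℕ) = j + 1 then B j else 0) +
        if i = 0 ∧ j = Fin.last _ then B (Fin.last _) else 0 := by
    intro B i j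
    rw [if_congr (eq_add_one_iff i j) rfl rfl]
    by_cases h1 : (i : ℕ) = j + 1
    · have h2 : ¬ (i = 0 ∧ j = Fin.last _) := by
        rintro ⟨rfl, _⟩
        simp at h1
      simp [h1, h2]
    · by_cases h2 : j = Fin.last _ ∧ i = 0
      · simp [h2.1, h2.2]
      · have h3 : ¬ (i = 0 ∧ j = Fin.last _) := fun h => h2 ⟨h.2, h.1⟩
        rw [if_neg (not_or.2 ⟨h1, h2⟩), if_neg h1, if_neg h3, add_zero]
  ext i j
  simp only [cycMat, cycTri, tri, Matrix.of_apply, cyc_val]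
  rw [key B, key C]
  have hD : (if i = j then D j else 0) = if (i : ℕ) = j then D i else 0 := by
    simp only [Fin.ext_iff]
    split_ifs with h
    · rw [Fin.ext h]
    · rfl
  rw [hD]
  simp only [and_comm (a := j = 0)]
  abel

end CycMat

/-! ### The Casimir element of a cyclic polynomial -/

theorem isWeightedHomogeneous_det {σ ι : Type*} [Fintype ι] [DecidableEq ι] {w : σ → ℤ}
    {u : ι → ℤ} {D : ℤ} {M : Matrix ι ι (MvPolynomial σ ℂ)}
    (hM : ∀ i j, IsWeightedHomogeneous w (M i j) (D - u i - u j)) :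
    IsWeightedHomogeneous w M.det (∑ i, (D - 2 * u i)) := by
  rw [Matrix.det_apply]
  refine IsWeightedHomogeneous.sum _ _ _ fun τ _ => ?_
  have h1 : IsWeightedHomogeneous w (∏ i, M (τ i) i) (∑ i, (D - u (τ i) - u i)) :=
    IsWeightedHomogeneous.prod _ _ _ fun i _ => hM _ _
  have h2 : ∑ i, (D - u (τ i) - u i) = ∑ i, (D - 2 * u i) := by
    simp only [Finset.sum_sub_distrib, two_mul, Finset.sum_add_distrib, Equiv.sum_comp τ u]
    ring
  rw [h2] at h1
  rcases Int.units_eq_one_or (Equiv.Perm.sign τ) with hs | hs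
  · rw [hs, one_smul]; exact h1
  · rw [hs, Units.neg_smul, one_smul]
    exact h1.neg

section CycCasimir

/-- `(x^m - y^m) / (x - y)`. -/
def geomSum {R : Type*} [CommRing R] (m : ℕ) (x y : R) : R :=
  ∑ r ∈ Finset.range m, x ^ r * y ^ (m - 1 - r)

theorem geomSum_zero_right {R : Type*} [CommRing R] (m : ℕ) (x : R) :
    geomSum m x 0 = if m = 0 then 0 else x ^ (m - 1) := by
  rcases m with _ | m
  · simp [geomSum]
  · rw [geomSum, Finset.sum_range_succ, Finset.sum_eq_zero]
    · simp
    · intro r hr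
      have hr := Finset.mem_range.1 hr
      rw [zero_pow (by omega), mul_zero]

theorem isWeightedHomogeneous_geomSum {σ : Type*} {w : σ → ℤ} {m : ℕ} {x y : MvPolynomial σ ℂ}
    {d : ℤ} (hx : IsWeightedHomogeneous w x d) (hy : IsWeightedHomogeneous w y d) :
    IsWeightedHomogeneous w (geomSum m x y) ((m - 1) * d) := by
  refine IsWeightedHomogeneous.sum _ _ _ fun r hr => ?_
  have hr := Finset.mem_range.1 hr
  have h := (hx.pow r).mul (hy.pow (m - 1 - r))
  convert h using 1
  simp only [nsmul_eq_mul]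
  have : (m : ℤ) - 1 = r + (m - 1 - r : ℕ) := by omega
  rw [this]
  ring

variable {N : ℕ} (a ε : Fin (N + 1) → ℕ)

/-- Factors of the difference of the gradients of a cyclic polynomial. -/
def cycCasimirMat : Matrix (Fin (N + 1)) (Fin (N + 1))
    (MvPolynomial (Fin (N + 1) ⊕ Fin (N + 1)) ℂ) :=
  cycMat
    (fun j => C (a j : ℂ) * (geomSum (a j - 1) (X (Sum.inl j)) (X (Sum.inr j)) *
      X (Sum.inr (j + 1)) ^ ε j))
    (fun j => C (a j * ε j : ℂ) * X (Sum.inl j) ^ (a j - 1))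
    (fun i => C (ε i : ℂ) * geomSum (a i) (X (Sum.inl i)) (X (Sum.inr i)))

variable {a ε}

theorem cycCasimirMat_diff (hε : ∀ i, ε i ≤ 1) (j : Fin (N + 1)) :
    rename Sum.inl (pderiv j (cycPoly a ε)) - rename Sum.inr (pderiv j (cycPoly a ε)) =
      ∑ i, (X (Sum.inl i) - X (Sum.inr i)) * cycCasimirMat a ε i j := by
  have h3 : ∀ i, j = i + 1 ↔ i = j - 1 := fun i => by rw [eq_comm, eq_sub_iff_add_eq]
  have hsum : ∑ i, (X (Sum.inl i) - X (Sum.inr i)) * cycCasimirMat a ε i j =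
      (X (Sum.inl j) - X (Sum.inr j)) * (C (a j : ℂ) * (geomSum (a j - 1) (X (Sum.inl j))
        (X (Sum.inr j)) * X (Sum.inr (j + 1)) ^ ε j)) +
      (X (Sum.inl (j + 1)) - X (Sum.inr (j + 1))) *
        (C (a j * ε j : ℂ) * X (Sum.inl j) ^ (a j - 1)) +
      (X (Sum.inl (j - 1)) - X (Sum.inr (j - 1))) * (C (ε (j - 1) : ℂ) *
        geomSum (a (j - 1)) (X (Sum.inl (j - 1))) (X (Sum.inr (j - 1)))) := by
    simp only [cycCasimirMat, cycMat, Matrix.of_apply, mul_add, Finset.sum_add_distrib, mul_ite,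
      mul_zero, h3, Finset.sum_ite_eq', Finset.mem_univ, if_true]
  rw [hsum, pderiv_cycPoly hε]
  have g : ∀ (m : ℕ) (x y : MvPolynomial (Fin (N + 1) ⊕ Fin (N + 1)) ℂ),
      geomSum m x y * (x - y) = x ^ m - y ^ m := fun m x y =>
    (Commute.all x y).geom_sum₂_mul m
  have hpow : ∀ (e : ℕ), e ≤ 1 → ∀ (x y : MvPolynomial (Fin (N + 1) ⊕ Fin (N + 1)) ℂ),
      x ^ e - y ^ e = C (e : ℂ) * (x - y) := by
    intro e he x y
    interval_cases e <;> simp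
  have e1 := g (a j - 1) (X (Sum.inl j)) (X (Sum.inr j))
  have e2 := g (a (j - 1)) (X (Sum.inl (j - 1))) (X (Sum.inr (j - 1)))
  have e3 := hpow (ε j) (hε j) (X (Sum.inl (j + 1))) (X (Sum.inr (j + 1)))
  simp only [map_add, map_mul, map_pow, rename_C, rename_X] at *
  linear_combination (-C (a j : ℂ) * X (Sum.inr (j + 1)) ^ ε j) * e1 - C (ε (j - 1) : ℂ) * e2 +
    C (a j : ℂ) * X (Sum.inl j) ^ (a j - 1) * e3

variable {Adm : (Fin (N + 1) → ℤ) → Prop}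

theorem isWeightedHomogeneous_cycMat {σ : Type*} {v : σ → ℤ} {w : Fin (N + 1) → ℤ} {D : ℤ}
    {F B G : Fin (N + 1) → MvPolynomial σ ℂ}
    (hF : ∀ i, IsWeightedHomogeneous v (F i) (D - w i - w i))
    (hB : ∀ i, IsWeightedHomogeneous v (B i) (D - w (i + 1) - w i))
    (hG : ∀ i, IsWeightedHomogeneous v (G i) (D - w i - w (i + 1))) (i j : Fin (N + 1)) :
    IsWeightedHomogeneous v (cycMat F B G i j) (D - w i - w j) := by
  rw [cycMat, Matrix.of_apply]
  refine ((IsWeightedHomogeneous.add ?_ ?_).add ?_)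
  · split_ifs with h
    · subst h; exact hF _
    · exact isWeightedHomogeneous_zero _ _ _
  · split_ifs with h
    · subst h; exact hB _
    · exact isWeightedHomogeneous_zero _ _ _
  · split_ifs with h
    · subst h; exact hG _
    · exact isWeightedHomogeneous_zero _ _ _

theorem IsWeightedHomogeneous.C_mul' {σ : Type*} {v : σ → ℤ} {p : MvPolynomial σ ℂ} {d : ℤ}
    (h : IsWeightedHomogeneous v p d) (r : ℂ) : IsWeightedHomogeneous v (C r * p) d := by
  simpa using (isWeightedHomogeneous_C v r).mul h

/-- `M` has degree $D-w_i-w_j$ in place $(i,j)$ because all $m_k$ have weight `D`; the functional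
lives in the right degree by `CycCond.weight`. -/
theorem cyc_casimirData (hA : CycAdm a ε Adm) (ha : ∀ i, 1 ≤ a i) (hε : ∀ i, ε i ≤ 1)
    {w : Fin (N + 1) → ℤ} {D : ℤ} (hw0 : ∀ i, 0 < w i)
    (hw : ∀ k, a k * w k + ε k * w (k + 1) = D) :
    CasimirData (cycPoly a ε) (cycFunctional a ε Adm) (cycCasimirMat a ε) where
  kills p hp := hA.kills ha hε hp
  diff := cycCasimirMat_diff hε
  degree := by
    refine ⟨w, D, hw0, ?_, ?_⟩
    · have hX : ∀ s : Fin (N + 1) ⊕ Fin (N + 1), IsWeightedHomogeneous (Sum.elim w w)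
          (X s : MvPolynomial _ ℂ) (Sum.elim w w s) := fun s => isWeightedHomogeneous_X _ _ _
      have hoff : ∀ i, ε i ≠ 0 → ((a i : ℤ) - 1) * w i = D - w (i + 1) - w i := by
        intro i hi
        have h1 : ε i = 1 := by have := hε i; omega
        have h2 := hw i
        rw [h1] at h2
        push_cast at h2
        linarith
      refine isWeightedHomogeneous_cycMat (fun i => ?_) (fun i => ?_) (fun i => ?_)
      · refine IsWeightedHomogeneous.C_mul' ?_ _
        have h1 := (isWeightedHomogeneous_geomSum (m := a i - 1) (hX (Sum.inl i))
          (hX (Sum.inr i))).mul ((hX (Sum.inr (i + 1))).pow (ε i))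
        convert h1 using 1
        simp only [Sum.elim_inr, Sum.elim_inl, nsmul_eq_mul, Nat.cast_sub (ha i), Nat.cast_one]
        linear_combination -hw i
      · by_cases h : ε i = 0
        · rw [h]
          simpa using isWeightedHomogeneous_zero _ _ _
        · refine IsWeightedHomogeneous.C_mul' ?_ _
          have h1 := (hX (Sum.inl i)).pow (a i - 1)
          rw [← hoff i h]
          simpa [Nat.cast_sub (ha i)] using h1
      · by_cases h : ε i = 0
        · rw [h]
          simpa using isWeightedHomogeneous_zero _ _ _
        · refine IsWeightedHomogeneous.C_mul' ?_ _
          have h1 := isWeightedHomogeneous_geomSum (m := a i) (hX (Sum.inl i)) (hX (Sum.inr i))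
          have h2 := hoff i h
          simp only [Sum.elim_inl] at h1
          rw [h2] at h1
          convert h1 using 1
          ring
    · intro u hu
      rw [cycFunctional_monomial, one_mul] at hu
      obtain ⟨c, hc⟩ := exists_of_cycVal_ne_zero hu
      have h1 := hc.weight hw
      simp only [Pi.one_apply, one_mul, Finset.sum_const, Finset.card_univ, Fintype.card_fin] at h1
      rw [Finset.sum_sub_distrib, ← Finset.mul_sum, Finset.sum_const, Finset.card_univ,
        Fintype.card_fin]
      simp only [nsmul_eq_mul] at h1 ⊢
      linear_combination h1

/-- At $y=0$ a diagonal entry survives only where $\varepsilon_j=0$, that is, at the end of a chain.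
-/
theorem aeval_cycCasimirMat_det (ha : ∀ i, 1 ≤ a i) :
    (aeval (Sum.elim X 0) (cycCasimirMat a ε).det : MvPolynomial (Fin (N + 1)) ℂ) =
      (cycMat (fun j => C (a j : ℂ) * ((if a j - 1 = 0 then 0 else X j ^ (a j - 1 - 1)) *
        0 ^ ε j)) (fun j => C (a j * ε j : ℂ) * X j ^ (a j - 1))
        (fun i => C (ε i : ℂ) * X i ^ (a i - 1)) :
        Matrix _ _ (MvPolynomial (Fin (N + 1)) ℂ)).det := by
  rw [AlgHom.map_det, cycCasimirMat]
  congr 1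
  have h1 : ∀ (m : ℕ) (i : Fin (N + 1)), (aeval (Sum.elim X 0) (geomSum m (X (Sum.inl i))
      (X (Sum.inr i)) : MvPolynomial (Fin (N + 1) ⊕ Fin (N + 1)) ℂ) :
        MvPolynomial (Fin (N + 1)) ℂ) = if m = 0 then 0 else X i ^ (m - 1) := by
    intro m i
    rw [← geomSum_zero_right]
    simp [geomSum]
  refine (map_cycMat (aeval (Sum.elim X 0) : MvPolynomial (Fin (N + 1) ⊕ Fin (N + 1)) ℂ →ₐ[ℂ]
    MvPolynomial (Fin (N + 1)) ℂ).toRingHom _ _ _).trans ?_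
  congr 1
  · funext j
    change aeval (Sum.elim X 0) (C (a j : ℂ) * (geomSum (a j - 1) (X (Sum.inl j))
      (X (Sum.inr j)) * X (Sum.inr (j + 1)) ^ ε j)) = _
    simp only [map_mul, map_pow, h1, aeval_X, aeval_C, algebraMap_eq, Sum.elim_inr, Pi.zero_apply]
  · funext j
    simp
  · funext j
    have := ha j
    change aeval (Sum.elim X 0) (C (ε j : ℂ) * geomSum (a j) (X (Sum.inl j))
      (X (Sum.inr j))) = _
    simp only [map_mul, h1, aeval_C, algebraMap_eq, if_neg (show a j ≠ 0 by omega)]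

theorem pderiv_pderiv_cycPoly (hε : ∀ i, ε i ≤ 1) (i j : Fin (N + 1)) :
    pderiv i (pderiv j (cycPoly a ε)) = cycMat
      (fun j => C (a j * (a j - 1 : ℕ) : ℂ) * (X j ^ (a j - 1 - 1) * X (j + 1) ^ ε j))
      (fun j => C (a j * ε j : ℂ) * X j ^ (a j - 1))
      (fun j => C (a j * ε j : ℂ) * X j ^ (a j - 1)) i j := by
  have e1 : ∀ (k : Fin (N + 1)) (m : ℕ), (pderiv i (X k ^ m) : MvPolynomial (Fin (N + 1)) ℂ) =
      if i = k then C (m : ℂ) * X k ^ (m - 1) else 0 := by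
    intro k m
    rw [pderiv_pow, pderiv_X]
    split_ifs with h
    · subst h; simp
    · simp [Ne.symm h]
  have e2 : (C (ε j : ℂ) * X (j + 1) ^ (ε j - 1) : MvPolynomial (Fin (N + 1)) ℂ) =
      C (ε j : ℂ) := by
    have := hε j
    interval_cases ε j <;> simp
  have h3 : (j = i + 1) ↔ i = j - 1 := by rw [eq_comm, eq_sub_iff_add_eq]
  rw [pderiv_cycPoly hε, cycMat, Matrix.of_apply, if_congr h3 rfl rfl, map_add, pderiv_C_mul,
    pderiv_C_mul, Derivation.leibniz, e1, e1, e1, e2, smul_eq_mul, smul_eq_mul]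
  have e4 : (if i = j - 1 then C (a i * ε i : ℂ) * X i ^ (a i - 1) else 0 :
      MvPolynomial (Fin (N + 1)) ℂ) = if i = j - 1 then
        C (a (j - 1) * ε (j - 1) : ℂ) * X (j - 1) ^ (a (j - 1) - 1) else 0 := by
    split_ifs with h
    · rw [h]
    · rfl
  rw [e4]
  simp only [C_mul]
  split_ifs <;> ring

theorem hess_cycPoly (hε : ∀ i, ε i ≤ 1) : hess (cycPoly a ε) = (cycMat
      (fun j => C (a j * (a j - 1 : ℕ) : ℂ) * (X j ^ (a j - 1 - 1) * X (j + 1) ^ ε j))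
      (fun j => C (a j * ε j : ℂ) * X j ^ (a j - 1))
      (fun j => C (a j * ε j : ℂ) * X j ^ (a j - 1)) :
        Matrix _ _ (MvPolynomial (Fin (N + 1)) ℂ)).det := by
  rw [hess]
  congr 1
  funext i j
  exact pderiv_pderiv_cycPoly hε i j

theorem contin_mem_cycRep_of_squares {Z : Finset (Fin (N + 1))} (ha : ∀ i, 1 ≤ a i) {o k : ℕ}
    {D d : ℕ → MvPolynomial (Fin (N + 1)) ℂ} {κ δ : ℕ → ℂ}
    (hi : ∀ i < k, cyc N (o + i) + 1 ≠ cyc N (o + i) ∨ ε (cyc N (o + i)) = 0)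
    (hZ : ∀ i, i + 1 < k → cyc N (o + i) ∈ Z ∧ ε (cyc N (o + i)) = 1)
    (hD : ∀ i < k, X (cyc N (o + i)) ^ 2 * D i = C (κ i) *
      (X (cyc N (o + i)) ^ a (cyc N (o + i)) * X (cyc N (o + i) + 1) ^ ε (cyc N (o + i))))
    (hd : ∀ i, i + 1 < k → ∃ r : ℂ, d i = C r * (X (cyc N (o + i)) ^ (a (cyc N (o + i)) - 1) *
      X (cyc N (o + i)) ^ (a (cyc N (o + i)) - 1)) ∧ r * cycRatio a (cyc N (o + i)) = δ i) :
    (contin D d k, contin κ δ k) ∈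
      cycRep a ε Z (∑ i ∈ Finset.range k, idx (cyc N (o + i))) := by
  refine contin_mem_cycRep (fun i hk => diag_mem_cycRep (hi i hk) (hD i hk) Z) fun i hk => ?_
  obtain ⟨r, h1, h2⟩ := hd i hk
  rw [h1, ← h2, ← add_assoc, cyc_succ]
  exact sq_mem_cycRep ha (hZ i hk).2 (hZ i hk).1 r

theorem sum_idx (N : ℕ) : ∑ i ∈ Finset.range (N + 1), idx (cyc N i) = 1 := by
  rw [Finset.sum_range]
  simp only [cyc_val]
  funext j
  simp [idx]

/-- The functional vanishes on all monomial multiples of $zA-yB$, so nondegeneracy applies. -/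
theorem CycAdm.jacMk_eq (hA : CycAdm a ε Adm) (ha : ∀ i, 1 ≤ a i) (hε : ∀ i, ε i ≤ 1)
    {w : Fin (N + 1) → ℤ} {D : ℤ} (hw0 : ∀ i, 0 < w i)
    (hw : ∀ k, a k * w k + ε k * w (k + 1) = D)
    (hc : cycFunctional a ε Adm (aeval (Sum.elim X 0) (cycCasimirMat a ε).det) ≠ 0)
    {S : Fin (N + 1) → ℤ} {A B : MvPolynomial (Fin (N + 1)) ℂ} {y z : ℂ}
    (h1 : (A, y) ∈ cycVals a ε Adm S) (h2 : (B, z) ∈ cycVals a ε Adm S) :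
    z • jacMk (cycPoly a ε) A = y • jacMk (cycPoly a ε) B := by
  have h := (cyc_casimirData hA ha hε hw0 hw).jacMk_eq_zero hc (p := z • A - y • B) fun u => by
    rw [sub_mul, map_sub, smul_mul_assoc, smul_mul_assoc, map_smul, map_smul, h1 u, h2 u]
    simp only [smul_eq_mul]
    ring
  rwa [map_sub, map_smul, map_smul, sub_eq_zero] at h

theorem CycAdm.apply_of_mem (hA : CycAdm a ε Adm) (h0 : Adm 0)
    {A : MvPolynomial (Fin (N + 1)) ℂ} {z : ℂ} (h1 : (A, z) ∈ cycVals a ε Adm 1) :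
    cycFunctional a ε Adm A = z := by
  have h2 := h1 0
  have h3 : CycCond a ε (1 - 1) 0 0 := by
    intro i
    simp
  rw [hA.cycVal_eq h0 h3] at h2
  simpa using h2

end CycCasimir

/-! ### Values of the residue functional for chains -/

section ChainValues

variable {N : ℕ} {a ε : Fin (N + 1) → ℕ}

theorem IsChainExp.le_one (hε : IsChainExp ε) (i : Fin (N + 1)) : ε i ≤ 1 := by
  rw [hε]
  split_ifs <;> simp

theorem IsChainExp.last (hε : IsChainExp ε) : ε (Fin.last N) = 0 := by
  rw [hε, if_pos rfl]

theorem cyc_ne_last {i : ℕ} (h : i < N) : cyc N i ≠ Fin.last N := by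
  intro h1
  have := congrArg Fin.val h1
  rw [val_cyc (by omega), Fin.val_last] at this
  omega

theorem IsChainExp.cyc_eq_one (hε : IsChainExp ε) {i : ℕ} (h : i < N) : ε (cyc N i) = 1 := by
  rw [hε, if_neg (cyc_ne_last h)]

theorem IsChainExp.add_one_ne_or (hε : IsChainExp ε) (i : Fin (N + 1)) : i + 1 ≠ i ∨ ε i = 0 := by
  by_cases h : i = Fin.last N
  · right
    rw [h, hε.last]
  · left
    intro h1
    have := congrArg Fin.val h1
    rw [Fin.val_add_one_of_lt (Fin.lt_last_iff_ne_last.2 h)] at this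
    omega

theorem chain_cycRep_le (ha : ∀ i, 1 ≤ a i) (hε : IsChainExp ε) (S : Fin (N + 1) → ℤ) :
    cycRep a ε {Fin.last N}ᶜ S ≤ cycVals a ε chainAdm S :=
  (chain_cycAdm ha hε).cycRep_le ha (chain_cycShift (by simp) S)

/-- Continuants of consecutive diagonal entries of a chain. -/
theorem chain_contin_mem (ha : ∀ i, 1 ≤ a i) (hε : IsChainExp ε) {o k : ℕ} (hk : o + k ≤ N + 1)
    {D d : ℕ → MvPolynomial (Fin (N + 1)) ℂ} {κ δ : ℕ → ℂ}
    (hD : ∀ i < k, X (cyc N (o + i)) ^ 2 * D i = C (κ i) *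
      (X (cyc N (o + i)) ^ a (cyc N (o + i)) * X (cyc N (o + i) + 1) ^ ε (cyc N (o + i))))
    (hd : ∀ i, i + 1 < k → ∃ r : ℂ, d i = C r * (X (cyc N (o + i)) ^ (a (cyc N (o + i)) - 1) *
      X (cyc N (o + i)) ^ (a (cyc N (o + i)) - 1)) ∧ r * cycRatio a (cyc N (o + i)) = δ i) :
    (contin D d k, contin κ δ k) ∈
      cycRep a ε {Fin.last N}ᶜ (∑ i ∈ Finset.range k, idx (cyc N (o + i))) := by
  refine contin_mem_cycRep_of_squares ha (fun i _ => hε.add_one_ne_or _) (fun i hi => ⟨?_, ?_⟩) hD hd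
  · simpa using cyc_ne_last (N := N) (i := o + i) (by omega)
  · exact hε.cyc_eq_one (by omega)

theorem cycRatio_cyc (i : ℕ) : cycRatio a (cyc N i) = -(a (cyc N (i + 1)) : ℂ) := by
  rw [cycRatio, cyc_succ]

theorem prod_range_cyc {M : Type*} [CommMonoid M] (F : Fin (N + 1) → M) :
    ∏ i ∈ Finset.range (N + 1), F (cyc N i) = ∏ i, F i := by
  rw [Finset.prod_range]
  simp

theorem X_sq_mul_X_pow {n : ℕ} (i : Fin n) (m : ℕ) (r : ℂ) (h : m ≤ 1 → r = 0)
    (q : MvPolynomial (Fin n) ℂ) :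
    X i ^ 2 * (C r * (X i ^ (m - 1 - 1) * q)) = C r * (X i ^ m * q) := by
  by_cases hm : m ≤ 1
  · rw [h hm]
    simp
  · obtain ⟨m, rfl⟩ : ∃ k, m = k + 2 := ⟨m - 2, by omega⟩
    rw [show m + 2 - 1 - 1 = m by omega, pow_add]
    ring

theorem chain_apply_casimir (ha : ∀ i, 1 ≤ a i) (hε : IsChainExp ε) (hl : 2 ≤ a (Fin.last N)) :
    cycFunctional a ε chainAdm (aeval (Sum.elim X 0) (cycCasimirMat a ε).det) =
      ∏ i, (a i : ℂ) := by
  rw [aeval_cycCasimirMat_det ha, det_cycMat_of_last_eq_zero (by simp [hε.last])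
    (by simp [hε.last])]
  -- The diagonal numbers are $0=a_i+(-a_i)$ for $i<N$ and $a_N+0$ at the end; the dimer numbers
  -- $-a_it_i=a_ia_{i+1}$ then have the factored form.
  set v : ℕ → ℂ := fun i => if i = N then 0 else -(a (cyc N i) : ℂ) with hv
  have h1 := chain_contin_mem ha hε (o := 0) (k := N + 1) (by omega)
    (D := fun i => C (a (cyc N i) : ℂ) * ((if a (cyc N i) - 1 = 0 then 0 else
      X (cyc N i) ^ (a (cyc N i) - 1 - 1)) * 0 ^ ε (cyc N i)))
    (d := fun i => -(C (a (cyc N i) * ε (cyc N i) : ℂ) * X (cyc N i) ^ (a (cyc N i) - 1) *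
      (C (ε (cyc N i) : ℂ) * X (cyc N i) ^ (a (cyc N i) - 1))))
    (κ := fun i => a (cyc N i) + v i) (δ := fun i => -(a (cyc N (i + 1)) * v i))
    (by
      intro i hi
      simp only [zero_add, hv]
      by_cases h : i = N
      · subst h
        rw [if_pos rfl, cyc_last, hε.last, add_zero, if_neg (by omega), pow_zero, pow_zero]
        exact X_sq_mul_X_pow _ _ _ (by omega) _
      · rw [if_neg h, hε.cyc_eq_one (by omega)]
        simp)
    (by
      intro i hi
      refine ⟨-(a (cyc N i) : ℂ), ?_, ?_⟩
      · simp only [zero_add]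
        rw [hε.cyc_eq_one (by omega)]
        simp
        ring
      · simp only [zero_add, hv]
        rw [if_neg (by omega), cycRatio_cyc]
        ring)
  simp only [zero_add] at h1
  rw [sum_idx] at h1
  rw [(chain_cycAdm ha hε).apply_of_mem rfl (chain_cycRep_le ha hε _ h1),
    contin_succ_of_factor (α := fun i => (a (cyc N i) : ℂ)) (v := v) N (fun i _ => rfl)
      (fun i _ => rfl), show v N = 0 from if_pos rfl, zero_mul, zero_add,
    prod_range_cyc fun i => (a i : ℂ)]

/-- The value of the Hessian determinant of a chain with the given exponents. -/
def hessContin (b : ℕ → ℕ) (k : ℕ) : ℂ :=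
  contin (fun i => (b i * (b i - 1 : ℕ) : ℂ)) (fun i => (b i ^ 2 * b (i + 1) : ℂ)) k

/-- The product of two symmetric off-diagonal entries contributes $-a_i^2x_i^{2(a_i-1)}$, whose
number is $-a_i^2t_i=a_i^2a_{i+1}$. The offset `o` serves both the moved block and the fixed tail.
-/
theorem chain_hess_contin_mem (ha : ∀ i, 1 ≤ a i) (hε : IsChainExp ε) {o k : ℕ}
    (hk : o + k ≤ N + 1) :
    (contin (fun i => C (a (cyc N (o + i)) * (a (cyc N (o + i)) - 1 : ℕ) : ℂ) *
        (X (cyc N (o + i)) ^ (a (cyc N (o + i)) - 1 - 1) *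
          X (cyc N (o + i) + 1) ^ ε (cyc N (o + i))))
      (fun i => -(C (a (cyc N (o + i)) * ε (cyc N (o + i)) : ℂ) *
          X (cyc N (o + i)) ^ (a (cyc N (o + i)) - 1) *
        (C (a (cyc N (o + i)) * ε (cyc N (o + i)) : ℂ) *
          X (cyc N (o + i)) ^ (a (cyc N (o + i)) - 1)))) k,
      hessContin (fun i => a (cyc N (o + i))) k) ∈
      cycRep a ε {Fin.last N}ᶜ (∑ i ∈ Finset.range k, idx (cyc N (o + i))) := by
  refine chain_contin_mem ha hε hk (fun i hi => ?_) (fun i hi => ⟨-(a (cyc N (o + i)) : ℂ) ^ 2,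
    ?_, ?_⟩)
  · refine X_sq_mul_X_pow _ _ _ (fun h => ?_) _
    rw [show a (cyc N (o + i)) - 1 = 0 by omega]
    simp
  · rw [hε.cyc_eq_one (by omega)]
    simp
    ring
  · rw [cycRatio_cyc, add_assoc]
    ring

theorem chain_hess_mem (ha : ∀ i, 1 ≤ a i) (hε : IsChainExp ε) :
    (hess (cycPoly a ε), hessContin (fun i => a (cyc N i)) (N + 1)) ∈ cycVals a ε chainAdm 1 := by
  have h := chain_hess_contin_mem ha hε (o := 0) (k := N + 1) (by omega)
  simp only [zero_add] at h
  rw [sum_idx] at h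
  have h1 := chain_cycRep_le ha hε _ h
  rwa [hess_cycPoly hε.le_one, det_cycMat_of_last_eq_zero (by simp [hε.last])
    (by simp [hε.last])]

variable {w : Fin (N + 1) → ℤ} {D : ℤ}

/-- The Milnor number of a chain. -/
theorem chain_milnor (ha : ∀ i, 1 ≤ a i) (hε : IsChainExp ε) (hl : 2 ≤ a (Fin.last N))
    (hw0 : ∀ i, 0 < w i) (hw : ∀ k, a k * w k + ε k * w (k + 1) = D)
    (hfin : Module.Finite ℂ (Jac (cycPoly a ε))) :
    hessContin (fun i => a (cyc N i)) (N + 1) = (∏ i, (a i : ℂ)) * milnorNumber (cycPoly a ε) := by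
  have hA := chain_cycAdm ha hε
  -- The functional is evaluated on the Hessian twice, by the Casimir trace and by the continuant.
  rw [← chain_apply_casimir ha hε hl,
    ← (cyc_casimirData hA ha hε.le_one hw0 hw).hess_eq hfin,
    hA.apply_of_mem rfl (chain_hess_mem ha hε)]

theorem chain_jacMk_eq (ha : ∀ i, 1 ≤ a i) (hε : IsChainExp ε) (hl : 2 ≤ a (Fin.last N))
    (hw0 : ∀ i, 0 < w i) (hw : ∀ k, a k * w k + ε k * w (k + 1) = D)
    {S : Fin (N + 1) → ℤ} {A B : MvPolynomial (Fin (N + 1)) ℂ} {y z : ℂ}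
    (h1 : (A, y) ∈ cycRep a ε {Fin.last N}ᶜ S) (h2 : (B, z) ∈ cycRep a ε {Fin.last N}ᶜ S) :
    z • jacMk (cycPoly a ε) A = y • jacMk (cycPoly a ε) B := by
  refine (chain_cycAdm ha hε).jacMk_eq ha hε.le_one hw0 hw ?_ (chain_cycRep_le ha hε _ h1)
    (chain_cycRep_le ha hε _ h2)
  rw [chain_apply_casimir ha hε hl, Finset.prod_ne_zero_iff]
  intro i _
  rw [Nat.cast_ne_zero]
  have := ha i
  omega

end ChainValues

/-! ### Values of the residue functional for loops -/

section LoopValues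

variable {k : ℕ} {a : Fin (k + 1 + 1) → ℕ} {w : Fin (k + 1 + 1) → ℤ} {D : ℤ}

theorem add_one_ne_self (i : Fin (k + 1 + 1)) : i + 1 ≠ i := by
  intro h
  simp at h

/-- Cyclic continuants of the diagonal entries of a loop. -/
theorem loop_contin_mem (ha : ∀ i, 1 ≤ a i)
    (hinj : ∀ v : Fin (k + 1 + 1) → ℤ, (∀ i, a i * v i + v (i - 1) = 0) → v = 0)
    (hw0 : ∀ i, 0 < w i) (hw : ∀ k, a k * w k + w (k + 1) = D)
    {F d : ℕ → MvPolynomial (Fin (k + 1 + 1)) ℂ} {W : MvPolynomial (Fin (k + 1 + 1)) ℂ}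
    {α v : ℕ → ℂ}
    (hF : ∀ i < k + 2, X (cyc (k + 1) i) ^ 2 * F i = C (α i + v i) *
      (X (cyc (k + 1) i) ^ a (cyc (k + 1) i) * X (cyc (k + 1) i + 1)))
    (hd : ∀ i < k + 1, ∃ r : ℂ, d i = C r * (X (cyc (k + 1) i) ^ (a (cyc (k + 1) i) - 1) *
      X (cyc (k + 1) i) ^ (a (cyc (k + 1) i) - 1)) ∧
        r * cycRatio a (cyc (k + 1) i) = -(α (i + 1) * v i))
    (hW : ∃ r : ℂ, W = C r * (X (Fin.last _) ^ (a (Fin.last _) - 1) *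
      X (Fin.last _) ^ (a (Fin.last _) - 1)) ∧ r * cycRatio a (Fin.last _) = α 0 * v (k + 1)) :
    (contin F d (k + 2) - W * contin (fun i => F (i + 1)) (fun i => d (i + 1)) k,
      ∏ i ∈ Finset.range (k + 2), α i + ∏ i ∈ Finset.range (k + 2), v i) ∈
        cycVals a 1 loopAdm 1 := by
  have hA := loop_cycAdm ha hinj
  -- The open continuant never uses the ratio at the last index and the wrap-around term never uses
  -- the one at 0. For a loop the exponents `c` must vanish somewhere, so the two parts need
  -- different support sets.
  have h1 := contin_mem_cycRep_of_squares (ε := 1) (Z := {Fin.last _}ᶜ) ha (o := 0) (k := k + 2)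
    (D := F) (d := d) (κ := fun i => α i + v i) (δ := fun i => -(α (i + 1) * v i))
    (fun i _ => Or.inl (add_one_ne_self _))
    (fun i hi => ⟨by simpa using cyc_ne_last (N := k + 1) (i := i) (by omega), rfl⟩)
    (by
      intro i hi
      simpa using hF i hi)
    (by
      intro i hi
      simpa using hd i (by omega))
  have h2 := contin_mem_cycRep_of_squares (ε := 1) (Z := {0}ᶜ) ha (o := 1) (k := k)
    (D := fun i => F (i + 1)) (d := fun i => d (i + 1)) (κ := fun i => α (i + 1) + v (i + 1))
    (δ := fun i => -(α (i + 1 + 1) * v (i + 1)))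
    (fun i _ => Or.inl (add_one_ne_self _))
    (fun i hi => ⟨by
      rw [Finset.mem_compl, Finset.mem_singleton]
      intro h
      have := congrArg Fin.val h
      rw [val_cyc (by omega), Fin.val_zero] at this
      omega, rfl⟩)
    (by
      intro i hi
      simpa [add_comm 1 i] using hF (i + 1) (by omega))
    (by
      intro i hi
      simpa [add_comm 1 i] using hd (i + 1) (by omega))
  obtain ⟨r, hr1, hr2⟩ := hW
  have h3 := SetLike.GradedMul.mul_mem (A := cycRep a 1 {0}ᶜ)
    (sq_mem_cycRep (ε := 1) ha (i := Fin.last _) rfl (Z := {0}ᶜ) (by simp [Fin.ext_iff]) r) h2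
  have hs : idx (Fin.last (k + 1)) + idx (Fin.last (k + 1) + 1) +
      ∑ i ∈ Finset.range k, idx (cyc (k + 1) (1 + i)) = 1 := by
    rw [← sum_idx (k + 1), Finset.sum_range_succ', Finset.sum_range_succ, cyc_last,
      Fin.last_add_one, show cyc (k + 1) 0 = 0 from rfl]
    simp only [add_comm 1]
    abel
  simp only [zero_add] at h1
  rw [sum_idx] at h1
  rw [hs, Prod.mk_mul_mk, ← hr1, hr2] at h3
  have h4 := sub_mem (hA.cycRep_le ha (loop_cycShift hinj hw0 hw (j := Fin.last _) (by simp)) h1)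
    (hA.cycRep_le ha (loop_cycShift hinj hw0 hw (j := 0) (by simp)) h3)
  rw [Prod.mk_sub_mk] at h4
  rwa [contin_cyclic_of_factor k (fun i _ => rfl) (fun i _ => rfl)] at h4

theorem loop_prod_mem (ha : ∀ i, 1 ≤ a i)
    (hinj : ∀ v : Fin (k + 1 + 1) → ℤ, (∀ i, a i * v i + v (i - 1) = 0) → v = 0)
    (hw0 : ∀ i, 0 < w i) (hw : ∀ k, a k * w k + w (k + 1) = D) (r : ℂ) :
    (C r * ∏ i, X i ^ (a i - 1), r) ∈ cycVals a 1 loopAdm 1 :=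
  (loop_cycAdm ha hinj).cycRep_le ha (loop_cycShift hinj hw0 hw (j := 0) (by simp))
    (prod_mem_cycRep ha (fun _ => rfl) ∅ r)

/-- With zero diagonal take $\alpha_i=a_i$, $v_i=-a_i$: the cyclic continuant gives $\prod
a_i+\prod(-a_i)$ and the two winding terms give $(-1)^{n-1}(\prod a_i+1)$, where $n=k+2$. -/
theorem loop_apply_casimir (ha : ∀ i, 1 ≤ a i)
    (hinj : ∀ v : Fin (k + 1 + 1) → ℤ, (∀ i, a i * v i + v (i - 1) = 0) → v = 0)
    (hw0 : ∀ i, 0 < w i) (hw : ∀ k, a k * w k + w (k + 1) = D) :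
    cycFunctional a 1 loopAdm (aeval (Sum.elim X 0) (cycCasimirMat a 1).det) =
      ∏ i, (a i : ℂ) - (-1) ^ (k + 2) := by
  rw [aeval_cycCasimirMat_det ha, cycMat_eq_cycTri, det_cycTri]
  have h1 := loop_contin_mem ha hinj hw0 hw (F := 0)
    (d := fun i => -(C (a (cyc (k + 1) i) : ℂ) * X (cyc (k + 1) i) ^ (a (cyc (k + 1) i) - 1) *
      X (cyc (k + 1) i) ^ (a (cyc (k + 1) i) - 1)))
    (W := C (a (Fin.last _) : ℂ) * X (Fin.last _) ^ (a (Fin.last _) - 1) *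
      X (Fin.last _) ^ (a (Fin.last _) - 1))
    (α := fun i => a (cyc (k + 1) i)) (v := fun i => -(a (cyc (k + 1) i) : ℂ))
    (fun i _ => by simp)
    (fun i _ => ⟨-(a (cyc (k + 1) i) : ℂ), by simp; ring, by rw [cycRatio_cyc]; ring⟩)
    ⟨a (Fin.last _), by ring, by
      rw [cycRatio, Fin.last_add_one, cyc_last, show cyc (k + 1) 0 = 0 from rfl]; ring⟩
  have h2 := loop_prod_mem ha hinj hw0 hw ((-1) ^ (k + 1) * (∏ i, (a i : ℂ) + 1))
  have h12 := add_mem h1 h2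
  rw [Prod.mk_add_mk] at h12
  have h3 := (loop_cycAdm ha hinj).apply_of_mem ⟨fun _ => le_rfl, 0, rfl⟩ h12
  have e1 : C (a (Fin.last (k + 1)) : ℂ) * X (Fin.last (k + 1)) ^ (a (Fin.last _) - 1) *
      ∏ i ∈ Finset.range (k + 1), (C (a (cyc (k + 1) i) : ℂ) *
        X (cyc (k + 1) i) ^ (a (cyc (k + 1) i) - 1)) =
      C (∏ i, (a i : ℂ)) * ∏ i, X i ^ (a i - 1) := by
    rw [map_prod, ← Finset.prod_mul_distrib,
      ← prod_range_cyc (fun i => (C (a i : ℂ) * X i ^ (a i - 1) : MvPolynomial _ ℂ)),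
      Finset.prod_range_succ _ (k + 1), cyc_last, mul_comm]
  have e2 : X (Fin.last (k + 1)) ^ (a (Fin.last _) - 1) *
      ∏ i ∈ Finset.range (k + 1), (X (cyc (k + 1) i) ^ (a (cyc (k + 1) i) - 1) :
        MvPolynomial _ ℂ) = ∏ i, X i ^ (a i - 1) := by
    rw [← prod_range_cyc (fun i => (X i ^ (a i - 1) : MvPolynomial _ ℂ)),
      Finset.prod_range_succ _ (k + 1), cyc_last, mul_comm]
  simp only [Pi.one_apply, Nat.cast_one, mul_one, C_1, one_mul, pow_one, mul_zero] at *
  rw [e1, e2]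
  refine Eq.trans (congrArg _ ?_) (h3.trans ?_)
  · simp only [Pi.zero_def, C_mul, C_add, C_1, map_pow, C_neg]
    ring
  · rw [prod_range_cyc (fun i => (a i : ℂ)), prod_range_cyc (fun i => -(a i : ℂ)),
      Finset.prod_neg]
    simp only [Finset.card_univ, Fintype.card_fin]
    ring

/-- In the degree of the functional, a product with a nonconstant monomial has too large a degree,
so only the pairing with 1 matters. -/
theorem loop_mem_of_homogeneous (ha : ∀ i, 1 ≤ a i)
    (hinj : ∀ v : Fin (k + 1 + 1) → ℤ, (∀ i, a i * v i + v (i - 1) = 0) → v = 0)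
    (hw0 : ∀ i, 0 < w i) (hw : ∀ k, a k * w k + w (k + 1) = D)
    {A : MvPolynomial (Fin (k + 1 + 1)) ℂ}
    (hAw : IsWeightedHomogeneous w A (∑ i, (D - 2 * w i))) :
    (A, cycFunctional a 1 loopAdm A) ∈ cycVals a 1 loopAdm 1 := by
  have hA := loop_cycAdm ha hinj
  have hw' : ∀ i, a i * w i + (1 : Fin (k + 1 + 1) → ℕ) i * w (i + 1) = D := by simpa using hw
  intro u
  by_cases hu : u = 0
  · subst hu
    have h3 : CycCond a 1 (1 - 1) 0 0 := by
      intro i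
      simp
    rw [hA.cycVal_eq ⟨fun _ => le_rfl, 0, rfl⟩ h3]
    simp
  · have hpos : 0 < ∑ i, (u i : ℤ) * w i := by
      obtain ⟨i, hi⟩ := Finsupp.ne_iff.1 hu
      refine Finset.sum_pos' (fun i _ => mul_nonneg (Int.natCast_nonneg _) (hw0 i).le)
        ⟨i, Finset.mem_univ _, mul_pos ?_ (hw0 i)⟩
      have : u i ≠ 0 := hi
      omega
    have h1 : cycVal a 1 loopAdm (1 - 1) u = 0 := by
      by_contra hne
      obtain ⟨c, hc⟩ := exists_of_cycVal_ne_zero hne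
      have := hc.weight hw'
      simp at this
      omega
    rw [h1, mul_zero, ← A.support_sum_monomial_coeff, Finset.sum_mul, map_sum]
    refine Finset.sum_eq_zero fun p hp => ?_
    rw [monomial_mul, cycFunctional_monomial]
    have hp := hAw (mem_support_iff.1 hp)
    rw [Finsupp.weight_apply, Finsupp.sum_fintype _ _ (by simp)] at hp
    have h2 : cycVal a 1 loopAdm 1 (p + u) = 0 := by
      by_contra hne
      obtain ⟨c, hc⟩ := exists_of_cycVal_ne_zero hne
      have h3 := hc.weight hw'
      simp only [Finsupp.add_apply, Nat.cast_add, add_mul, Finset.sum_add_distrib, Pi.one_apply,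
        one_mul, Finset.sum_const, Finset.card_univ, Fintype.card_fin, nsmul_eq_mul] at h3
      simp only [nsmul_eq_mul, Finset.sum_sub_distrib, ← Finset.mul_sum, Finset.sum_const,
        Finset.card_univ, Fintype.card_fin] at hp
      rw [hp] at h3
      push_cast at h3 hp
      linarith
    rw [h2, mul_zero]

/-- The Hessian lies in the degree of the functional, so its class is fixed by one value, which the
Casimir trace supplies in terms of the Milnor number. -/
theorem loop_hess_mem (ha : ∀ i, 1 ≤ a i)
    (hinj : ∀ v : Fin (k + 1 + 1) → ℤ, (∀ i, a i * v i + v (i - 1) = 0) → v = 0)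
    (hw0 : ∀ i, 0 < w i) (hw : ∀ k, a k * w k + w (k + 1) = D)
    (hfin : Module.Finite ℂ (Jac (cycPoly a 1))) :
    (hess (cycPoly a 1), (∏ i, (a i : ℂ) - (-1) ^ (k + 2)) * milnorNumber (cycPoly a 1)) ∈
      cycVals a 1 loopAdm 1 := by
  have hw' : ∀ i, a i * w i + (1 : Fin (k + 1 + 1) → ℕ) i * w (i + 1) = D := by simpa using hw
  have hX : ∀ s, IsWeightedHomogeneous w (X s : MvPolynomial (Fin (k + 1 + 1)) ℂ) (w s) :=
    fun s => isWeightedHomogeneous_X _ _ _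
  have hoff : ∀ i, IsWeightedHomogeneous w (C (a i * (1 : Fin (k + 1 + 1) → ℕ) i : ℂ) *
      X i ^ (a i - 1) : MvPolynomial (Fin (k + 1 + 1)) ℂ) (D - w (i + 1) - w i) := by
    intro i
    refine IsWeightedHomogeneous.C_mul' ?_ _
    have h := (hX i).pow (a i - 1)
    convert h using 1
    rw [nsmul_eq_mul, Nat.cast_sub (ha i), ← hw i]
    push_cast
    ring
  have h1 : IsWeightedHomogeneous w (hess (cycPoly a 1)) (∑ i, (D - 2 * w i)) := by
    rw [hess_cycPoly (ε := 1) (fun _ => le_rfl)]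
    refine isWeightedHomogeneous_det (isWeightedHomogeneous_cycMat (fun i => ?_) hoff fun i => ?_)
    · by_cases h : a i = 1
      · rw [h]
        simpa using isWeightedHomogeneous_zero _ _ _
      · refine IsWeightedHomogeneous.C_mul' ?_ _
        have h := ((hX i).pow (a i - 1 - 1)).mul ((hX (i + 1)).pow ((1 : Fin (k + 1 + 1) → ℕ) i))
        convert h using 1
        have := ha i
        rw [nsmul_eq_mul, ← hw i, show a i - 1 - 1 = a i - 2 by omega, Nat.cast_sub (by omega)]
        simp only [Pi.one_apply, one_smul]
        push_cast
        ring
    · rw [show D - w i - w (i + 1) = D - w (i + 1) - w i by ring]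
      exact hoff i
  have h2 := loop_mem_of_homogeneous ha hinj hw0 hw h1
  rwa [(cyc_casimirData (loop_cycAdm ha hinj) ha (fun _ => le_rfl) hw0 hw').hess_eq hfin,
    loop_apply_casimir ha hinj hw0 hw] at h2

end LoopValues

/-! ### Difference derivatives of cyclic polynomials -/

section Differences

variable {N : ℕ} {a ε : Fin (N + 1) → ℕ}

theorem geomSum_mul_sub {R : Type*} [CommRing R] (m : ℕ) (x y : R) :
    geomSum m x y * (x - y) = x ^ m - y ^ m :=
  (Commute.all x y).geom_sum₂_mul m

theorem geomSum_self {R : Type*} [CommRing R] (m : ℕ) (x : R) :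
    geomSum m x x = m * x ^ (m - 1) := by
  rw [geomSum, Finset.sum_congr rfl (g := fun _ => x ^ (m - 1))]
  · simp
  · intro r hr
    have := Finset.mem_range.1 hr
    rw [← pow_add, show r + (m - 1 - r) = m - 1 by omega]

/-- Only $m_i$ and $m_{i-1}$ contain $x_i$. The neighbouring variable is still an `x` above index
`i` and already a `y` below it; the cases `i = Fin.last N` and `i = 0` are where the cyclic
neighbour wraps around. -/
theorem diffDeriv_cycPoly (hε : ∀ i, ε i ≤ 1) (hi : ∀ i : Fin (N + 1), i + 1 ≠ i ∨ ε i = 0)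
    (i : Fin (N + 1)) : diffDeriv i (cycPoly a ε) =
      geomSum (a i) (X (Sum.inl i)) (X (Sum.inr i)) *
        (if i = Fin.last N then X (Sum.inr (i + 1)) else X (Sum.inl (i + 1))) ^ ε i +
      C (ε (i - 1) : ℂ) *
        (if i = 0 then X (Sum.inl (i - 1)) else X (Sum.inr (i - 1))) ^ a (i - 1) := by
  have hne : (X (Sum.inl i) - X (Sum.inr i) : MvPolynomial (Fin (N + 1) ⊕ Fin (N + 1)) ℂ) ≠ 0 := by
    rw [sub_ne_zero]
    intro h
    simpa using X_injective h
  apply mul_left_cancel₀ hne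
  rw [← diffDeriv_spec]
  set mv : ℕ → Fin (N + 1) → MvPolynomial (Fin (N + 1) ⊕ Fin (N + 1)) ℂ :=
    fun m k => if (k : ℕ) < m then X (Sum.inr k) else X (Sum.inl k) with hmv
  have hmix : ∀ m, mixVars m (cycPoly a ε) = ∑ k, mv m k ^ a k * mv m (k + 1) ^ ε k := by
    intro m
    simp only [mixVars, cycPoly, map_sum, map_mul, map_pow, aeval_X, hmv]
  have hsame : ∀ k, k ≠ i → mv i k = mv (i + 1) k := by
    intro k hk
    have hk : (k : ℕ) ≠ i := fun h => hk (Fin.ext h)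
    simp only [hmv]
    split_ifs <;> first | rfl | omega
  have hii : mv i i = X (Sum.inl i) := by simp [hmv]
  have hii' : mv (i + 1) i = X (Sum.inr i) := by simp [hmv]
  have hpow : ∀ (e : ℕ), e ≤ 1 → ∀ (x y : MvPolynomial (Fin (N + 1) ⊕ Fin (N + 1)) ℂ),
      x ^ e - y ^ e = C (e : ℂ) * (x - y) := by
    intro e he x y
    interval_cases e <;> simp
  have hterm : ∀ k, mv i k ^ a k * mv i (k + 1) ^ ε k -
      mv (i + 1) k ^ a k * mv (i + 1) (k + 1) ^ ε k =
      (if k = i then (mv i i ^ a i - mv (i + 1) i ^ a i) * mv i (i + 1) ^ ε i else 0) +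
      if k = i - 1 then mv (i + 1) (i - 1) ^ a (i - 1) * (C (ε (i - 1) : ℂ) *
        (mv i i - mv (i + 1) i)) else 0 := by
    intro k
    have e1 : (mv i k ^ a k - mv (i + 1) k ^ a k) * mv i (k + 1) ^ ε k =
        if k = i then (mv i i ^ a i - mv (i + 1) i ^ a i) * mv i (i + 1) ^ ε i else 0 := by
      split_ifs with h
      · rw [h]
      · rw [hsame k h, sub_self, zero_mul]
    have e2 : mv (i + 1) k ^ a k * (mv i (k + 1) ^ ε k - mv (i + 1) (k + 1) ^ ε k) =
        if k = i - 1 then mv (i + 1) (i - 1) ^ a (i - 1) * (C (ε (i - 1) : ℂ) *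
          (mv i i - mv (i + 1) i)) else 0 := by
      rw [hpow _ (hε k)]
      split_ifs with h
      · rw [h, sub_add_cancel]
      · have h1 : k + 1 ≠ i := fun h1 => h (by rw [← h1, add_sub_cancel_right])
        rw [hsame _ h1, sub_self, mul_zero, mul_zero]
    rw [← e1, ← e2]
    ring
  have hu : mv i (i + 1) ^ ε i =
      (if i = Fin.last N then X (Sum.inr (i + 1)) else X (Sum.inl (i + 1))) ^ ε i := by
    rcases hi i with h | h
    · congr 1
      simp only [hmv]
      by_cases hl : i = Fin.last N
      · rw [if_pos hl, if_pos]
        subst hl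
        rw [Fin.last_add_one] at h ⊢
        exact Fin.pos_iff_ne_zero.2 h.symm
      · rw [if_neg hl, if_neg]
        rw [Fin.val_add_one_of_lt (Fin.lt_last_iff_ne_last.2 hl)]
        omega
    · rw [h, pow_zero, pow_zero]
  have hv : mv (i + 1) (i - 1) ^ a (i - 1) * C (ε (i - 1) : ℂ) = C (ε (i - 1) : ℂ) *
      (if i = 0 then X (Sum.inl (i - 1)) else X (Sum.inr (i - 1))) ^ a (i - 1) := by
    rw [mul_comm]
    rcases hi (i - 1) with h | h
    · congr 2
      rw [sub_add_cancel] at h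
      simp only [hmv]
      by_cases hl : i = 0
      · subst hl
        rw [if_pos rfl, if_neg]
        have h1 : (0 - 1 : Fin (N + 1)) ≠ 0 := h.symm
        have := Fin.pos_iff_ne_zero.2 h1
        rw [Fin.lt_def, Fin.val_zero] at this
        simp only [Fin.val_zero]
        omega
      · rw [if_neg hl, if_pos]
        have h1 := Fin.val_add_one_of_lt (i := i - 1) (Fin.lt_last_iff_ne_last.2 (fun h2 => hl (by
          rw [← sub_add_cancel i 1, h2, Fin.last_add_one])))
        rw [sub_add_cancel] at h1
        omega
    · simp [h]
  rw [hmix, hmix, ← Finset.sum_sub_distrib, Finset.sum_congr rfl fun k _ => hterm k,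
    Finset.sum_add_distrib]
  simp only [Finset.sum_ite_eq', Finset.mem_univ, if_true]
  rw [hu, ← mul_assoc (mv (i + 1) (i - 1) ^ a (i - 1)), hv, hii, hii', ← geomSum_mul_sub]
  ring

/-- The difference derivative of a cyclic polynomial at `y = s(x)`. -/
theorem aeval_diffDeriv_cycPoly (hε : ∀ i, ε i ≤ 1)
    (hi : ∀ i : Fin (N + 1), i + 1 ≠ i ∨ ε i = 0) (i : Fin (N + 1))
    (s : Fin (N + 1) → MvPolynomial (Fin (N + 1)) ℂ) :
    aeval (Sum.elim X s) (diffDeriv i (cycPoly a ε)) =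
      geomSum (a i) (X i) (s i) * (if i = Fin.last N then s (i + 1) else X (i + 1)) ^ ε i +
      C (ε (i - 1) : ℂ) * (if i = 0 then X (i - 1) else s (i - 1)) ^ a (i - 1) := by
  have hg : aeval (Sum.elim X s) (geomSum (a i) (X (Sum.inl i)) (X (Sum.inr i)) :
      MvPolynomial (Fin (N + 1) ⊕ Fin (N + 1)) ℂ) = geomSum (a i) (X i) (s i) := by
    simp [geomSum]
  rw [diffDeriv_cycPoly hε hi, map_add, map_mul, map_mul, hg, map_pow, map_pow, aeval_C]
  simp only [apply_ite (aeval (Sum.elim X s)), aeval_X, Sum.elim_inl, Sum.elim_inr, algebraMap_eq]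

variable {n : ℕ}

/-- The denominator is kept on the left. For a moved index it is a nonzero element of a domain, so
the coefficient is found by cancelling it. -/
theorem hfCoeffAt_spec (f : MvPolynomial (Fin n) ℂ) (g : Fin n → ℂˣ) (i j : Fin n) :
    (C (g j : ℂ) * X j - X j) * hfCoeffAt f g i j =
      aeval (Sum.elim X fun k => if k < j then X k else C (g k : ℂ) * X k) (diffDeriv i f) -
      aeval (Sum.elim X fun k => if k ≤ j then X k else C (g k : ℂ) * X k) (diffDeriv i f) := by
  set E : MvPolynomial (Fin n ⊕ Fin n) (MvPolynomial (Fin n) ℂ) →ₐ[MvPolynomial (Fin n) ℂ]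
    MvPolynomial (Fin n) ℂ := aeval (Sum.elim (fun k => C (g k : ℂ) * X k) X) with hE
  have key : ∀ (m : ℕ) (p : MvPolynomial (Fin n ⊕ Fin n) ℂ),
      E (mixVars m (aeval (Sum.elim (fun k => C (X k)) X) p :
        MvPolynomial (Fin n) (MvPolynomial (Fin n) ℂ))) =
      aeval (Sum.elim X fun k : Fin n => if (k : ℕ) < m then X k else C (g k : ℂ) * X k) p := by
    intro m p
    have h1 : ((E.restrictScalars ℂ).comp ((mixVars m : MvPolynomial (Fin n)
        (MvPolynomial (Fin n) ℂ) →ₐ[MvPolynomial (Fin n) ℂ] _).restrictScalars ℂ)).comp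
        (aeval (Sum.elim (fun k => C (X k)) X)) =
        aeval (Sum.elim X fun k : Fin n => if (k : ℕ) < m then X k else C (g k : ℂ) * X k) := by
      apply algHom_ext
      rintro (k | k)
      · simp only [AlgHom.comp_apply, AlgHom.restrictScalars_apply, aeval_X, Sum.elim_inl]
        rw [← algebraMap_eq, AlgHom.commutes, AlgHom.commutes]
        rfl
      · simp only [AlgHom.comp_apply, AlgHom.restrictScalars_apply, aeval_X, Sum.elim_inr, mixVars]
        split_ifs <;> simp [hE]
    exact DFunLike.congr_fun h1 p
  have h := congrArg E (diffDeriv_spec j (aeval (Sum.elim (fun k => C (X k)) X) (diffDeriv i f) :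
    MvPolynomial (Fin n) (MvPolynomial (Fin n) ℂ)))
  rw [map_sub, key, key, map_mul, map_sub] at h
  have e1 : E (X (Sum.inl j)) = C (g j : ℂ) * X j := by simp [hE]
  have e2 : E (X (Sum.inr j)) = X j := by simp [hE]
  rw [e1, e2] at h
  simp only [Fin.lt_def, Fin.le_def, ← Nat.lt_succ_iff]
  exact h.symm

theorem diffDerivAt_spec (ψ : Fin n → MvPolynomial (Fin n) ℂ) (j : Fin n)
    (p : MvPolynomial (Fin n) ℂ) :
    (X j - ψ j) * diffDerivAt ψ j p =
      aeval (fun k => if k < j then ψ k else X k) p -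
        aeval (fun k => if k ≤ j then ψ k else X k) p := by
  set E : MvPolynomial (Fin n ⊕ Fin n) ℂ →ₐ[ℂ] MvPolynomial (Fin n) ℂ := aeval (Sum.elim X ψ)
    with hE
  have key : ∀ m : ℕ, E (mixVars m p) =
      aeval (fun k : Fin n => if (k : ℕ) < m then ψ k else X k) p := by
    intro m
    have h1 : E.comp (mixVars m) =
        aeval (fun k : Fin n => if (k : ℕ) < m then ψ k else X k) := by
      apply algHom_ext
      intro k
      simp only [AlgHom.comp_apply, aeval_X, mixVars]
      split_ifs <;> simp [hE]
    exact DFunLike.congr_fun h1 p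
  have h := congrArg E (diffDeriv_spec j p)
  rw [map_sub, key, key, map_mul, map_sub] at h
  have e1 : E (X (Sum.inl j)) = X j := by simp [hE]
  have e2 : E (X (Sum.inr j)) = ψ j := by simp [hE]
  rw [e1, e2] at h
  simp only [Fin.lt_def, Fin.le_def, ← Nat.lt_succ_iff]
  exact h.symm

end Differences

/-! ### The coefficients of `H_f` and `H_{f,g}` -/

section Coefficients

variable {N : ℕ} {a ε : Fin (N + 1) → ℕ} {g : Fin (N + 1) → ℂˣ}

/-- `1 / (1 - g_i)`. -/
def invSub (g : Fin (N + 1) → ℂˣ) (i : Fin (N + 1)) : ℂ := 1 / (1 - (g i : ℂ))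

theorem one_sub_mul_invSub {i : Fin (N + 1)} (h : g i ≠ 1) : (1 - (g i : ℂ)) * invSub g i = 1 := by
  rw [invSub, mul_one_div_cancel]
  rw [sub_ne_zero]
  intro h1
  exact h (Units.ext h1.symm)

theorem geomSum_scaled (ha : ∀ i, 1 ≤ a i) {i : Fin (N + 1)} (h : g i ≠ 1) :
    geomSum (a i) (X i : MvPolynomial (Fin (N + 1)) ℂ) (C (g i : ℂ) * X i) =
      C ((1 - (g i : ℂ) ^ a i) * invSub g i) * X i ^ (a i - 1) := by
  have h1 := one_sub_mul_invSub h
  have h2 := geomSum_mul_sub (a i) (X i : MvPolynomial (Fin (N + 1)) ℂ) (C (g i : ℂ) * X i)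
  have h3 : (X i : MvPolynomial (Fin (N + 1)) ℂ) ≠ 0 := X_ne_zero i
  have h4 : (C ((1 - (g i : ℂ)) * invSub g i) : MvPolynomial (Fin (N + 1)) ℂ) = 1 := by
    rw [h1, C_1]
  apply mul_right_cancel₀ h3
  have h5 : (X i : MvPolynomial (Fin (N + 1)) ℂ) ^ (a i - 1) * X i = X i ^ a i := by
    rw [← pow_succ, Nat.sub_add_cancel (ha i)]
  simp only [mul_pow, C_mul, C_sub, C_1, C_pow] at h2 h4 ⊢
  linear_combination C (invSub g i) * h2 - geomSum (a i) (X i) (C (g i : ℂ) * X i) * X i * h4 -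
    (1 - C (g i : ℂ) ^ a i) * C (invSub g i) * h5

theorem C_mul_X_sub_X_ne_zero {i : Fin (N + 1)} (h : g i ≠ 1) :
    (C (g i : ℂ) * X i - X i : MvPolynomial (Fin (N + 1)) ℂ) ≠ 0 := by
  have h1 : (C (g i : ℂ) * X i - X i : MvPolynomial (Fin (N + 1)) ℂ) = C ((g i : ℂ) - 1) * X i := by
    rw [C_sub, C_1]
    ring
  rw [h1]
  refine mul_ne_zero ?_ (X_ne_zero i)
  rw [Ne, C_eq_zero, sub_eq_zero]
  intro h2
  exact h (Units.ext h2)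

/-- The coefficients of `H_f(x, g(x), x)` for a cyclic polynomial. -/
theorem hfCoeffAt_cycPoly (ha : ∀ i, 1 ≤ a i) (hε : ∀ i, ε i ≤ 1)
    (hi : ∀ i : Fin (N + 1), i + 1 ≠ i ∨ ε i = 0) {i j : Fin (N + 1)} (hji : j ≤ i)
    (hgi : g i ≠ 1) (hgj : g j ≠ 1) :
    hfCoeffAt (cycPoly a ε) g i j =
      (if i = j then C (a i * invSub g i - (1 - (g i : ℂ) ^ a i) * invSub g i ^ 2) *
        (X i ^ (a i - 1 - 1) * X (i + 1) ^ ε i) else 0) +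
      (if (i : ℕ) = j + 1 then C (ε j * ((1 - (g j : ℂ) ^ a j) * invSub g j)) * X j ^ (a j - 1)
        else 0) +
      if j = 0 ∧ i = Fin.last N then
        C (ε i * ((1 - (g i : ℂ) ^ a i) * invSub g i)) * X i ^ (a i - 1) else 0 := by
  apply mul_left_cancel₀ (C_mul_X_sub_X_ne_zero hgj)
  rw [hfCoeffAt_spec, aeval_diffDeriv_cycPoly hε hi, aeval_diffDeriv_cycPoly hε hi]
  set s : Fin (N + 1) → MvPolynomial (Fin (N + 1)) ℂ :=
    fun k => if k < j then X k else C (g k : ℂ) * X k with hs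
  set t : Fin (N + 1) → MvPolynomial (Fin (N + 1)) ℂ :=
    fun k => if k ≤ j then X k else C (g k : ℂ) * X k with ht
  have hst : ∀ k, k ≠ j → s k = t k := by
    intro k hk
    simp only [hs, ht]
    by_cases h : k < j
    · rw [if_pos h, if_pos h.le]
    · rw [if_neg h, if_neg]
      intro h1
      exact h (lt_of_le_of_ne h1 hk)
  have hsj : s j = C (g j : ℂ) * X j := by simp [hs]
  have htj : t j = X j := by simp [ht]
  have hsi : s i = C (g i : ℂ) * X i := by
    simp only [hs]
    rw [if_neg (not_lt.2 hji)]
  have hti : t i = if i = j then X i else C (g i : ℂ) * X i := by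
    simp only [ht]
    by_cases h : i = j
    · simp [h]
    · rw [if_neg h, if_neg]
      intro h1
      exact h (le_antisymm h1 hji)
  set U : (Fin (N + 1) → MvPolynomial (Fin (N + 1)) ℂ) → MvPolynomial (Fin (N + 1)) ℂ :=
    fun s => if i = Fin.last N then s (i + 1) else X (i + 1) with hU
  have hG := one_sub_mul_invSub hgi
  have hGj := one_sub_mul_invSub hgj
  -- the three kinds of differences
  have d1 : (geomSum (a i) (X i) (s i) - geomSum (a i) (X i) (t i)) * U t ^ ε i =
      (C (g j : ℂ) * X j - X j) * if i = j then
        C (a i * invSub g i - (1 - (g i : ℂ) ^ a i) * invSub g i ^ 2) *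
        (X i ^ (a i - 1 - 1) * X (i + 1) ^ ε i) else 0 := by
    by_cases h : i = j
    · subst h
      have hUt : U t ^ ε i = X (i + 1) ^ ε i := by
        by_cases hl : i = Fin.last N
        · simp only [hU, if_pos hl, ht]
          rw [if_pos]
          rw [hl]
          exact Fin.le_last _
        · simp only [hU, if_neg hl]
      rw [if_pos rfl, hUt, hsi, htj, geomSum_scaled ha hgi, geomSum_self]
      -- For $a_i=1$ the truncated exponent $a_i-1-1$ is 0 instead of $-1$; this is harmless since
      -- the coefficient vanishes.
      by_cases h1 : a i = 1
      · have h2 : (a i * invSub g i - (1 - (g i : ℂ) ^ a i) * invSub g i ^ 2) = 0 := by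
          rw [h1]
          push_cast
          linear_combination -invSub g i * hG
        rw [h2, h1, pow_one, hG]
        simp
      · have h2 : (X i : MvPolynomial (Fin (N + 1)) ℂ) ^ (a i - 1) =
            X i ^ (a i - 1 - 1) * X i := by
          rw [← pow_succ]
          congr 1
          have := ha i
          omega
        have h3 : (C ((1 - (g i : ℂ)) * invSub g i) : MvPolynomial (Fin (N + 1)) ℂ) = 1 := by
          rw [hG, C_1]
        rw [h2]
        simp only [C_mul, C_sub, C_1, C_pow, ← map_natCast (C (σ := Fin (N + 1)) (R := ℂ))] at h3 ⊢
        linear_combination (X i ^ (a i - 1 - 1) * X i * X (i + 1) ^ ε i) *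
          (C (a i : ℂ) - (1 - C (g i : ℂ) ^ a i) * C (invSub g i)) * h3
    · rw [if_neg h, hti, if_neg h, hsi, sub_self, zero_mul, mul_zero]
  have d2 : geomSum (a i) (X i) (s i) * (U s ^ ε i - U t ^ ε i) =
      (C (g j : ℂ) * X j - X j) * if j = 0 ∧ i = Fin.last N then
        C (ε i * ((1 - (g i : ℂ) ^ a i) * invSub g i)) * X i ^ (a i - 1) else 0 := by
    by_cases hl : i = Fin.last N
    · by_cases hj0 : j = 0
      · rw [if_pos ⟨hj0, hl⟩, hsi, geomSum_scaled ha hgi]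
        have hi1 : i + 1 = j := by rw [hl, hj0, Fin.last_add_one]
        simp only [hU, if_pos hl, hi1, hsj, htj]
        have hei : ε i = 0 ∨ ε i = 1 := by have := hε i; omega
        rcases hei with he | he <;> rw [he]
        · simp
        · simp only [pow_one, Nat.cast_one, one_mul]
          ring
      · have hne : i + 1 ≠ j := by
          rw [hl, Fin.last_add_one]
          exact fun h => hj0 h.symm
        rw [if_neg (fun h => hj0 h.1)]
        simp only [hU, if_pos hl, hst _ hne, sub_self, mul_zero]
    · rw [if_neg (fun h => hl h.2)]
      simp only [hU, if_neg hl, sub_self, mul_zero]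
  have d3 : C (ε (i - 1) : ℂ) * ((if i = 0 then X (i - 1) else s (i - 1)) ^ a (i - 1) -
      (if i = 0 then X (i - 1) else t (i - 1)) ^ a (i - 1)) =
      (C (g j : ℂ) * X j - X j) * if (i : ℕ) = j + 1 then
        C (ε j * ((1 - (g j : ℂ) ^ a j) * invSub g j)) * X j ^ (a j - 1) else 0 := by
    by_cases h0 : i = 0
    · have : ¬ (i : ℕ) = j + 1 := by rw [h0, Fin.val_zero]; omega
      rw [if_neg this, if_pos h0, if_pos h0, sub_self, mul_zero, mul_zero]
    · have h1 := Fin.val_add_one_of_lt (i := i - 1) (Fin.lt_last_iff_ne_last.2 (fun h2 => h0 (by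
          rw [← sub_add_cancel i 1, h2, Fin.last_add_one])))
      rw [sub_add_cancel] at h1
      rw [if_neg h0, if_neg h0]
      by_cases hj : i - 1 = j
      · have hij : (i : ℕ) = j + 1 := by rw [h1, hj]
        rw [if_pos hij, hj, hsj, htj, mul_pow]
        have h5 : (X j : MvPolynomial (Fin (N + 1)) ℂ) ^ (a j - 1) * X j = X j ^ a j := by
          rw [← pow_succ, Nat.sub_add_cancel (ha j)]
        have h3 : (C ((1 - (g j : ℂ)) * invSub g j) : MvPolynomial (Fin (N + 1)) ℂ) = 1 := by
          rw [hGj, C_1]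
        simp only [C_mul, C_sub, C_1, C_pow] at h3 ⊢
        linear_combination -C (ε j : ℂ) * (C (g j : ℂ) ^ a j - 1) * h5 -
          C (ε j : ℂ) * (C (g j : ℂ) ^ a j - 1) * X j ^ (a j - 1) * X j * h3
      · have hij : ¬ (i : ℕ) = j + 1 := by
          rw [h1]
          intro h
          exact hj (Fin.ext (by omega))
        rw [if_neg hij, hst _ hj, sub_self, mul_zero, mul_zero]
  rw [mul_add, mul_add, ← d1, ← d2, ← d3]
  ring

/-- The coefficients of `H_{f,g}` for a cyclic polynomial. -/
theorem hfgCoeff_cycPoly (ha : ∀ i, 1 ≤ a i) (hε : ∀ i, ε i ≤ 1)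
    (hi : ∀ i : Fin (N + 1), i + 1 ≠ i ∨ ε i = 0) (hg : ∀ k, (g k : ℂ) ^ a k * g (k + 1) ^ ε k = 1)
    {i j : Fin (N + 1)} (hji : j < i) (hgi : g i ≠ 1) (hgj : g j ≠ 1) :
    hfgCoeff (cycPoly a ε) g j i =
      (if (i : ℕ) = j + 1 then C (ε j * ((g j : ℂ) ^ a j * invSub g j)) * X j ^ (a j - 1)
        else 0) +
      if j = 0 ∧ i = Fin.last N then
        C (ε i * -invSub g i) * X i ^ (a i - 1) else 0 := by
  have hi0 : i ≠ 0 := by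
    rintro rfl
    exact absurd hji (Fin.not_lt_zero _)
  have hGj := one_sub_mul_invSub hgj
  set ψ : Fin (N + 1) → MvPolynomial (Fin (N + 1)) ℂ := fun k => if g k = 1 then X k else 0 with hψ
  have hψj : ψ j = 0 := by simp [hψ, hgj]
  have hX : (X j : MvPolynomial (Fin (N + 1)) ℂ) ≠ 0 := X_ne_zero j
  apply mul_left_cancel₀ hX
  have hspec := diffDerivAt_spec ψ j (diffDerivAt (fun k => C (g k : ℂ) * X k) i (cycPoly a ε))
  rw [hψj, sub_zero] at hspec
  have hdef : hfgCoeff (cycPoly a ε) g j i = C (invSub g j) * diffDerivAt ψ j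
      (diffDerivAt (fun k => C (g k : ℂ) * X k) i (cycPoly a ε)) := by
    rw [hfgCoeff, invSub]
  rw [hdef, mul_left_comm, hspec, diffDerivAt, aeval_diffDeriv_cycPoly hε hi,
    geomSum_scaled ha hgi, if_neg hi0]
  set s : Fin (N + 1) → MvPolynomial (Fin (N + 1)) ℂ := fun k => if k < j then ψ k else X k with hs
  set t : Fin (N + 1) → MvPolynomial (Fin (N + 1)) ℂ := fun k => if k ≤ j then ψ k else X k with ht
  have hst : ∀ k, k ≠ j → s k = t k := by
    intro k hk
    simp only [hs, ht]
    by_cases h : k < j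
    · rw [if_pos h, if_pos h.le]
    · rw [if_neg h, if_neg]
      intro h1
      exact h (lt_of_le_of_ne h1 hk)
  have hsj : s j = X j := by simp [hs]
  have htj : t j = 0 := by simp [ht, hψj]
  have hsi : s i = X i := by
    simp only [hs]
    rw [if_neg (not_lt.2 hji.le)]
  have hti : t i = X i := by rw [← hst i hji.ne', hsi]
  have happ : ∀ s : Fin (N + 1) → MvPolynomial (Fin (N + 1)) ℂ,
      aeval s (C ((1 - (g i : ℂ) ^ a i) * invSub g i) * X i ^ (a i - 1) *
        (if i = Fin.last N then C (g (i + 1) : ℂ) * X (i + 1) else X (i + 1)) ^ ε i +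
        C (ε (i - 1) : ℂ) * (C (g (i - 1) : ℂ) * X (i - 1)) ^ a (i - 1)) =
      C ((1 - (g i : ℂ) ^ a i) * invSub g i) * s i ^ (a i - 1) *
        (if i = Fin.last N then C (g (i + 1) : ℂ) * s (i + 1) else s (i + 1)) ^ ε i +
        C (ε (i - 1) : ℂ) * (C (g (i - 1) : ℂ) * s (i - 1)) ^ a (i - 1) := by
    intro s
    simp only [map_add, map_mul, map_pow, aeval_X, aeval_C, algebraMap_eq, apply_ite (aeval s)]
  rw [happ, happ, hsi, hti]
  have d1 : C (invSub g j) * (C ((1 - (g i : ℂ) ^ a i) * invSub g i) * X i ^ (a i - 1) *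
      ((if i = Fin.last N then C (g (i + 1) : ℂ) * s (i + 1) else s (i + 1)) ^ ε i -
        (if i = Fin.last N then C (g (i + 1) : ℂ) * t (i + 1) else t (i + 1)) ^ ε i)) =
      X j * if j = 0 ∧ i = Fin.last N then
        C (ε i * -invSub g i) * X i ^ (a i - 1) else 0 := by
    by_cases hl : i = Fin.last N
    · by_cases hj0 : j = 0
      · have hi1 : i + 1 = j := by rw [hl, hj0, Fin.last_add_one]
        rw [if_pos hl, if_pos hl, if_pos ⟨hj0, hl⟩, hi1, hsj, htj]
        have hei : ε i = 0 ∨ ε i = 1 := by have := hε i; omega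
        rcases hei with he | he <;> rw [he]
        · simp
        · have hgi1 := hg i
          rw [hi1, he, pow_one] at hgi1
          -- On the corner $i+1=j$, so $g_i^{a_i}g_j=1$ and $(1-g_i^{a_i})g_j=g_j-1$.
          have h3 : (C (invSub g j * ((1 - (g i : ℂ) ^ a i) * g j)) :
              MvPolynomial (Fin (N + 1)) ℂ) = -1 := by
            rw [← C_1, ← C_neg]
            congr 1
            linear_combination -invSub g j * hgi1 - hGj
          simp only [pow_one, Nat.cast_one, one_mul, mul_zero, sub_zero]
          simp only [C_mul, C_sub, C_1, C_pow, C_neg] at h3 ⊢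
          linear_combination C (invSub g i) * X i ^ (a i - 1) * X j * h3
      · have hne : i + 1 ≠ j := by
          rw [hl, Fin.last_add_one]
          exact fun h => hj0 h.symm
        rw [if_pos hl, if_pos hl, if_neg (fun h : j = 0 ∧ i = Fin.last N => hj0 h.1), hst _ hne, sub_self,
          mul_zero, mul_zero, mul_zero]
    · have hne : i + 1 ≠ j := by
        intro h
        have h1 := Fin.val_add_one_of_lt (Fin.lt_last_iff_ne_last.2 hl)
        rw [h] at h1
        rw [Fin.lt_def] at hji
        omega
      rw [if_neg hl, if_neg hl, if_neg (fun h : j = 0 ∧ i = Fin.last N => hl h.2), hst _ hne, sub_self,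
        mul_zero, mul_zero, mul_zero]
  have d2 : C (invSub g j) * (C (ε (i - 1) : ℂ) * ((C (g (i - 1) : ℂ) * s (i - 1)) ^ a (i - 1) -
      (C (g (i - 1) : ℂ) * t (i - 1)) ^ a (i - 1))) =
      X j * if (i : ℕ) = j + 1 then C (ε j * ((g j : ℂ) ^ a j * invSub g j)) * X j ^ (a j - 1)
        else 0 := by
    have h1 := Fin.val_add_one_of_lt (i := i - 1) (Fin.lt_last_iff_ne_last.2 (fun h2 => hi0 (by
          rw [← sub_add_cancel i 1, h2, Fin.last_add_one])))
    rw [sub_add_cancel] at h1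
    by_cases hj : i - 1 = j
    · have hij : (i : ℕ) = j + 1 := by rw [h1, hj]
      have h5 : (X j : MvPolynomial (Fin (N + 1)) ℂ) ^ (a j - 1) * X j = X j ^ a j := by
        rw [← pow_succ, Nat.sub_add_cancel (ha j)]
      have ha0 : a j ≠ 0 := by have := ha j; omega
      rw [if_pos hij, hj, hsj, htj, mul_zero, zero_pow ha0, sub_zero, mul_pow, ← h5]
      simp only [C_mul, C_pow]
      ring
    · have hij : ¬ (i : ℕ) = j + 1 := by
        rw [h1]
        intro h
        exact hj (Fin.ext (by omega))
      rw [if_neg hij, hst _ hj, sub_self, mul_zero, mul_zero, mul_zero]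
  rw [mul_add, ← d1, ← d2]
  ring

/-- The coefficients of `H_{f,g⁻¹}(g(x))` for a cyclic polynomial. -/
theorem diagSubst_hfgCoeff_cycPoly (ha : ∀ i, 1 ≤ a i) (hε : ∀ i, ε i ≤ 1)
    (hi : ∀ i : Fin (N + 1), i + 1 ≠ i ∨ ε i = 0) (hg : ∀ k, (g k : ℂ) ^ a k * g (k + 1) ^ ε k = 1)
    {i j : Fin (N + 1)} (hji : j < i) (hgi : g i ≠ 1) (hgj : g j ≠ 1) :
    diagSubst g (hfgCoeff (cycPoly a ε) g⁻¹ j i) =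
      (if (i : ℕ) = j + 1 then C (ε j * -invSub g j) * X j ^ (a j - 1) else 0) +
      if j = 0 ∧ i = Fin.last N then
        C (ε i * ((g i : ℂ) ^ a i * invSub g i)) * X i ^ (a i - 1) else 0 := by
  -- $1/(1-g^{-1})=-g/(1-g)$; the extra $g$ merges with $g^{a-1}$ or $g^{-a}$ coming from the
  -- substitution and the coefficient.
  have hinv : ∀ k, g k ≠ 1 → invSub g⁻¹ k = -((g k : ℂ) * invSub g k) := by
    intro k hk
    have h1 := one_sub_mul_invSub hk
    have h2 := one_sub_mul_invSub (g := g⁻¹) (i := k) (by simpa using hk)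
    have h0 : (g k : ℂ) ≠ 0 := (g k).ne_zero
    rw [Pi.inv_apply, Units.val_inv_eq_inv_val] at h2
    have h3 : (g k : ℂ) * (g k : ℂ)⁻¹ = 1 := mul_inv_cancel₀ h0
    linear_combination invSub g⁻¹ k * (-1) * h1 - (g k : ℂ) * invSub g k * h2 +
      (-invSub g⁻¹ k * invSub g k) * h3
  have hpow : ∀ k, diagSubst g (X k ^ (a k - 1)) = C ((g k : ℂ) ^ (a k - 1)) * X k ^ (a k - 1) := by
    intro k
    simp [diagSubst, mul_pow]
  have hC : ∀ r : ℂ, diagSubst g (C r) = C r := by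
    intro r
    simp [diagSubst]
  have hga : ∀ k, (g k : ℂ) ^ a k = (g k : ℂ) ^ (a k - 1) * g k := by
    intro k
    rw [← pow_succ, Nat.sub_add_cancel (ha k)]
  rw [hfgCoeff_cycPoly ha hε hi (fun k => by
    have := hg k
    rw [Pi.inv_apply, Pi.inv_apply, Units.val_inv_eq_inv_val, Units.val_inv_eq_inv_val, inv_pow,
      inv_pow, ← mul_inv, this, inv_one]) hji (by simpa using hgi) (by simpa using hgj), map_add]
  congr 1
  · split_ifs with h
    · rw [map_mul, hpow, hC, ← mul_assoc, ← C_mul, hinv j hgj, Pi.inv_apply,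
        Units.val_inv_eq_inv_val, inv_pow, hga]
      congr 2
      have h0 : (g j : ℂ) ≠ 0 := (g j).ne_zero
      field_simp
    · rw [map_zero]
  · split_ifs with h
    · rw [map_mul, hpow, hC, ← mul_assoc, ← C_mul, hinv i hgi, hga]
      congr 2
      ring
    · rw [map_zero]

end Coefficients

/-! ### The structure constants of cyclic polynomials -/

section StructureConstants

variable {N : ℕ} {a ε : Fin (N + 1) → ℕ} {g : Fin (N + 1) → ℂˣ}

variable (a ε g) in
/-- The diagonal coefficients of `H_f(x, g(x), x)`. -/
def cycDiag (i : Fin (N + 1)) : MvPolynomial (Fin (N + 1)) ℂ :=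
  C (a i * invSub g i - (1 - (g i : ℂ) ^ a i) * invSub g i ^ 2) *
    (X i ^ (a i - 1 - 1) * X (i + 1) ^ ε i)

theorem X_sq_mul_cycDiag {i : Fin (N + 1)} (ha : 1 ≤ a i) (h : g i ≠ 1) :
    X i ^ 2 * cycDiag a ε g i = C (a i * invSub g i +
      -((1 - (g i : ℂ) ^ a i) * invSub g i ^ 2)) * (X i ^ a i * X (i + 1) ^ ε i) := by
  rw [cycDiag, ← sub_eq_add_neg]
  refine X_sq_mul_X_pow i (a i) _ (fun h1 => ?_) _
  have hG := one_sub_mul_invSub h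
  rw [show a i = 1 by omega]
  push_cast
  linear_combination -invSub g i * hG

/-- Used with $q=g_i^{a_i}=1/g_{i+1}$. It makes the dimer numbers of the structure constants factor
as in `contin_succ_of_factor`. -/
theorem invSub_mul_one_sub {i : Fin (N + 1)} {q : ℂ} (h : g i ≠ 1) (hq : q * g i = 1) :
    invSub g i * (1 - q) = -q := by
  have hG := one_sub_mul_invSub h
  linear_combination -q * hG - invSub g i * hq

/-- The corner coefficients carry the factor $\varepsilon_N=0$, so the ladder is open. -/
theorem chain_ladderCoeffs (ha : ∀ i, 1 ≤ a i) (hε : IsChainExp ε)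
    (hg : ∀ k, (g k : ℂ) ^ a k * g (k + 1) ^ ε k = 1) {d : ℕ} (hd0 : 0 < d) (hd : d ≤ N + 1)
    (hm : ∀ i, g i ≠ 1 ↔ (i : ℕ) < d) :
    LadderCoeffs (cycPoly a ε) g d (fun i => cycDiag a ε g (cyc N i))
      (fun i => C (ε (cyc N i) * ((g (cyc N i) : ℂ) ^ a (cyc N i) * invSub g (cyc N i))) *
        X (cyc N i) ^ (a (cyc N i) - 1))
      (fun i => C (ε (cyc N i) * -invSub g (cyc N i)) * X (cyc N i) ^ (a (cyc N i) - 1))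
      (fun i => C (ε (cyc N i) * ((1 - (g (cyc N i) : ℂ) ^ a (cyc N i)) * invSub g (cyc N i))) *
        X (cyc N i) ^ (a (cyc N i) - 1)) 0 0 0 where
  pos := hd0
  le := hd
  moved i := by simp [movedIdx, hm]
  hf i j hji hi := by
    rw [hfCoeffAt_cycPoly ha hε.le_one hε.add_one_ne_or hji ((hm i).2 hi)
      ((hm j).2 (lt_of_le_of_lt hji hi))]
    simp only [cyc_val, ite_self, ← Fin.ext_iff, add_zero, cycDiag]
    rw [add_eq_left]
    split_ifs with h
    · simp [h.2, hε.last]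
    · rfl
  hfg i j hji hi := by
    rw [hfgCoeff_cycPoly ha hε.le_one hε.add_one_ne_or hg hji ((hm i).2 hi)
      ((hm j).2 (lt_trans hji hi))]
    simp only [cyc_val, ite_self, add_zero]
    rw [add_eq_left]
    split_ifs with h
    · simp [h.2, hε.last]
    · rfl
  hfg_inv i j hji hi := by
    rw [diagSubst_hfgCoeff_cycPoly ha hε.le_one hε.add_one_ne_or hg hji ((hm i).2 hi)
      ((hm j).2 (lt_trans hji hi))]
    simp only [cyc_val, ite_self, add_zero]
    rw [add_eq_left]
    split_ifs with h
    · simp [h.2, hε.last]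
    · rfl

/-- `σ_{g,g⁻¹}` for chains. -/
theorem chain_sigmaInv (ha : ∀ i, 1 ≤ a i) (hε : IsChainExp ε)
    (hg : ∀ k, (g k : ℂ) ^ a k * g (k + 1) ^ ε k = 1) {d : ℕ} (hd0 : 0 < d) (hd : d ≤ N + 1)
    (hm : ∀ i, g i ≠ 1 ↔ (i : ℕ) < d) :
    ∃ K, sigmaInv (cycPoly a ε) g = jacMk (cycPoly a ε) (((-1 : ℤ) ^ d * revSign d) • K) ∧
      (K, ∏ i ∈ Finset.range d, (a (cyc N i) * invSub g (cyc N i) : ℂ)) ∈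
        cycRep a ε {Fin.last N}ᶜ (∑ i ∈ Finset.range d, idx (cyc N i)) := by
  have h := chain_ladderCoeffs ha hε hg hd0 hd hm
  refine ⟨contin (fun i => cycDiag a ε g (cyc N i))
    (fun i => -((C (ε (cyc N i) * ((g (cyc N i) : ℂ) ^ a (cyc N i) * invSub g (cyc N i))) *
        X (cyc N i) ^ (a (cyc N i) - 1)) *
        (C (ε (cyc N i) * -invSub g (cyc N i)) * X (cyc N i) ^ (a (cyc N i) - 1)))) d,
    h.sigmaInv_eq _ ?_, ?_⟩
  · intro R _ _ φ
    simp only [map_zero, bond, zero_smul, add_zero]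
    rw [(grassmann_theta.ladder_pow _ _ _ _ d).1]
    congr 2
    rw [← AlgHom.coe_toRingHom, map_contin]
    simp only [AlgHom.coe_toRingHom, map_neg, map_mul]
  · have hmc : ∀ i < d, g (cyc N i) ≠ 1 := fun i hi => (hm _).2 (by rwa [val_cyc (by omega)])
    -- With $G_i=1/(1-g_i)$ and $q_i=g_i^{a_i}$, the diagonal number splits as
    -- $a_iG_i-(1-q_i)G_i^2$.
    set v : ℕ → ℂ := fun i => -((1 - (g (cyc N i) : ℂ) ^ a (cyc N i)) * invSub g (cyc N i) ^ 2)
      with hv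
    have h1 := chain_contin_mem ha hε (o := 0) (k := d) (by omega)
      (D := fun i => cycDiag a ε g (cyc N i))
      (d := fun i => -((C (ε (cyc N i) * ((g (cyc N i) : ℂ) ^ a (cyc N i) * invSub g (cyc N i))) *
        X (cyc N i) ^ (a (cyc N i) - 1)) *
        (C (ε (cyc N i) * -invSub g (cyc N i)) * X (cyc N i) ^ (a (cyc N i) - 1))))
      (κ := fun i => a (cyc N i) * invSub g (cyc N i) + v i)
      (δ := fun i => -(a (cyc N (i + 1)) * invSub g (cyc N (i + 1)) * v i))
      (fun i hi => by
        simp only [zero_add]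
        exact X_sq_mul_cycDiag (ha _) (hmc i hi))
      (fun i hi => by
        simp only [zero_add]
        have he := hε.cyc_eq_one (i := i) (by omega)
        have hgi := hg (cyc N i)
        rw [he, pow_one, ← cyc_succ] at hgi
        have h2 := invSub_mul_one_sub (hmc (i + 1) hi) hgi
        refine ⟨(g (cyc N i) : ℂ) ^ a (cyc N i) * invSub g (cyc N i) ^ 2, ?_, ?_⟩
        · rw [he]
          simp only [Nat.cast_one, one_mul, C_mul, C_neg, C_pow]
          ring
        · rw [cycRatio_cyc, hv]
          linear_combination (-a (cyc N (i + 1)) * invSub g (cyc N i) ^ 2 : ℂ) * h2)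
    simp only [zero_add] at h1
    obtain ⟨d, rfl⟩ : ∃ e, d = e + 1 := ⟨d - 1, by omega⟩
    -- After the renaming `d` is the last moved index: its successor is fixed or absent, so $q_d=1$
    -- and only $\prod a_iG_i$ survives.
    have hv0 : v d = 0 := by
      have hgd := hg (cyc N d)
      have : (g (cyc N d + 1) : ℂ) ^ ε (cyc N d) = 1 := by
        by_cases hdN : d = N
        · rw [hdN, cyc_last, hε.last, pow_zero]
        · have : g (cyc N d + 1) = 1 := by
            rw [← cyc_succ]
            by_contra hne
            have := (hm _).1 hne
            rw [val_cyc (by omega)] at this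
            omega
          rw [this, Units.val_one, one_pow]
      rw [this, mul_one] at hgd
      simp only [hv]
      rw [hgd, sub_self, zero_mul, neg_zero]
    rwa [contin_succ_of_factor (α := fun i => (a (cyc N i) * invSub g (cyc N i) : ℂ)) (v := v) d
      (fun i _ => rfl) (fun i _ => rfl), hv0, zero_mul, zero_add] at h1

end StructureConstants

/-! ### Loops -/

/-- The row vector $(1,1)$ is a left eigenvector of each transfer matrix, with eigenvalue $r_if_i$.
-/
theorem transfer_sum {R : Type*} [CommRing R] {b c s f : ℕ → R} {r : ℕ → R}
    (hb : ∀ i, b i = r i * f i) (hc : ∀ i, c i = -f i) (hs : ∀ i, s i = (1 - r i) * f i)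
    (p : R × R) (j : ℕ) :
    (transfer b c s p j).1 + (transfer b c s p j).2 =
      (p.1 + p.2) * ∏ i ∈ Finset.range j, (r i * f i) := by
  induction j with
  | zero => simp [transfer]
  | succ j ih =>
    rw [Finset.prod_range_succ, transfer, hb, hc, hs]
    linear_combination r j * f j * ih

/-- The sum of the two initial vectors, $(-1,1)$, is a right eigenvector of each transfer matrix,
with eigenvalue $-f_i$. -/
theorem transfer_add {R : Type*} [CommRing R] {b c s f : ℕ → R} {r : ℕ → R}
    (hb : ∀ i, b i = r i * f i) (hc : ∀ i, c i = -f i) (hs : ∀ i, s i = (1 - r i) * f i) (j : ℕ) :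
    (transfer b c s (0, 1) j).1 + (transfer b c s (-1, 0) j).1 =
        -((-1) ^ j * ∏ i ∈ Finset.range j, f i) ∧
      (transfer b c s (0, 1) j).2 + (transfer b c s (-1, 0) j).2 =
        (-1) ^ j * ∏ i ∈ Finset.range j, f i := by
  induction j with
  | zero => simp [transfer]
  | succ j ih =>
    rw [Finset.prod_range_succ]
    simp only [transfer, hb, hc, hs]
    constructor
    · linear_combination f j * ih.2
    · linear_combination r j * f j * ih.1 - (1 - r j) * f j * ih.2

section LoopConstants

variable {k : ℕ} {a : Fin (k + 1 + 1) → ℕ} {w : Fin (k + 1 + 1) → ℤ} {D : ℤ}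
  {g : Fin (k + 1 + 1) → ℂˣ}

theorem loop_ladderCoeffs (ha : ∀ i, 1 ≤ a i) (hg : ∀ k, (g k : ℂ) ^ a k * g (k + 1) = 1)
    (hm : ∀ i, g i ≠ 1) :
    LadderCoeffs (cycPoly a 1) g (k + 2) (fun i => cycDiag a 1 g (cyc (k + 1) i))
      (fun i => C ((g (cyc (k + 1) i) : ℂ) ^ a (cyc (k + 1) i) * invSub g (cyc (k + 1) i)) *
        X (cyc (k + 1) i) ^ (a (cyc (k + 1) i) - 1))
      (fun i => C (-invSub g (cyc (k + 1) i)) * X (cyc (k + 1) i) ^ (a (cyc (k + 1) i) - 1))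
      (fun i => C ((1 - (g (cyc (k + 1) i) : ℂ) ^ a (cyc (k + 1) i)) * invSub g (cyc (k + 1) i)) *
        X (cyc (k + 1) i) ^ (a (cyc (k + 1) i) - 1))
      (C (-invSub g (Fin.last _)) * X (Fin.last _) ^ (a (Fin.last _) - 1))
      (C ((g (Fin.last _) : ℂ) ^ a (Fin.last _) * invSub g (Fin.last _)) *
        X (Fin.last _) ^ (a (Fin.last _) - 1))
      (C ((1 - (g (Fin.last _) : ℂ) ^ a (Fin.last _)) * invSub g (Fin.last _)) *
        X (Fin.last _) ^ (a (Fin.last _) - 1)) := by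
  have hlast : ∀ i j : Fin (k + 1 + 1), ((j : ℕ) = 0 ∧ (i : ℕ) + 1 = k + 2) ↔
      (j = 0 ∧ i = Fin.last _) := by
    intro i j
    rw [Fin.ext_iff, Fin.ext_iff, Fin.val_last, Fin.val_zero]
    omega
  have hg' : ∀ i, (g i : ℂ) ^ a i * g (i + 1) ^ (1 : Fin (k + 1 + 1) → ℕ) i = 1 := by simpa using hg
  refine ⟨by omega, le_rfl, fun i => by simp [movedIdx, hm], fun i j hji hi => ?_,
    fun i j hji hi => ?_, fun i j hji hi => ?_⟩
  · rw [hfCoeffAt_cycPoly (ε := 1) ha (fun _ => le_rfl) (fun i => Or.inl (add_one_ne_self i)) hji (hm i)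
      (hm j)]
    simp only [cyc_val, hlast, ← Fin.ext_iff, cycDiag, Pi.one_apply, Nat.cast_one, one_mul]
    congr 1
    split_ifs with h
    · rw [h.2]
    · rfl
  · rw [hfgCoeff_cycPoly (ε := 1) ha (fun _ => le_rfl) (fun i => Or.inl (add_one_ne_self i)) hg' hji (hm i)
      (hm j)]
    simp only [cyc_val, hlast, Pi.one_apply, Nat.cast_one, one_mul]
    congr 1
    split_ifs with h
    · rw [h.2]
    · rfl
  · rw [diagSubst_hfgCoeff_cycPoly (ε := 1) ha (fun _ => le_rfl) (fun i => Or.inl (add_one_ne_self i)) hg'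
      hji (hm i) (hm j)]
    simp only [cyc_val, hlast, Pi.one_apply, Nat.cast_one, one_mul]
    congr 1
    split_ifs with h
    · rw [h.2]
    · rfl

theorem prod_range_cyc_succ {M : Type*} [CommMonoid M] (F : Fin (k + 1 + 1) → M) :
    ∏ i ∈ Finset.range (k + 2), F (cyc (k + 1) i + 1) = ∏ i, F i := by
  rw [prod_range_cyc fun i => F (i + 1)]
  exact Equiv.prod_comp (Equiv.addRight (1 : Fin (k + 1 + 1))) F

/-- `σ_{g,g⁻¹}` for loops. -/
theorem loop_sigmaInv (ha : ∀ i, 1 ≤ a i)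
    (hinj : ∀ v : Fin (k + 1 + 1) → ℤ, (∀ i, a i * v i + v (i - 1) = 0) → v = 0)
    (hw0 : ∀ i, 0 < w i) (hw : ∀ k, a k * w k + w (k + 1) = D)
    (hg : ∀ k, (g k : ℂ) ^ a k * g (k + 1) = 1) (hm : ∀ i, g i ≠ 1) :
    ∃ K, sigmaInv (cycPoly a 1) g =
        jacMk (cycPoly a 1) (((-1 : ℤ) ^ (k + 2) * revSign (k + 2)) • K) ∧
      (K, (∏ i, invSub g i) * (∏ i, (a i : ℂ) - (-1) ^ (k + 2))) ∈ cycVals a 1 loopAdm 1 := by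
  have h := loop_ladderCoeffs ha hg hm
  set q : ℕ → ℂ := fun i => (g (cyc (k + 1) i) : ℂ) ^ a (cyc (k + 1) i) with hq
  set G : ℕ → ℂ := fun i => invSub g (cyc (k + 1) i) with hG
  set F : ℕ → MvPolynomial (Fin (k + 1 + 1)) ℂ :=
    fun i => C (G i) * X (cyc (k + 1) i) ^ (a (cyc (k + 1) i) - 1) with hF
  set Df : ℕ → MvPolynomial (Fin (k + 1 + 1)) ℂ := fun i => cycDiag a 1 g (cyc (k + 1) i) with hDf
  have hqg : ∀ i, G (i + 1) * (1 - q i) = -q i := fun i =>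
    invSub_mul_one_sub (hm _) (by rw [cyc_succ]; exact hg _)
  have hb : ∀ i, C (q i * G i) * X (cyc (k + 1) i) ^ (a (cyc (k + 1) i) - 1) = C (q i) * F i := by
    intro i
    rw [hF, C_mul, mul_assoc]
  have hc : ∀ i, C (-G i) * X (cyc (k + 1) i) ^ (a (cyc (k + 1) i) - 1) = -F i := by
    intro i
    rw [hF, C_neg, neg_mul]
  have hs : ∀ i, C ((1 - q i) * G i) * X (cyc (k + 1) i) ^ (a (cyc (k + 1) i) - 1) =
      (1 - C (q i)) * F i := by
    intro i
    rw [hF, C_mul, C_sub, C_1, mul_assoc]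
  rw [← cyc_last] at h
  change LadderCoeffs _ _ _ Df
    (fun i => C (q i * G i) * X (cyc (k + 1) i) ^ (a (cyc (k + 1) i) - 1))
    (fun i => C (-G i) * X (cyc (k + 1) i) ^ (a (cyc (k + 1) i) - 1))
    (fun i => C ((1 - q i) * G i) * X (cyc (k + 1) i) ^ (a (cyc (k + 1) i) - 1))
    (C (-G (k + 1)) * X (cyc (k + 1) (k + 1)) ^ (a (cyc (k + 1) (k + 1)) - 1))
    (C (q (k + 1) * G (k + 1)) * X (cyc (k + 1) (k + 1)) ^ (a (cyc (k + 1) (k + 1)) - 1))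
    (C ((1 - q (k + 1)) * G (k + 1)) * X (cyc (k + 1) (k + 1)) ^ (a (cyc (k + 1) (k + 1)) - 1)) at h
  simp only [hb, hc, hs] at h
  -- The last summand is the winding contribution: the two eigenvector identities evaluate the three
  -- closing terms to $((-1)^{k+1}-\prod q_i)\prod F_i$.
  refine ⟨contin Df (fun i => -(C (q i) * F i * -F i)) (k + 2) -
      -F (k + 1) * (C (q (k + 1)) * F (k + 1)) * contin (fun i => Df (i + 1))
        (fun i => -(C (q (i + 1)) * F (i + 1) * -F (i + 1))) k +
      ((-1) ^ (k + 1) - C (∏ i ∈ Finset.range (k + 2), q i)) * ∏ i ∈ Finset.range (k + 2), F i,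
    h.sigmaInv_eq _ ?_, ?_⟩
  · intro R _ _ φ
    rw [show k + 2 - 1 = k + 1 from rfl, grassmann_theta.add_ladder_pow_cyclic]
    congr 2
    have hb' : ∀ i, φ (C (q i) * F i) = φ (C (q i)) * φ (F i) := fun i => map_mul _ _ _
    have hc' : ∀ i, φ (-F i) = -φ (F i) := fun i => map_neg _ _
    have hs' : ∀ i, φ ((1 - C (q i)) * F i) = (1 - φ (C (q i))) * φ (F i) := fun i => by simp
    have t1 := (transfer_add hb' hc' hs' (k + 1)).1
    have t2 := transfer_sum hb' hc' hs' (-1, 0) (k + 1)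
    have m1 : φ (contin Df (fun i => -(C (q i) * F i * -F i)) (k + 2)) =
        contin (fun i => φ (Df i)) (fun i => -(φ (C (q i) * F i) * φ (-F i))) (k + 2) := by
      rw [← AlgHom.coe_toRingHom, map_contin]
      simp only [AlgHom.coe_toRingHom, map_neg, map_mul]
    have m2 : φ (contin (fun i => Df (i + 1))
        (fun i => -(C (q (i + 1)) * F (i + 1) * -F (i + 1))) k) =
        contin (fun i => φ (Df (i + 1)))
          (fun i => -(φ (C (q (i + 1)) * F (i + 1)) * φ (-F (i + 1)))) k := by
      rw [← AlgHom.coe_toRingHom, map_contin]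
      simp only [AlgHom.coe_toRingHom, map_neg, map_mul]
    rw [map_add, map_sub, m1, map_mul φ (-F (k + 1) * (C (q (k + 1)) * F (k + 1))), m2,
      map_mul φ _ (∏ i ∈ Finset.range (k + 2), F i)]
    rw [Finset.prod_mul_distrib] at t2
    rw [Finset.prod_range_succ F, Finset.prod_range_succ q, C_mul]
    simp only [map_mul, map_neg, map_sub, map_prod, map_pow, map_one] at t1 t2 ⊢
    linear_combination φ (C (q (k + 1))) * φ (F (k + 1)) * t2 - φ (F (k + 1)) * t1
  · have h1 := loop_contin_mem ha hinj hw0 hw (F := Df)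
      (d := fun i => -(C (q i) * F i * -F i)) (W := -F (k + 1) * (C (q (k + 1)) * F (k + 1)))
      (α := fun i => a (cyc (k + 1) i) * G i) (v := fun i => -((1 - q i) * G i ^ 2))
      (fun i _ => by
        have := X_sq_mul_cycDiag (ε := 1) (ha _) (hm (cyc (k + 1) i))
        simpa only [Pi.one_apply, pow_one] using this)
      (fun i _ => by
        refine ⟨q i * G i ^ 2, ?_, ?_⟩
        · simp only [hF, C_mul, C_pow]
          ring
        · rw [cycRatio_cyc]
          linear_combination (-a (cyc (k + 1) (i + 1)) * G i ^ 2 : ℂ) * hqg i)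
      (by
        refine ⟨-(q (k + 1) * G (k + 1) ^ 2), ?_, ?_⟩
        · simp only [hF, C_mul, C_pow, C_neg, cyc_last]
          ring
        · have h0 : cyc (k + 1) (k + 1 + 1) = 0 := by rw [cyc_succ, cyc_last, Fin.last_add_one]
          have := hqg (k + 1)
          rw [cycRatio, Fin.last_add_one]
          simp only [hG, h0, show cyc (k + 1) 0 = 0 from rfl] at this ⊢
          linear_combination (a 0 * invSub g (cyc (k + 1) (k + 1)) ^ 2 : ℂ) * this)
    have h2 := loop_prod_mem ha hinj hw0 hw
      (((-1) ^ (k + 1) - ∏ i ∈ Finset.range (k + 2), q i) * ∏ i, invSub g i)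
    have h12 := add_mem h1 h2
    rw [Prod.mk_add_mk] at h12
    have e1 : ∏ i ∈ Finset.range (k + 2), F i = C (∏ i, invSub g i) * ∏ i, X i ^ (a i - 1) := by
      rw [hF, prod_range_cyc fun i => (C (invSub g i) * X i ^ (a i - 1) : MvPolynomial _ ℂ),
        Finset.prod_mul_distrib, map_prod]
    -- Since $G_{i+1}(1-q_i)=-q_i$, multiplying by $\prod G_{i+1}$, which is $\prod G_i$ around the
    -- cycle, and cancelling it gives the identity. This $\prod q_i\prod G_i$ is cancelled by the
    -- second winding term.
    have e2 : ∏ i ∈ Finset.range (k + 2), -((1 - q i) * G i ^ 2) =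
        (∏ i ∈ Finset.range (k + 2), q i) * ∏ i, invSub g i := by
      have h3 : (∏ i ∈ Finset.range (k + 2), G (i + 1)) = ∏ i, invSub g i := by
        rw [← prod_range_cyc_succ]
        simp only [hG, cyc_succ]
      have h4 : (∏ i ∈ Finset.range (k + 2), G i) = ∏ i, invSub g i :=
        prod_range_cyc (invSub g)
      have h5 : ∏ i, invSub g i ≠ 0 := by
        rw [Finset.prod_ne_zero_iff]
        intro i _ h0
        have := one_sub_mul_invSub (hm i)
        rw [h0, mul_zero] at this
        exact zero_ne_one this
      apply mul_left_cancel₀ h5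
      conv_lhs => rw [← h3]
      rw [← Finset.prod_mul_distrib, ← h4, ← mul_assoc, mul_comm (∏ i ∈ _, G i), mul_assoc,
        ← Finset.prod_mul_distrib, ← Finset.prod_mul_distrib]
      refine Finset.prod_congr rfl fun i _ => ?_
      linear_combination -G i ^ 2 * hqg i
    convert h12 using 2
    · rw [e1]
      simp only [C_mul, C_sub, C_pow, C_neg, C_1]
      ring
    · rw [e2, Finset.prod_mul_distrib, prod_range_cyc fun i => (a i : ℂ),
        show (∏ i ∈ Finset.range (k + 2), G i) = ∏ i, invSub g i from prod_range_cyc (invSub g)]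
      ring

end LoopConstants

/-! ### Consequences of invertibility -/

section Invertible

variable {N : ℕ} {a ε : Fin (N + 1) → ℕ}

variable (a ε) in
/-- The exponents of the monomials of `cycPoly a ε`. -/
def cycExp (k : Fin (N + 1)) : Fin (N + 1) →₀ ℕ :=
  Finsupp.single k (a k) + Finsupp.single (k + 1) (ε k)

theorem cycPoly_eq_sum_monomial : cycPoly a ε = ∑ k, monomial (cycExp a ε k) (1 : ℂ) := by
  refine Finset.sum_congr rfl fun k _ => ?_
  rw [X_pow_eq_monomial, X_pow_eq_monomial, monomial_mul, one_mul, cycExp]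

theorem sum_mul_cycExp (v : Fin (N + 1) → ℤ) (i : Fin (N + 1)) :
    ∑ k, v k * (cycExp a ε k i : ℤ) = a i * v i + ε (i - 1) * v (i - 1) := by
  have h : ∀ k, v k * (cycExp a ε k i : ℤ) =
      (if k = i then a i * v i else 0) + if k = i - 1 then ε (i - 1) * v (i - 1) else 0 := by
    intro k
    simp only [cycExp, Finsupp.add_apply, Finsupp.single_apply, Nat.cast_add, Nat.cast_ite,
      Nat.cast_zero, mul_add, eq_sub_iff_add_eq]
    congr 1
    · split_ifs with h
      · rw [h, mul_comm]
      · simp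
    · split_ifs with h
      · rw [← h, add_sub_cancel_right, mul_comm]
      · simp
  simp [h, Finset.sum_add_distrib]

theorem sum_cycExp_mul {R : Type*} [CommSemiring R] (u : Fin (N + 1) → R) (k : Fin (N + 1)) :
    ∑ i, (cycExp a ε k i : R) * u i = a k * u k + ε k * u (k + 1) := by
  simp [cycExp, Finsupp.single_apply, add_mul, Finset.sum_add_distrib]

theorem exists_eq_cycExp_of_coeff_ne_zero {p : Fin (N + 1) →₀ ℕ}
    (h : coeff p (cycPoly a ε) ≠ 0) : ∃ k, cycExp a ε k = p := by
  rw [cycPoly_eq_sum_monomial, coeff_sum] at h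
  obtain ⟨k, -, hk⟩ := Finset.exists_ne_zero_of_sum_ne_zero h
  rw [coeff_monomial] at hk
  exact ⟨k, by_contra fun h => hk (if_neg h)⟩

/-- The exponents of the monomials of an invertible cyclic polynomial are independent. -/
theorem IsInvertible.cyc_inj (h : IsInvertible (cycPoly a ε)) (v : Fin (N + 1) → ℤ)
    (hv : ∀ i, a i * v i + ε (i - 1) * v (i - 1) = 0) : v = 0 := by
  by_contra hne
  obtain ⟨c, F, hc, hf, hdet⟩ := h.monomials
  set E : Matrix (Fin (N + 1)) (Fin (N + 1)) ℚ := Matrix.of fun k i => (cycExp a ε k i : ℚ) with hE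
  have hEdet : E.det = 0 := by
    refine Matrix.exists_vecMul_eq_zero_iff.1 ⟨fun k => (v k : ℚ), fun h0 => hne ?_, ?_⟩
    · funext k
      have := congrFun h0 k
      simpa using this
    · funext i
      have h1 := sum_mul_cycExp (a := a) (ε := ε) v i
      rw [hv] at h1
      have h2 := congrArg (Int.cast : ℤ → ℚ) h1
      simpa [Matrix.vecMul, dotProduct, hE] using h2
  obtain ⟨u, hu0, hu⟩ := Matrix.exists_mulVec_eq_zero_iff.2 hEdet
  refine hdet (Matrix.exists_mulVec_eq_zero_iff.1 ⟨u, hu0, ?_⟩)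
  -- The presentation given by invertibility need not be the obvious one. Its exponents are
  -- distinct, so each occurs in $f$ and equals some row of the obvious matrix; a kernel vector of
  -- the latter is then one of the former.
  set q : Fin (N + 1) → Fin (N + 1) →₀ ℕ := fun i => Finsupp.equivFunOnFinite.symm (F i) with hq
  have hqinj : Function.Injective q := by
    intro i j hij
    by_contra hne
    refine hdet (Matrix.det_zero_of_row_eq hne ?_)
    have h1 : F i = F j := Finsupp.equivFunOnFinite.symm.injective hij
    funext l
    simp [h1]
  have hf' : cycPoly a ε = ∑ i, monomial (q i) (c i) := by
    rw [hf]
    refine Finset.sum_congr rfl fun i _ => ?_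
    rw [monomial_eq, Finsupp.prod_fintype _ _ (by simp)]
    rfl
  funext i
  have h1 : coeff (q i) (cycPoly a ε) ≠ 0 := by
    rw [hf', coeff_sum]
    simp [coeff_monomial, hqinj.eq_iff, hc i]
  obtain ⟨k, hk⟩ := exists_eq_cycExp_of_coeff_ne_zero h1
  have h2 := congrFun hu k
  simp only [Matrix.mulVec, dotProduct, hE, Matrix.of_apply, hk, Pi.zero_apply] at h2
  simpa [Matrix.mulVec, dotProduct, hq] using h2

theorem cycExp_injective
    (hinj : ∀ v : Fin (N + 1) → ℤ, (∀ i, a i * v i + ε (i - 1) * v (i - 1) = 0) → v = 0) :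
    Function.Injective (cycExp a ε) := by
  intro k l hkl
  by_contra hne
  have h := hinj (Pi.single k 1 - Pi.single l 1) (by
    intro i
    rw [← sum_mul_cycExp]
    simp [sub_mul, Finset.sum_sub_distrib, Pi.single_apply, hkl])
  have := congrFun h k
  simp [hne] at this

theorem coeff_cycExp
    (hinj : ∀ v : Fin (N + 1) → ℤ, (∀ i, a i * v i + ε (i - 1) * v (i - 1) = 0) → v = 0)
    (k : Fin (N + 1)) : coeff (cycExp a ε k) (cycPoly a ε) = 1 := by
  rw [cycPoly_eq_sum_monomial, coeff_sum]
  simp [coeff_monomial, (cycExp_injective hinj).eq_iff]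

theorem IsInvertible.cyc_weights (h : IsInvertible (cycPoly a ε)) :
    ∃ (w : Fin (N + 1) → ℤ) (D : ℤ), (∀ i, 0 < w i) ∧
      ∀ k, a k * w k + ε k * w (k + 1) = D := by
  obtain ⟨w, d, hw, -, hf⟩ := h.weighted
  refine ⟨fun i => w i, d, fun i => Int.natCast_pos.2 (hw i), fun k => ?_⟩
  have h1 := hf (d := cycExp a ε k) (by
    rw [coeff_cycExp h.cyc_inj]
    exact one_ne_zero)
  rw [Finsupp.weight_apply, Finsupp.sum_fintype _ _ (by simp)] at h1
  simp only [smul_eq_mul] at h1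
  have h2 := sum_cycExp_mul (a := a) (ε := ε) (fun i => (w i : ℤ)) k
  rw [← h2, ← h1]
  push_cast
  rfl

theorem diagSubst_monomial {n : ℕ} (g : Fin n → ℂˣ) (p : Fin n →₀ ℕ) (r : ℂ) :
    diagSubst g (monomial p r) = monomial p ((∏ i, (g i : ℂ) ^ p i) * r) := by
  rw [diagSubst, aeval_monomial, monomial_eq, Finsupp.prod_fintype _ _ (by simp),
    Finsupp.prod_fintype _ _ (by simp)]
  simp only [mul_pow, Finset.prod_mul_distrib, algebraMap_eq, C_mul, map_prod, map_pow]
  ring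

/-- The equations of a diagonal symmetry of a cyclic polynomial. -/
theorem IsInvertible.cyc_character (h : IsInvertible (cycPoly a ε)) {g : Fin (N + 1) → ℂˣ}
    (hg : g ∈ maxSymGroup (cycPoly a ε)) (k : Fin (N + 1)) :
    (g k : ℂ) ^ a k * g (k + 1) ^ ε k = 1 := by
  have h1 : diagSubst g (cycPoly a ε) = cycPoly a ε := hg
  have h2 := congrArg (coeff (cycExp a ε k)) h1
  rw [coeff_cycExp h.cyc_inj, cycPoly_eq_sum_monomial, map_sum, coeff_sum] at h2
  simp only [diagSubst_monomial, coeff_monomial, (cycExp_injective h.cyc_inj).eq_iff,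
    Finset.sum_ite_eq', Finset.mem_univ, if_true, mul_one] at h2
  rw [← h2]
  simp only [cycExp, Finsupp.add_apply, pow_add, Finset.prod_mul_distrib]
  congr 1
  · rw [Finset.prod_eq_single k] <;> simp +contextual [eq_comm]
  · rw [Finset.prod_eq_single (k + 1)] <;> simp +contextual [eq_comm]

end Invertible

/-! ### Chains and loops as cyclic polynomials -/

section Types

variable {N : ℕ} {a ε : Fin (N + 1) → ℕ}

theorem chainPoly_eq_cycPoly (hε : IsChainExp ε) : chainPoly a = cycPoly a ε := by
  refine Finset.sum_congr rfl fun i _ => ?_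
  rw [hε]
  congr 1
  by_cases h : i = Fin.last N
  · subst h
    simp
  · have hlt : (i : ℕ) < N := by
      have := Fin.lt_last_iff_ne_last.2 h
      rwa [Fin.lt_def, Fin.val_last] at this
    rw [dif_pos (by omega), if_neg h, pow_one]
    congr 1
    ext
    rw [Fin.val_add_one_of_lt (Fin.lt_last_iff_ne_last.2 h)]

theorem loopPoly_eq_cycPoly {k : ℕ} (a : Fin (k + 1 + 1) → ℕ) : loopPoly a = cycPoly a 1 := by
  refine Finset.sum_congr rfl fun i _ => ?_
  rw [Pi.one_apply, pow_one]
  congr 2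

/-- The coordinates moved by a symmetry of a chain are the first ones. -/
theorem chain_exists_moved (hε : IsChainExp ε) {g : Fin (N + 1) → ℂˣ}
    (hg : ∀ k, (g k : ℂ) ^ a k * g (k + 1) ^ ε k = 1) (hg1 : g ≠ 1) :
    ∃ d, 0 < d ∧ d ≤ N + 1 ∧ ∀ i, g i ≠ 1 ↔ (i : ℕ) < d := by
  classical
  -- $g_i^{a_i}g_{i+1}=1$ shows that fixed coordinates propagate to the right.
  have hstep : ∀ i < N, g (cyc N i) = 1 → g (cyc N (i + 1)) = 1 := by
    intro i hi h
    have h1 := hg (cyc N i)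
    rw [h, hε.cyc_eq_one hi, pow_one, Units.val_one, one_pow, one_mul, ← cyc_succ] at h1
    exact Units.ext h1
  have hex : ∃ m, ∀ i : Fin (N + 1), m ≤ (i : ℕ) → g i = 1 :=
    ⟨N + 1, fun i hi => absurd i.2 (by omega)⟩
  refine ⟨Nat.find hex, Nat.pos_of_ne_zero fun h0 => hg1 ?_, Nat.find_min' hex fun i hi =>
    absurd i.2 (by omega), fun i => ⟨fun h => ?_, fun h h1 => ?_⟩⟩
  · funext i
    exact Nat.find_spec hex i (by omega)
  · by_contra hlt
    exact h (Nat.find_spec hex i (by omega))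
  · have hup : ∀ m, (i : ℕ) + m < N + 1 → g (cyc N (i + m)) = 1 := by
      intro m
      induction m with
      | zero =>
        intro _
        simpa using h1
      | succ m ih =>
        intro hm
        exact hstep (i + m) (by omega) (ih (by omega))
    refine Nat.find_min hex h fun j hj => ?_
    have := hup (j - i) (by have := j.2; omega)
    rwa [Nat.add_sub_cancel' hj, cyc_val] at this

/-- If $a_N=1$ the last monomial is $x_N$, so $w_N=D$, and the preceding monomial leaves no positive
weight for $x_{N-1}$. With one variable the symmetry group is trivial instead. -/
theorem chain_two_le_last (ha : ∀ i, 1 ≤ a i) (hε : IsChainExp ε) {w : Fin (N + 1) → ℤ} {D : ℤ}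
    (hw0 : ∀ i, 0 < w i) (hw : ∀ k, a k * w k + ε k * w (k + 1) = D) {g : Fin (N + 1) → ℂˣ}
    (hg : ∀ k, (g k : ℂ) ^ a k * g (k + 1) ^ ε k = 1) (hg1 : g ≠ 1) : 2 ≤ a (Fin.last N) := by
  by_contra hlt
  have h1 : a (Fin.last N) = 1 := by have := ha (Fin.last N); omega
  cases N with
  | zero =>
    refine hg1 ?_
    funext i
    have h2 := hg (Fin.last 0)
    rw [h1, hε.last, pow_one, pow_zero, mul_one] at h2
    rw [show i = Fin.last 0 from Fin.ext (by have := i.2; rw [Fin.val_last]; omega)]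
    exact Units.ext h2
  | succ N =>
    have h2 := hw (Fin.last _)
    have h3 := hw (cyc (N + 1) N)
    rw [h1, hε.last] at h2
    rw [hε.cyc_eq_one (by omega), ← cyc_succ, cyc_last] at h3
    have h4 : (0 : ℤ) < a (cyc (N + 1) N) * w (cyc (N + 1) N) :=
      mul_pos (by exact_mod_cast ha _) (hw0 _)
    push_cast at h2 h3
    linarith

variable {k : ℕ}

theorem loop_moved {g : Fin (N + 1) → ℂˣ}
    {a : Fin (N + 1) → ℕ} (hg : ∀ k, (g k : ℂ) ^ a k * g (k + 1) = 1) (hg1 : g ≠ 1)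
    (i : Fin (N + 1)) : g i ≠ 1 := by
  intro h
  refine hg1 ?_
  have hup : ∀ m : ℕ, g (i + cyc N m) = 1 := by
    intro m
    induction m with
    | zero =>
      rw [show cyc N 0 = 0 from rfl, add_zero]
      exact h
    | succ m ih =>
      have h1 := hg (i + cyc N m)
      rw [ih, Units.val_one, one_pow, one_mul, add_assoc, ← cyc_succ] at h1
      exact Units.ext h1
  funext j
  have := hup ((j - i : Fin (N + 1)) : ℕ)
  rwa [cyc_val, add_sub_cancel] at this

/-- Since all $a_i\ge0$, equality would force all $a_i=1$ and an even number of variables, and then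
the alternating vector is a linear relation between the exponents. -/
theorem loop_prod_ne {a : Fin (k + 1 + 1) → ℕ}
    (hinj : ∀ v : Fin (k + 1 + 1) → ℤ, (∀ i, a i * v i + v (i - 1) = 0) → v = 0) :
    ∏ i, (a i : ℂ) - (-1) ^ (k + 2) ≠ 0 := by
  intro h
  have h0 : (∏ i, (a i : ℤ)) = (-1) ^ (k + 2) := by
    have : ((∏ i, (a i : ℤ) : ℤ) : ℂ) = (((-1) ^ (k + 2) : ℤ) : ℂ) := by
      push_cast
      linear_combination h
    exact_mod_cast this
  have heven : Even (k + 2) := by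
    by_contra hodd
    rw [(Nat.not_even_iff_odd.1 hodd).neg_one_pow] at h0
    have : (0 : ℤ) ≤ ∏ i, (a i : ℤ) := Finset.prod_nonneg fun _ _ => Int.natCast_nonneg _
    omega
  rw [heven.neg_one_pow] at h0
  have h1 : ∏ i, a i = 1 := by exact_mod_cast h0
  have h2 : ∀ i, a i = 1 := fun i => Nat.eq_one_of_dvd_one (h1 ▸ Finset.dvd_prod_of_mem a
    (Finset.mem_univ i))
  have h3 := hinj (fun i => (-1) ^ (i : ℕ)) (by
    intro i
    obtain ⟨m, hm⟩ := i
    rw [h2]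
    cases m with
    | zero =>
      rw [Fin.mk_zero_sub_one]
      have : Odd (k + 1) := by
        rcases heven with ⟨r, hr⟩
        exact ⟨r - 1, by omega⟩
      simp [this.neg_one_pow]
    | succ m =>
      rw [Fin.mk_succ_sub_one]
      simp only [pow_succ]
      push_cast
      ring)
  have := congrFun h3 0
  simp at this

end Types

/-! ### Jacobian algebras of restrictions -/

section Restriction

theorem milnorNumber_of_isEmpty {σ : Type} [IsEmpty σ] (f : MvPolynomial σ ℂ) :
    milnorNumber f = 1 := by
  have h : jacobianIdeal f = ⊥ := by simp [jacobianIdeal]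
  let e : Jac f ≃ₗ[ℂ] ℂ := ((Ideal.quotientEquivAlgOfEq ℂ h).toLinearEquiv.trans
    (AlgEquiv.quotientBot ℂ (MvPolynomial σ ℂ)).toLinearEquiv).trans
      (isEmptyAlgEquiv ℂ σ).toLinearEquiv
  rw [milnorNumber, e.finrank_eq, Module.finrank_self]

theorem hess_of_isEmpty {σ : Type} [Fintype σ] [IsEmpty σ] (f : MvPolynomial σ ℂ) :
    hess f = 1 := by
  rw [hess]
  convert Matrix.det_isEmpty
  infer_instance

variable {σ τ : Type}

/-- The isomorphism of Jacobian algebras given by a renaming of the variables. -/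
def jacRenameEquiv (e : σ ≃ τ) (f : MvPolynomial σ ℂ) : Jac f ≃ₐ[ℂ] Jac (rename e f) :=
  Ideal.quotientEquivAlg _ _ (renameEquiv ℂ e) (jacobianIdeal_rename e f)

theorem milnorNumber_rename (e : σ ≃ τ) (f : MvPolynomial σ ℂ) :
    milnorNumber (rename e f) = milnorNumber f :=
  (jacRenameEquiv e f).toLinearEquiv.finrank_eq.symm

theorem hess_rename [Fintype σ] [Fintype τ] (e : σ ≃ τ) (f : MvPolynomial σ ℂ) :
    hess (rename e f) = rename e (hess f) := by
  classical
  rw [hess, hess, AlgHom.map_det, ← Matrix.det_submatrix_equiv_self e]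
  congr 1
  · ext i j : 2
    simp [pderiv_rename e.injective]

variable {n : ℕ}

theorem restrictFix_surjective (g : Fin n → ℂˣ) : Function.Surjective (restrictFix g) := by
  intro p
  refine ⟨rename Subtype.val p, ?_⟩
  have h : (restrictFix g).comp (rename Subtype.val) = AlgHom.id ℂ _ := by
    apply algHom_ext
    rintro ⟨i, hi⟩
    simp [restrictFix, hi]
  exact DFunLike.congr_fun h p

theorem restrictFix_pderiv (g : Fin n → ℂˣ) (i : {i // g i = 1}) (p : MvPolynomial (Fin n) ℂ) :
    restrictFix g (pderiv (i : Fin n) p) = pderiv i (restrictFix g p) := by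
  induction p using MvPolynomial.induction_on with
  | C r => simp [restrictFix]
  | add p q hp hq => simp only [map_add, hp, hq]
  | mul_X p j hp =>
    simp only [Derivation.leibniz, map_mul, map_add, hp, smul_eq_mul]
    congr 1
    simp only [restrictFix, aeval_X, pderiv_X, Pi.single_apply]
    split_ifs with h1 h2 h2
    · subst h1
      simp
    · exact absurd (h1 ▸ i.2) h2
    · have : (⟨j, h2⟩ : {i // g i = 1}) ≠ i := fun h => h1 (by rw [← h])
      simp [pderiv_X_of_ne this]
    · simp

/-- The moved derivatives vanish on the fixed locus, so restriction maps the Jacobian ideal into the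
one of $f^g$ and induces a surjection of Jacobian algebras. -/
theorem finite_jac_fixPoly {f : MvPolynomial (Fin n) ℂ} {g : Fin n → ℂˣ}
    (h : ∀ i, g i ≠ 1 → restrictFix g (pderiv i f) = 0) (hfin : Module.Finite ℂ (Jac f)) :
    Module.Finite ℂ (Jac (fixPoly f g)) := by
  have hle : jacobianIdeal f ≤ (jacobianIdeal (fixPoly f g)).comap (restrictFix g) := by
    rw [jacobianIdeal, Ideal.span_le]
    rintro _ ⟨i, rfl⟩
    change restrictFix g (pderiv i f) ∈ jacobianIdeal (fixPoly f g)
    by_cases hi : g i = 1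
    · rw [restrictFix_pderiv g ⟨i, hi⟩]
      exact Ideal.subset_span ⟨_, rfl⟩
    · rw [h i hi]
      exact zero_mem _
  exact Module.Finite.of_surjective (Ideal.quotientMapₐ _ (restrictFix g) hle).toLinearMap
    (Ideal.quotientMap_surjective (H := hle) (restrictFix_surjective g))

end Restriction

/-! ### Restrictions of chains -/

section ChainRestriction

variable {d M : ℕ} {a ε : Fin (d + M + 1) → ℕ} {g : Fin (d + M + 1) → ℂˣ}

/-- The coordinates fixed by a symmetry of a chain. -/
def chainFixEquiv (hm : ∀ i, g i ≠ 1 ↔ (i : ℕ) < d) :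
    Fin (M + 1) ≃ {i : Fin (d + M + 1) // g i = 1} where
  toFun j := ⟨cyc (d + M) (d + j), by
    by_contra h
    have := (hm _).1 h
    rw [val_cyc (by omega)] at this
    omega⟩
  invFun i := ⟨(i : Fin (d + M + 1)) - d, by omega⟩
  left_inv j := by
    ext
    simp only
    rw [val_cyc (by omega)]
    omega
  right_inv i := by
    have h : ¬ ((i : Fin (d + M + 1)) : ℕ) < d := fun h => (hm _).2 h i.2
    ext
    simp only
    rw [val_cyc (by omega)]
    omega

theorem IsChainExp.tail (hε : IsChainExp ε) :
    IsChainExp fun j : Fin (M + 1) => ε (cyc (d + M) (d + j)) := by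
  intro j
  change ε (cyc (d + M) (d + j)) = _
  rw [hε]
  refine if_congr ?_ rfl rfl
  rw [Fin.ext_iff, Fin.ext_iff, val_cyc (by omega), Fin.val_last, Fin.val_last]
  omega

theorem sum_cyc_tail {A : Type*} [AddCommMonoid A] (F : Fin (d + M + 1) → A) :
    ∑ i, F i = ∑ i ∈ Finset.range d, F (cyc (d + M) i) +
      ∑ j : Fin (M + 1), F (cyc (d + M) (d + j)) := by
  rw [Finset.sum_fin_eq_sum_range, ← Finset.sum_range fun j => F (cyc (d + M) (d + j)),
    show Finset.range (d + M + 1) = Finset.range (d + (M + 1)) from rfl, Finset.sum_range_add]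
  congr 1
  all_goals
    refine Finset.sum_congr rfl fun i hi => ?_
    rw [Finset.mem_range] at hi
    rw [dif_pos (by omega)]
    congr 1
    ext
    rw [val_cyc (by omega)]

theorem restrictFix_X_of_lt (hm : ∀ i, g i ≠ 1 ↔ (i : ℕ) < d) {i : Fin (d + M + 1)}
    (h : (i : ℕ) < d) : restrictFix g (X i) = 0 := by
  rw [restrictFix, aeval_X, dif_neg ((hm i).2 h)]

theorem restrictFix_X_cyc (hm : ∀ i, g i ≠ 1 ↔ (i : ℕ) < d) (j : Fin (M + 1)) :
    restrictFix g (X (cyc (d + M) (d + j))) = X (chainFixEquiv hm j) := by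
  rw [restrictFix, aeval_X]
  exact dif_pos (chainFixEquiv hm j).2

theorem chain_fixPoly (ha : ∀ i, 1 ≤ a i) (hε : IsChainExp ε)
    (hm : ∀ i, g i ≠ 1 ↔ (i : ℕ) < d) :
    fixPoly (cycPoly a ε) g = rename (chainFixEquiv hm)
      (cycPoly (fun j => a (cyc (d + M) (d + j))) fun j => ε (cyc (d + M) (d + j))) := by
  rw [fixPoly, cycPoly, map_sum, sum_cyc_tail, Finset.sum_eq_zero, zero_add, cycPoly, map_sum]
  · refine Finset.sum_congr rfl fun j _ => ?_
    simp only [map_mul, map_pow, restrictFix_X_cyc hm, rename_X]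
    congr 1
    by_cases hj : j = Fin.last M
    · have h0 : ε (cyc (d + M) (d + j)) = 0 := by
        rw [hj, Fin.val_last, cyc_last, hε.last]
      rw [h0, pow_zero, pow_zero]
    · rw [← cyc_succ, add_assoc d (j : ℕ) 1, ← Fin.val_add_one_of_lt (Fin.lt_last_iff_ne_last.2 hj),
        restrictFix_X_cyc hm]
  · intro i hi
    rw [Finset.mem_range] at hi
    rw [map_mul, map_pow, restrictFix_X_of_lt hm (by rwa [val_cyc (by omega)]), zero_pow, zero_mul]
    have := ha (cyc (d + M) i)
    omega

/-- Every term of $\partial_if$ contains a moved coordinate: $x_{i+1}$ or $x_{i-1}$ in general, and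
$x_i$ itself at the last moved index, where $a_i\ge2$ is needed. -/
theorem chain_restrictFix_pderiv (ha : ∀ i, 1 ≤ a i) (hε : IsChainExp ε)
    (hm : ∀ i, g i ≠ 1 ↔ (i : ℕ) < d) (hd : ∀ i : Fin (d + M + 1), (i : ℕ) + 1 = d → 2 ≤ a i)
    (i : Fin (d + M + 1)) (hi : g i ≠ 1) : restrictFix g (pderiv i (cycPoly a ε)) = 0 := by
  have hi := (hm i).1 hi
  have hlast : i ≠ Fin.last _ := by
    rintro rfl
    rw [Fin.val_last] at hi
    omega
  have h1 : restrictFix g (X i ^ (a i - 1) * X (i + 1) ^ ε i) = 0 := by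
    rw [map_mul, map_pow, map_pow]
    by_cases hid : (i : ℕ) + 1 = d
    · have := hd i hid
      rw [restrictFix_X_of_lt hm hi, zero_pow (by omega), zero_mul]
    · rw [restrictFix_X_of_lt hm (i := i + 1), hε, if_neg hlast, pow_one, mul_zero]
      rw [Fin.val_add_one_of_lt (Fin.lt_last_iff_ne_last.2 hlast)]
      omega
  have h2 : restrictFix g (C (ε (i - 1) : ℂ) * X (i - 1) ^ a (i - 1)) = 0 := by
    rw [map_mul, map_pow]
    by_cases h0 : i - 1 = Fin.last _
    · rw [h0, hε.last, Nat.cast_zero, C_0, map_zero, zero_mul]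
    · have h3 := Fin.val_add_one_of_lt (Fin.lt_last_iff_ne_last.2 h0)
      rw [sub_add_cancel] at h3
      have := ha (i - 1)
      rw [restrictFix_X_of_lt hm (i := i - 1) (by omega), zero_pow (by omega), mul_zero]
  rw [pderiv_cycPoly hε.le_one, map_add, map_mul, h1, h2, mul_zero, add_zero]

theorem chain_hess_fixPoly (ha : ∀ i, 1 ≤ a i) (hε : IsChainExp ε)
    (hm : ∀ i, g i ≠ 1 ↔ (i : ℕ) < d) :
    rename Subtype.val (hess (fixPoly (cycPoly a ε) g)) =
      contin (fun i => C (a (cyc (d + M) (d + i)) * (a (cyc (d + M) (d + i)) - 1 : ℕ) : ℂ) *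
        (X (cyc (d + M) (d + i)) ^ (a (cyc (d + M) (d + i)) - 1 - 1) *
          X (cyc (d + M) (d + i) + 1) ^ ε (cyc (d + M) (d + i))))
      (fun i => -(C (a (cyc (d + M) (d + i)) * ε (cyc (d + M) (d + i)) : ℂ) *
          X (cyc (d + M) (d + i)) ^ (a (cyc (d + M) (d + i)) - 1) *
        (C (a (cyc (d + M) (d + i)) * ε (cyc (d + M) (d + i)) : ℂ) *
          X (cyc (d + M) (d + i)) ^ (a (cyc (d + M) (d + i)) - 1)))) (M + 1) := by
  have ht := hε.tail (M := M)
  have hval : ∀ j : Fin (M + 1), (chainFixEquiv hm j : Fin (d + M + 1)) = cyc (d + M) (d + j) :=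
    fun _ => rfl
  rw [chain_fixPoly ha hε hm, hess_rename, rename_rename, hess_cycPoly ht.le_one,
    det_cycMat_of_last_eq_zero (by rw [ht.last]; simp) (by rw [ht.last]; simp),
    ← AlgHom.coe_toRingHom, map_contin]
  refine contin_congr (fun i hi => ?_) (fun i hi => ?_)
  · simp only [AlgHom.coe_toRingHom, map_mul, map_pow, rename_X, algHom_C, algebraMap_eq,
      Function.comp_apply, hval, val_cyc hi]
    congr 2
    by_cases h : i = M
    · rw [h, show ε (cyc (d + M) (d + M)) = 0 by rw [cyc_last, hε.last], pow_zero, pow_zero]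
    · rw [← cyc_succ, ← cyc_succ, val_cyc (by omega), add_assoc d i 1]
  · simp only [AlgHom.coe_toRingHom, map_mul, map_pow, rename_X, algHom_C, algebraMap_eq, map_neg,
      Function.comp_apply, hval, val_cyc (show i < M + 1 by omega)]

end ChainRestriction

/-! ### The constant in the structure constants -/

section Constant

theorem ee_add (s t : ℝ) : ee (s + t) = ee s * ee t := by
  rw [ee, ee, ee, ← Complex.exp_add]
  congr 1
  push_cast
  ring

theorem ee_zero : ee 0 = 1 := by simp [ee]

theorem ee_sum {ι : Type*} (s : Finset ι) (t : ι → ℝ) : ee (∑ i ∈ s, t i) = ∏ i ∈ s, ee (t i) := by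
  classical
  induction s using Finset.induction_on with
  | empty => simp [ee_zero]
  | insert i s hi ih => rw [Finset.sum_insert hi, Finset.prod_insert hi, ee_add, ih]

theorem eq_zero_of_ee_eq_one {t : ℝ} (h0 : 0 ≤ t) (h1 : t < 1) (h : ee t = 1) : t = 0 := by
  rw [ee, Complex.exp_eq_one_iff] at h
  obtain ⟨m, hm⟩ := h
  have h2 : (t : ℂ) = m := by
    have h3 : (2 * Real.pi * Complex.I : ℂ) ≠ 0 := by
      simp [Real.pi_ne_zero, Complex.I_ne_zero]
    apply mul_left_cancel₀ h3
    rw [hm]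
    ring
  have h3 : t = m := by exact_mod_cast h2
  have h4 : m = 0 := by
    rw [h3] at h0 h1
    have h5 : 0 ≤ m := by exact_mod_cast h0
    have h6 : m < 1 := by exact_mod_cast h1
    omega
  rw [h3, h4, Int.cast_zero]

/-- $1-\mathbf e[t]=-2\sqrt{-1}\,\sin(\pi t)\,\mathbf e[\tfrac t2]$ and $\mathbf
e[-\frac14]=-\sqrt{-1}$. -/
theorem ee_neg_half_mul (t : ℝ) (h : ee t ≠ 1) :
    ee (-(1 / 2) * t) * (ee (-(1 / 4)) / (2 * (Real.sin (t * Real.pi) : ℂ))) =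
      -(1 / (1 - ee t)) := by
  have h4 : ee (-(1 / 4)) = -Complex.I := by
    rw [ee, show (2 * Real.pi * Complex.I * ((-(1 / 4) : ℝ) : ℂ)) =
      -(Real.pi / 2 * Complex.I) by push_cast; ring, Complex.exp_neg, Complex.exp_pi_div_two_mul_I,
      Complex.inv_I]
  set u := ee (1 / 2 * t) with hu
  have hu0 : u ≠ 0 := Complex.exp_ne_zero _
  have hu2 : ee t = u * u := by
    rw [hu, ← ee_add]
    congr 1
    ring
  have hui : ee (-(1 / 2) * t) = u⁻¹ := by
    refine eq_inv_of_mul_eq_one_left ?_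
    rw [hu, ← ee_add, ← ee_zero]
    congr 1
    ring
  have hsin : (2 * (Real.sin (t * Real.pi) : ℂ)) = (u⁻¹ - u) * Complex.I := by
    rw [Complex.ofReal_sin, Complex.two_sin, ← hui, hu, ee, ee]
    congr 3 <;> · push_cast; ring_nf
  have hne : 1 - u * u ≠ 0 := by
    rw [← hu2, sub_ne_zero]
    exact h.symm
  have hne' : u⁻¹ - u ≠ 0 := by
    intro h0
    apply hne
    have := congrArg (u * ·) h0
    simpa [mul_sub, hu0] using this
  rw [hui, h4, hsin, hu2]
  have hI := Complex.I_ne_zero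
  have e : (u⁻¹ - u) * u = 1 - u * u := by
    rw [sub_mul, inv_mul_cancel₀ hu0]
  rw [← e]
  field_simp

theorem ee_age_mul_prod {n d : ℕ} {α : Fin n → ℝ} {g : Fin n → ℂˣ}
    (hα : ∀ i, 0 ≤ α i ∧ α i < 1) (hgα : ∀ i, (g i : ℂ) = ee (α i)) (hd : d ≤ n)
    (hm : ∀ i, g i ≠ 1 ↔ (i : ℕ) < d) :
    ee (-(1 / 2) * age α) * ∏ i ∈ Finset.univ.filter (fun i : Fin n => (i : ℕ) < d),
        ee (-(1 / 4)) / (2 * (Real.sin (α i * Real.pi) : ℂ)) =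
      (-1) ^ d * ∏ i ∈ Finset.univ.filter (fun i : Fin n => (i : ℕ) < d), (1 / (1 - (g i : ℂ))) := by
  have h1 : ee (-(1 / 2) * age α) = ∏ i ∈ Finset.univ.filter (fun i : Fin n => (i : ℕ) < d),
      ee (-(1 / 2) * α i) := by
    rw [age, Finset.mul_sum, ee_sum]
    symm
    refine Finset.prod_subset (Finset.filter_subset _ _) fun i _ hi => ?_
    -- Fixed coordinates have $\alpha_i=0$ because $0\le\alpha_i<1$, so the age only involves the
    -- moved ones.
    have hg : g i = 1 := by
      by_contra h
      exact hi (by simpa using (hm i).1 h)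
    have := hgα i
    rw [hg, Units.val_one] at this
    rw [eq_zero_of_ee_eq_one (hα i).1 (hα i).2 this.symm, mul_zero, ee_zero]
  have hcard : (Finset.univ.filter (fun i : Fin n => (i : ℕ) < d)).card = d := by
    rw [Fin.card_filter_val_lt, min_eq_right hd]
  conv_rhs => rw [← hcard, ← Finset.prod_const, hcard]
  rw [h1, ← Finset.prod_mul_distrib, ← Finset.prod_mul_distrib]
  refine Finset.prod_congr rfl fun i hi => ?_
  have hi := (hm i).2 (by simpa using hi)
  rw [ee_neg_half_mul _ (fun h => hi (Units.ext (by rw [hgα, h, Units.val_one]))), hgα]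
  ring

end Constant

/-! ### The constant `m` -/

section HConstant

variable {n : ℕ} {f : MvPolynomial (Fin n) ℂ} {g : Fin n → ℂˣ}

/-- For a chain, `A` and `B` are the products of the $a_i$ over the moved and the fixed indices, `z`
is the number of the moved Hessian minor `Dt`, and $\gamma=\prod1/(1-g_i)$. The defining equation
becomes $m=A/z$, so uniqueness needs only that the Hessian class is nonzero. -/
theorem hConstant_of_relations {Dt K P : MvPolynomial (Fin n) ℂ} {A B z γ : ℂ}
    (hP : rename Subtype.val (hess (fixPoly f g)) = P) (hD : ∀ m, hPoly f g m = C m * Dt)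
    (hA : A ≠ 0) (hB : B ≠ 0) (hz : z ≠ 0) (hμ : (milnorNumber f : ℂ) ≠ 0)
    (hμg : (milnorNumber (fixPoly f g) : ℂ) ≠ 0) (hh : jacMk f (hess f) ≠ 0)
    (h1 : (A * B * milnorNumber f) • jacMk f (P * Dt) =
      (B * milnorNumber (fixPoly f g) * z) • jacMk f (hess f))
    (h2 : z • jacMk f K = (A * γ) • jacMk f Dt) :
    (∃! m, IsHConstant f g m) ∧
      ∀ m, IsHConstant f g m → jacMk f K = γ • jacMk f (hPoly f g m) := by
  have h3 : jacMk f (P * Dt) =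
      ((milnorNumber (fixPoly f g) * z) / (A * milnorNumber f)) • jacMk f (hess f) := by
    have h4 := congrArg ((A * B * milnorNumber f : ℂ)⁻¹ • ·) h1
    simp only [smul_smul] at h4
    rw [inv_mul_cancel₀ (by positivity), one_smul] at h4
    rw [h4]
    congr 1
    field_simp
  have hiff : ∀ m, IsHConstant f g m ↔ m = A / z := by
    intro m
    rw [IsHConstant, hP, hD, show P * (C m * Dt) = m • (P * Dt) by
      rw [smul_eq_C_mul]; ring, map_smul, h3, smul_smul, smul_smul,
      (smul_left_injective ℂ hh).eq_iff]
    constructor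
    · intro h
      field_simp at h ⊢
      linear_combination h
    · rintro rfl
      field_simp
  refine ⟨⟨A / z, (hiff _).2 rfl, fun m hm => (hiff m).1 hm⟩, fun m hm => ?_⟩
  rw [(hiff m).1 hm, hD, ← smul_eq_C_mul, map_smul, smul_smul]
  have h4 := congrArg (z⁻¹ • ·) h2
  simp only [smul_smul] at h4
  rw [inv_mul_cancel₀ hz, one_smul] at h4
  rw [h4]
  congr 1
  field_simp

theorem hPoly_of_forall_ne (hm : ∀ i, g i ≠ 1) (m : ℂ) : hPoly f g m = C m * hess f := by
  have hmem : ∀ i, i ∈ movedIdx g := fun i => by simp [movedIdx, hm i]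
  rw [hPoly, hess, ← Matrix.det_submatrix_equiv_self (Equiv.subtypeUnivEquiv hmem).symm]
  congr 1
  convert rfl using 2
  ext
  rfl

theorem codim_eq_of_moved {d : ℕ} (hd : d ≤ n) (hm : ∀ i, g i ≠ 1 ↔ (i : ℕ) < d) :
    codim g = d := by
  have : movedIdx g = Finset.univ.filter fun i : Fin n => (i : ℕ) < d := by
    ext i
    simp [movedIdx, hm i]
  rw [codim, this, Fin.card_filter_val_lt, min_eq_right hd]

end HConstant

/-! ### Chains -/

section Chain

variable {N : ℕ} {a ε : Fin (N + 1) → ℕ} {g : Fin (N + 1) → ℂˣ}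

/-- The determinant of the second derivatives in the moved directions. -/
theorem chain_hPoly (hε : IsChainExp ε) {d : ℕ} (hd : d ≤ N + 1)
    (hm : ∀ i, g i ≠ 1 ↔ (i : ℕ) < d) (m : ℂ) :
    hPoly (cycPoly a ε) g m = C m *
      contin (fun i => C (a (cyc N i) * (a (cyc N i) - 1 : ℕ) : ℂ) *
          (X (cyc N i) ^ (a (cyc N i) - 1 - 1) * X (cyc N i + 1) ^ ε (cyc N i)))
        (fun i => -(C (a (cyc N i) * ε (cyc N i) : ℂ) * X (cyc N i) ^ (a (cyc N i) - 1) *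
          (C (a (cyc N i) * ε (cyc N i) : ℂ) * X (cyc N i) ^ (a (cyc N i) - 1)))) d := by
  let e : Fin d ≃ movedIdx g :=
    { toFun := fun i => ⟨cyc N i, by
        simp only [movedIdx, Finset.mem_filter, Finset.mem_univ, true_and, hm]
        rw [val_cyc (by omega)]
        exact i.2⟩
      invFun := fun i => ⟨(i : Fin (N + 1)), by simpa [movedIdx, hm] using i.2⟩
      left_inv := fun i => by
        ext
        simp only
        rw [val_cyc (by omega)]
      right_inv := fun i => by
        ext
        simp }
  rw [hPoly, ← Matrix.det_submatrix_equiv_self e, ← det_tri]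
  congr 2
  ext i j : 2
  simp only [Matrix.submatrix_apply, Matrix.of_apply]
  rw [pderiv_pderiv_cycPoly hε.le_one, cycMat_eq_tri (by simp [hε.last]) (by simp [hε.last])]
  simp only [tri, Matrix.of_apply, e, Equiv.coe_fn_mk, val_cyc (show (i : ℕ) < N + 1 by omega),
    val_cyc (show (j : ℕ) < N + 1 by omega)]

theorem hessContin_congr {b b' : ℕ → ℕ} {k : ℕ} (h : ∀ i < k, b i = b' i) :
    hessContin b k = hessContin b' k := by
  refine contin_congr (fun i hi => ?_) fun i hi => ?_
  · simp only [h i hi]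
  · simp only [h i (by omega), h (i + 1) hi]

/-- All terms are nonnegative and dimers are positive, so two consecutive continuants are never both
zero; a positive last diagonal term then makes the continuant positive. -/
theorem hessContin_ne_zero {b : ℕ → ℕ} (hb : ∀ i, 1 ≤ b i) {k : ℕ}
    (hk : ∀ j, j + 1 = k → 2 ≤ b j) : hessContin b k ≠ 0 := by
  set κ : ℕ → ℤ := fun i => b i * (b i - 1 : ℕ) with hκ
  set δ : ℕ → ℤ := fun i => b i ^ 2 * b (i + 1) with hδ
  have hcast : hessContin b k = ((contin κ δ k : ℤ) : ℂ) := by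
    change _ = Int.castRingHom ℂ _
    rw [map_contin, hessContin]
    simp [hκ, hδ]
  have hκ0 : ∀ i, 0 ≤ κ i := fun i => by positivity
  have hδ0 : ∀ i, 0 < δ i := fun i => by
    have h1 := hb i
    have h2 := hb (i + 1)
    positivity
  have hpos : ∀ k, 0 ≤ contin κ δ k ∧ 0 ≤ contin κ δ (k + 1) ∧
      (0 < contin κ δ k ∨ 0 < contin κ δ (k + 1)) := by
    intro k
    induction k with
    | zero => simpa using hκ0 0
    | succ k ih =>
      obtain ⟨h1, h2, h3⟩ := ih
      have h4 : 0 ≤ κ (k + 1) * contin κ δ (k + 1) := mul_nonneg (hκ0 _) h2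
      have h5 : 0 ≤ δ k * contin κ δ k := mul_nonneg (hδ0 _).le h1
      refine ⟨h2, by rw [contin_add_two]; exact add_nonneg h4 h5, ?_⟩
      rcases h3 with h3 | h3
      · right
        rw [contin_add_two]
        exact add_pos_of_nonneg_of_pos h4 (mul_pos (hδ0 _) h3)
      · exact Or.inl h3
  rw [hcast, Int.cast_ne_zero]
  have hlast : ∀ j, j + 1 = k → 0 < κ j := by
    intro j hj
    have := hk j hj
    have h1 : 0 < b j - 1 := by omega
    positivity
  rcases k with _ | _ | k
  · simp
  · exact (hlast 0 rfl).ne'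
  · obtain ⟨h1, h2, h3⟩ := hpos k
    rw [contin_add_two]
    rcases h3 with h3 | h3
    · exact (add_pos_of_nonneg_of_pos (mul_nonneg (hκ0 _) h2) (mul_pos (hδ0 _) h3)).ne'
    · exact (add_pos_of_pos_of_nonneg (mul_pos (hlast _ rfl) h3) (mul_nonneg (hδ0 _).le h1)).ne'

variable {w : Fin (N + 1) → ℤ} {D : ℤ}

/-- $f^g$ is a chain in the last variables, so `chain_milnor` for it expresses the number of its
Hessian as `B` times its Milnor number, with `B` the product of the remaining $a_i$. When everything
is moved, $f^g$ has no variables and `B = 1`. -/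
theorem chain_fix_data (ha : ∀ i, 1 ≤ a i) (hε : IsChainExp ε) (hl : 2 ≤ a (Fin.last N))
    (hw0 : ∀ i, 0 < w i) (hw : ∀ k, a k * w k + ε k * w (k + 1) = D)
    (hfin : Module.Finite ℂ (Jac (cycPoly a ε))) {d : ℕ} (hd : d ≤ N + 1)
    (hm : ∀ i, g i ≠ 1 ↔ (i : ℕ) < d) (had : ∀ i : Fin (N + 1), (i : ℕ) + 1 = d → 2 ≤ a i) :
    ∃ B : ℂ, B ≠ 0 ∧ (milnorNumber (fixPoly (cycPoly a ε) g) : ℂ) ≠ 0 ∧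
      (∏ i ∈ Finset.range d, (a (cyc N i) : ℂ)) * B = ∏ i, (a i : ℂ) ∧
      (rename Subtype.val (hess (fixPoly (cycPoly a ε) g)),
        B * milnorNumber (fixPoly (cycPoly a ε) g)) ∈
        cycRep a ε {Fin.last N}ᶜ (∑ i ∈ Finset.range (N + 1 - d), idx (cyc N (d + i))) := by
  rcases hd.lt_or_eq with hlt | rfl
  · obtain ⟨M, rfl⟩ : ∃ M, N = d + M := ⟨N - d, by omega⟩
    have ht := hε.tail (M := M)
    have hw' : ∀ k : Fin (M + 1), (a (cyc (d + M) (d + k)) : ℤ) * w (cyc (d + M) (d + k)) +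
        ε (cyc (d + M) (d + k)) * w (cyc (d + M) (d + (k + 1 : Fin (M + 1)))) = D := by
      intro k
      rw [← hw (cyc (d + M) (d + k))]
      congr 1
      by_cases hk : k = Fin.last M
      · rw [show ε (cyc (d + M) (d + k)) = 0 by rw [hk, Fin.val_last, cyc_last, hε.last]]
        simp
      · rw [← cyc_succ, Fin.val_add_one_of_lt (Fin.lt_last_iff_ne_last.2 hk), add_assoc d]
    have hfg := finite_jac_fixPoly (chain_restrictFix_pderiv ha hε hm had) hfin
    rw [chain_fixPoly ha hε hm] at hfg
    have hfin' := Module.Finite.equiv (jacRenameEquiv (chainFixEquiv hm)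
      (cycPoly (fun j => a (cyc (d + M) (d + j)))
        fun j => ε (cyc (d + M) (d + j)))).symm.toLinearEquiv
    have hmil := chain_milnor (fun j => ha _) ht (by rwa [Fin.val_last, cyc_last]) (fun i => hw0 _) hw' hfin'
    rw [hessContin_congr (b' := fun i => a (cyc (d + M) (d + i)))
      (fun i hi => by simp only [val_cyc hi])] at hmil
    have hne := hessContin_ne_zero (b := fun i => a (cyc (d + M) (d + i))) (k := M + 1)
      (fun i => ha _) (fun j hj => by
        obtain rfl : j = M := by omega
        rwa [cyc_last])
    have hprod : (∏ i ∈ Finset.range d, (a (cyc (d + M) i) : ℂ)) *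
        ∏ j : Fin (M + 1), (a (cyc (d + M) (d + j)) : ℂ) = ∏ i, (a i : ℂ) := by
      rw [← prod_range_cyc fun i => (a i : ℂ), ← Finset.prod_range fun j => (a (cyc (d + M) (d + j)) : ℂ),
        ← Finset.prod_range_add]
      rfl
    refine ⟨∏ j : Fin (M + 1), (a (cyc (d + M) (d + j)) : ℂ), ?_, ?_, hprod, ?_⟩
    · rw [hmil] at hne
      exact left_ne_zero_of_mul hne
    · rw [chain_fixPoly ha hε hm, milnorNumber_rename]
      rw [hmil] at hne
      exact right_ne_zero_of_mul hne
    · rw [chain_hess_fixPoly ha hε hm, chain_fixPoly ha hε hm, milnorNumber_rename, ← hmil,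
        show d + M + 1 - d = M + 1 by omega]
      exact chain_hess_contin_mem ha hε (by omega)
  · have hne : ∀ i, g i ≠ 1 := fun i => (hm i).2 i.2
    have : IsEmpty {i // g i = 1} := ⟨fun i => hne i i.2⟩
    refine ⟨1, one_ne_zero, ?_, ?_, ?_⟩
    · rw [milnorNumber_of_isEmpty]
      simp
    · rw [mul_one, prod_range_cyc fun i => (a i : ℂ)]
    · rw [milnorNumber_of_isEmpty, hess_of_isEmpty, map_one, Nat.sub_self, Finset.sum_range_zero]
      rw [Nat.cast_one, mul_one]
      exact SetLike.GradedOne.one_mem (A := cycRep a ε {Fin.last N}ᶜ)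

end Chain

/-! ### Comparison with `H_{g,g⁻¹}` -/

section Comparison

variable {N : ℕ} {g : Fin (N + 1) → ℂˣ}

theorem sigmaInv_eq_smul_hPoly {n d : ℕ} {f K : MvPolynomial (Fin n) ℂ} {g : Fin n → ℂˣ} {m : ℂ}
    {α : Fin n → ℝ} (hα : ∀ i, 0 ≤ α i ∧ α i < 1) (hgα : ∀ i, (g i : ℂ) = ee (α i)) (hd : d ≤ n)
    (hm : ∀ i, g i ≠ 1 ↔ (i : ℕ) < d)
    (hσ : sigmaInv f g = jacMk f (((-1 : ℤ) ^ d * revSign d) • K))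
    (hK : jacMk f K = (∏ i ∈ Finset.univ.filter (fun i : Fin n => (i : ℕ) < d),
      (1 / (1 - (g i : ℂ)))) • jacMk f (hPoly f g m)) :
    sigmaInv f g = ((-1 : ℂ) ^ (codim g * (codim g - 1) / 2) * ee (-(1 / 2) * age α) *
      ∏ i ∈ Finset.univ.filter (fun i : Fin n => (i : ℕ) < codim g),
        ee (-(1 / 4)) / (2 * (Real.sin (α i * Real.pi) : ℂ))) • jacMk f (hPoly f g m) := by
  rw [codim_eq_of_moved hd hm, mul_assoc, ee_age_mul_prod hα hgα hd hm, hσ,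
    ← Int.cast_smul_eq_zsmul ℂ, map_smul, hK, smul_smul, revSign]
  congr 1
  push_cast
  ring

variable {a ε : Fin (N + 1) → ℕ}

theorem prod_filter_lt_eq_prod_range_cyc {d : ℕ} (hd : d ≤ N + 1) (F : Fin (N + 1) → ℂ) :
    ∏ i ∈ Finset.univ.filter (fun i : Fin (N + 1) => (i : ℕ) < d), F i =
      ∏ i ∈ Finset.range d, F (cyc N i) := by
  symm
  refine Finset.prod_bij (fun i _ => cyc N i) (fun i hi => ?_) (fun i hi j hj h => ?_)
    (fun i hi => ⟨i, ?_, cyc_val i⟩) fun _ _ => rfl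
  · rw [Finset.mem_range] at hi
    simpa [val_cyc (show i < N + 1 by omega)] using hi
  · rw [Finset.mem_range] at hi hj
    have := congrArg Fin.val h
    rwa [val_cyc (by omega), val_cyc (by omega)] at this
  · simpa using hi

theorem chain_comparison (ha : ∀ i, 1 ≤ a i) (hε : IsChainExp ε)
    (hinv : IsInvertible (cycPoly a ε)) (hg : g ∈ maxSymGroup (cycPoly a ε)) (hg1 : g ≠ 1)
    {α : Fin (N + 1) → ℝ} (hα : ∀ i, 0 ≤ α i ∧ α i < 1) (hgα : ∀ i, (g i : ℂ) = ee (α i)) :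
    (∃! m : ℂ, IsHConstant (cycPoly a ε) g m) ∧ ∀ m : ℂ, IsHConstant (cycPoly a ε) g m →
      sigmaInv (cycPoly a ε) g =
        ((-1 : ℂ) ^ (codim g * (codim g - 1) / 2) * ee (-(1 / 2) * age α) *
          ∏ i ∈ Finset.univ.filter (fun i : Fin (N + 1) => (i : ℕ) < codim g),
            ee (-(1 / 4)) / (2 * (Real.sin (α i * Real.pi) : ℂ))) •
          jacMk (cycPoly a ε) (hPoly (cycPoly a ε) g m) := by
  obtain ⟨w, D, hw0, hw⟩ := hinv.cyc_weights
  have hχ := hinv.cyc_character hg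
  obtain ⟨d, hd0, hd, hm⟩ := chain_exists_moved hε hχ hg1
  have hl := chain_two_le_last ha hε hw0 hw hχ hg1
  have hfin := hinv.nondegenerate
  have hA := chain_cycAdm ha hε
  -- At the last moved index $g_i^{a_i}=1$; exponent 1 would make it fixed.
  have had : ∀ i : Fin (N + 1), (i : ℕ) + 1 = d → 2 ≤ a i := by
    intro i hi
    by_contra hlt
    have h1 : a i = 1 := by have := ha i; omega
    have h2 := hχ i
    have h3 : (g (i + 1) : ℂ) ^ ε i = 1 := by
      by_cases hil : i = Fin.last N
      · rw [hil, hε.last, pow_zero]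
      · have h4 := Fin.val_add_one_of_lt (Fin.lt_last_iff_ne_last.2 hil)
        have h5 : g (i + 1) = 1 := by
          by_contra h5
          have h6 := (hm _).1 h5
          rw [h4] at h6
          omega
        rw [h5, Units.val_one, one_pow]
    rw [h1, h3, pow_one, mul_one] at h2
    exact (hm i).2 (by omega) (Units.ext h2)
  obtain ⟨K, hσ, hK⟩ := chain_sigmaInv ha hε hχ hd0 hd hm
  obtain ⟨B, hB, hμg, hAB, hP⟩ := chain_fix_data ha hε hl hw0 hw hfin hd hm had
  have hDt := chain_hess_contin_mem ha hε (o := 0) (k := d) (by omega)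
  simp only [zero_add] at hDt
  have hz := hessContin_ne_zero (b := fun i => a (cyc N i)) (k := d) (fun i => ha _)
    (fun j hj => had _ (by rwa [val_cyc (by omega)]))
  have hne : ∏ i, (a i : ℂ) ≠ 0 := by
    rw [Finset.prod_ne_zero_iff]
    intro i _
    have := ha i
    exact Nat.cast_ne_zero.2 (by omega)
  have hhess := chain_hess_mem ha hε
  have hμ := hessContin_ne_zero (b := fun i => a (cyc N i)) (k := N + 1) (fun i => ha _)
    (fun j hj => by
      obtain rfl : j = N := by omega
      rwa [cyc_last])
  have hh : jacMk (cycPoly a ε) (hess (cycPoly a ε)) ≠ 0 := by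
    rw [Ne, jacMk_eq_zero_iff]
    intro h
    have h1 := hA.kills ha hε.le_one h
    rw [hA.apply_of_mem rfl hhess] at h1
    exact hμ h1
  rw [chain_milnor ha hε hl hw0 hw hfin] at hhess hμ
  -- The moved minor and the Hessian of $f^g$ have complementary degrees, so their product has the
  -- same degree $S=1$ as the full Hessian.
  have hPD := SetLike.GradedMul.mul_mem (A := cycRep a ε {Fin.last N}ᶜ) hP hDt
  rw [Prod.mk_mul_mk, add_comm (∑ i ∈ Finset.range (N + 1 - d), _), ← Finset.sum_range_add,
    Nat.add_sub_cancel' hd, sum_idx] at hPD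
  obtain ⟨hex, hall⟩ := hConstant_of_relations
    (γ := ∏ i ∈ Finset.univ.filter (fun i : Fin (N + 1) => (i : ℕ) < d), (1 / (1 - (g i : ℂ))))
    (K := K) rfl (chain_hPoly hε hd hm)
    (left_ne_zero_of_mul (hAB.trans_ne hne)) hB hz (right_ne_zero_of_mul hμ) hμg hh
    (by
      rw [hAB]
      exact hA.jacMk_eq ha hε.le_one hw0 hw (by rwa [chain_apply_casimir ha hε hl])
        (chain_cycRep_le ha hε _ hPD) hhess)
    (by
      rw [prod_filter_lt_eq_prod_range_cyc hd, ← Finset.prod_mul_distrib]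
      exact chain_jacMk_eq ha hε hl hw0 hw hK hDt)
  exact ⟨hex, fun m hm' => sigmaInv_eq_smul_hPoly hα hgα hd hm hσ (hall m hm')⟩

theorem loop_comparison {k : ℕ} {a : Fin (k + 1 + 1) → ℕ} {g : Fin (k + 1 + 1) → ℂˣ}
    (ha : ∀ i, 1 ≤ a i)
    (hinv : IsInvertible (cycPoly a 1)) (hg : g ∈ maxSymGroup (cycPoly a 1)) (hg1 : g ≠ 1)
    {α : Fin (k + 1 + 1) → ℝ} (hα : ∀ i, 0 ≤ α i ∧ α i < 1) (hgα : ∀ i, (g i : ℂ) = ee (α i)) :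
    (∃! m : ℂ, IsHConstant (cycPoly a 1) g m) ∧ ∀ m : ℂ, IsHConstant (cycPoly a 1) g m →
      sigmaInv (cycPoly a 1) g =
        ((-1 : ℂ) ^ (codim g * (codim g - 1) / 2) * ee (-(1 / 2) * age α) *
          ∏ i ∈ Finset.univ.filter (fun i : Fin (k + 1 + 1) => (i : ℕ) < codim g),
            ee (-(1 / 4)) / (2 * (Real.sin (α i * Real.pi) : ℂ))) •
          jacMk (cycPoly a 1) (hPoly (cycPoly a 1) g m) := by
  obtain ⟨w, D, hw0, hw⟩ := hinv.cyc_weights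
  have hχ := hinv.cyc_character hg
  have hinj := hinv.cyc_inj
  have hA1 := hw
  simp only [Pi.one_apply, pow_one, Nat.cast_one, one_mul] at hw hχ hinj
  have hne := loop_moved hχ hg1
  have hm : ∀ i, g i ≠ 1 ↔ (i : ℕ) < k + 2 := fun i => ⟨fun _ => i.2, fun _ => hne i⟩
  have hfin := hinv.nondegenerate
  have hA := loop_cycAdm ha hinj
  have h0 : loopAdm (0 : Fin (k + 1 + 1) → ℤ) := ⟨fun _ => le_rfl, 0, rfl⟩
  have hc := loop_prod_ne hinj
  obtain ⟨K, hσ, hK⟩ := loop_sigmaInv ha hinj hw0 hw hχ hne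
  have hhess := loop_hess_mem ha hinj hw0 hw hfin
  have hnt : Nontrivial (Jac (cycPoly a 1)) := by
    refine ⟨jacMk _ (C 1 * ∏ i, X i ^ (a i - 1)), 0, ?_⟩
    rw [Ne, jacMk_eq_zero_iff]
    intro h
    have h1 := hA.kills ha (fun _ => le_rfl) h
    rw [hA.apply_of_mem h0 (loop_prod_mem ha hinj hw0 hw 1)] at h1
    exact one_ne_zero h1
  have hμ : (milnorNumber (cycPoly a 1) : ℂ) ≠ 0 :=
    Nat.cast_ne_zero.2 (Module.finrank_pos (R := ℂ) (M := Jac (cycPoly a 1))).ne'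
  have hh : jacMk (cycPoly a 1) (hess (cycPoly a 1)) ≠ 0 := by
    rw [Ne, jacMk_eq_zero_iff]
    intro h
    have h1 := hA.kills ha (fun _ => le_rfl) h
    rw [hA.apply_of_mem h0 hhess] at h1
    exact mul_ne_zero hc hμ h1
  have : IsEmpty {i // g i = 1} := ⟨fun i => hne i i.2⟩
  -- `K` and the Hessian have numbers $c\prod1/(1-g_i)$ and $c\,\mu_f$ with the same $c=\prod
  -- a_i-(-1)^n\ne0$, which is cancelled below.
  have hKH := hA.jacMk_eq ha (fun _ => le_rfl) hw0 hA1
    (by rwa [loop_apply_casimir ha hinj hw0 hw]) hK hhess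
  rw [mul_comm (∏ i, invSub g i), mul_smul, mul_smul] at hKH
  obtain ⟨hex, hall⟩ := hConstant_of_relations (A := 1) (B := 1)
    (γ := ∏ i ∈ Finset.univ.filter (fun i : Fin (k + 2) => (i : ℕ) < k + 2),
      (1 / (1 - (g i : ℂ))))
    (K := K) (P := 1) (by rw [hess_of_isEmpty, map_one]) (hPoly_of_forall_ne hne)
    one_ne_zero one_ne_zero hμ hμ (by rw [milnorNumber_of_isEmpty]; simp) hh
    (by rw [milnorNumber_of_isEmpty (fixPoly (cycPoly a 1) g)]; simp)
    (by
      rw [Finset.filter_true_of_mem fun i _ => i.2, one_mul]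
      exact smul_right_injective _ hc hKH)
  exact ⟨hex, fun m hm' => sigmaInv_eq_smul_hPoly hα hgα le_rfl hm hσ (hall m hm')⟩

end Comparison

end OrbifoldJac

end

/-! ### The proposition, by reduction to cyclic polynomials -/

theorem proposition5p3 (n : ℕ) (a : Fin n → ℕ) (ha : ∀ i, 1 ≤ a i)
    (f : MvPolynomial (Fin n) ℂ)
    (hf : f = OrbifoldJac.chainPoly a ∨ (2 ≤ n ∧ f = OrbifoldJac.loopPoly a))
    (hinv : OrbifoldJac.IsInvertible f)
    (g : Fin n → ℂˣ) (hg : g ∈ OrbifoldJac.maxSymGroup f) (hg1 : g ≠ 1)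
    (α : Fin n → ℝ) (hα : ∀ i, 0 ≤ α i ∧ α i < 1) (hgα : ∀ i, (g i : ℂ) = OrbifoldJac.ee (α i)) :
    (∃! m : ℂ, OrbifoldJac.IsHConstant f g m) ∧
    ∀ m : ℂ, OrbifoldJac.IsHConstant f g m →
      OrbifoldJac.sigmaInv f g =
        ((-1 : ℂ) ^ (OrbifoldJac.codim g * (OrbifoldJac.codim g - 1) / 2) *
          OrbifoldJac.ee (-(1 / 2) * OrbifoldJac.age α) *
          ∏ i ∈ Finset.univ.filter (fun i : Fin n => (i : ℕ) < OrbifoldJac.codim g),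
            OrbifoldJac.ee (-(1 / 4)) / (2 * (Real.sin (α i * Real.pi) : ℂ))) •
        OrbifoldJac.jacMk f (OrbifoldJac.hPoly f g m) := by
  cases n with
  | zero => exact absurd (Subsingleton.elim g 1) hg1
  | succ N =>
    rcases hf with rfl | ⟨hn, rfl⟩
    · have hε : OrbifoldJac.IsChainExp (N := N) fun i => if i = Fin.last N then 0 else 1 :=
        fun _ => rfl
      rw [OrbifoldJac.chainPoly_eq_cycPoly hε] at hinv hg ⊢
      exact OrbifoldJac.chain_comparison ha hε hinv hg hg1 hα hgα
    · obtain ⟨k, rfl⟩ : ∃ k, N = k + 1 := ⟨N - 1, by omega⟩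
      rw [OrbifoldJac.loopPoly_eq_cycPoly] at hinv hg ⊢
      exact OrbifoldJac.loop_comparison ha hinv hg hg1 hα hgα
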